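/- Let $E$ be a Euclidean space of finite dimension $d\ge 2$, let $N\ge 2$, and let $m_1,\dots,m_N>0$ be masses. Equip $E^N$ with the mass inner product $\langle x,y\rangle=\sum_i m_i\langle x_i,y_i\rangle_E$ and its norm $\|\cdot\|$. Let $\Omega=\{x\in E^N : x_i\ne x_j \text{ for } i\ne j\}$, $\Delta=E^N\setminus\Omega$, and let $U(x)=\sum_{i<j}m_im_j\|x_i-x_j\|_E^{-1}$ be the Newtonian potential, with $U=+\infty$ on $\Delta$. A motion is a solution in $\Omega$ of Newton's equation $\ddot\gamma=\nabla U(\gamma)$ (gradient for the mass inner product). A curve $\gamma:[0,+\infty)\to E^N$ has limit shape $a$ if $\gamma(t)=ta+o(t)$ as $t\to+\infty$; for $a\in\Omega$, a motion $\gamma:[0,+\infty)\to\Omega$ with limit shape $a$ is called a hyperbolic motion with limit shape $a$. For $h\ge 0$ let $\mathcal A_{L+h}(\sigma)=\int\big(\tfrac12\|\dot\sigma\|^2+U(\sigma)+h\big)\,dt$ for an absolutely continuous curve $\sigma$ in $E^N$ on a compact interval, and let $\phi_h(x,y)$ be the infimum of $\mathcal A_{L+h}(\sigma)$ over all absolutely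 continuous curves $\sigma:[0,\tau]\to E^N$, $\tau>0$ arbitrary, from $x$ to $y$ (the Jacobi–Maupertuis distance of level $h$). A curve $\gamma:[0,+\infty)\to E^N$, absolutely continuous on compact intervals, is a geodesic ray of the Jacobi–Maupertuis metric of level $h$ if $\phi_h(\gamma(0),\gamma(t))=\mathcal A_{L+h}(\gamma|_{[0,t]})$ for all $t\ge 0$. For $a\in\Omega$, $\alpha\in(0,1)$ and $r>0$ let $\mathscr C_a(\alpha)=\{x\in E^N : \langle x,a\rangle\ge\alpha\|x\|\|a\|\}$, let $\mathscr C_a(\alpha,r)=\{x\in\mathscr C_a(\alpha) : \|x\|\ge r\}$ (the cut cone), and let $\alpha_0(a)=\inf\{\beta\in(0,1) : \mathscr C_a(\beta)\cap\Delta=\{0\}\}$. **Theorem (Theorem of the cone).** Let $a\in\Omega$ and let $\alpha\in(0,1)$ with $\alpha>\alpha_0(a)$. Then there is $r>0$ such that for every $x\in\mathscr C_a(\alpha,r)$ the following two assertions hold. (1) There is a unique hyperbolic motion $\gamma:[0,+\infty)\to\Omega$ with limit shape $a$ and $\gamma(0)=x$ such that $\gamma(t)\in\mathscr C_a(\alpha,r)$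 for all $t\ge 0$. (2) This curve $\gamma$ is the unique geodesic ray of the Jacobi–Maupertuis metric of level $h=\tfrac12\|a\|^2$ that starts at $x$ and has limit shape $a$. -/

import Mathlib

open Set Filter Topology MeasureTheory Asymptotics

namespace NBody

noncomputable section

/-- The set `Ω` of configurations without collisions in `E^N`. -/
def collisionFree (N : ℕ) (E : Type*) : Set (Fin N → E) :=
  {x | ∀ i j, i ≠ j → x i ≠ x j}

/-- The set `Δ = E^N \ Ω` of configurations with collisions. -/
def collisionSet (N : ℕ) (E : Type*) : Set (Fin N → E) :=
  (collisionFree N E)ᶜ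

section

variable {N : ℕ} {E : Type*} [NormedAddCommGroup E] [InnerProductSpace ℝ E]

/-- The mass inner product `⟪x, y⟫ = ∑ i, m i * ⟪x i, y i⟫_E` on `E^N`. -/
def massInner (m : Fin N → ℝ) (x y : Fin N → E) : ℝ :=
  ∑ i, m i * inner ℝ (x i) (y i)

/-- The norm on `E^N` of the mass inner product. -/
def massNorm (m : Fin N → ℝ) (x : Fin N → E) : ℝ :=
  Real.sqrt (massInner m x x)

/-- The Newtonian potential `U(x) = ∑_{i<j} m_i m_j / r_ij`, with value `∞` at collisions. -/
def potential (m : Fin N → ℝ) (x : Fin N → E) : ENNReal :=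
  ∑ i, ∑ j ∈ Finset.Ioi i,
    ENNReal.ofReal (m i * m j) / ENNReal.ofReal ‖x i - x j‖

/-- The gradient `∇U` of the Newtonian potential on `Ω` for the mass inner product: its `i`-th
component is `(1 / m_i) ∂U/∂r_i = ∑_{j ≠ i} m_j (r_j - r_i) / r_ij ^ 3`. -/
def gradPotential (m : Fin N → ℝ) (x : Fin N → E) : Fin N → E :=
  fun i => ∑ j ∈ Finset.univ.erase i, (m j / ‖x j - x i‖ ^ 3) • (x j - x i)

/-- `γ` restricted to `[0, +∞)` is a motion: it avoids collisions and solves Newton's equation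
`γ'' = ∇U(γ)` (with one-sided derivatives at `0`). -/
def IsMotion (m : Fin N → ℝ) (γ : ℝ → Fin N → E) : Prop :=
  (∀ t, 0 ≤ t → γ t ∈ collisionFree N E) ∧
  ∃ v : ℝ → Fin N → E, ∀ t, 0 ≤ t →
    HasDerivWithinAt γ (v t) (Ici 0) t ∧
    HasDerivWithinAt v (gradPotential m (γ t)) (Ici 0) t

/-- `γ` has limit shape `a`: `γ(t) = t a + o(t)` as `t → +∞`. -/
def HasLimitShape (γ : ℝ → Fin N → E) (a : Fin N → E) : Prop :=
  (fun t : ℝ => γ t - t • a) =o[atTop] (fun t : ℝ => t)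

/-- `γ : [0, +∞) → Ω` is a hyperbolic motion with limit shape `a` (used for `a ∈ Ω`). -/
def IsHyperbolicMotion (m : Fin N → ℝ) (a : Fin N → E) (γ : ℝ → Fin N → E) : Prop :=
  IsMotion m γ ∧ HasLimitShape γ a

/-- The Lagrangian `L(x, v) = ‖v‖² / 2 + U(x)`, with value `∞` at collisions. -/
def lagrangian (m : Fin N → ℝ) (x v : Fin N → E) : ENNReal :=
  ENNReal.ofReal (massNorm m v ^ 2 / 2) + potential m x

/-- The action `∫ (L + h)` of the curve `γ` over `[s, t]`, for `h ≥ 0`. -/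
def action (m : Fin N → ℝ) (h : ℝ) (γ : ℝ → Fin N → E) (s t : ℝ) : ENNReal :=
  ∫⁻ u in Icc s t, (lagrangian m (γ u) (deriv γ u) + ENNReal.ofReal h)

/-- The Jacobi-Maupertuis distance `φ_h(x, y)`: the infimum of the action of `L + h` over all
absolutely continuous curves from `x` to `y`, possibly with collisions, of any duration `τ > 0`. -/
def jmDist (m : Fin N → ℝ) (h : ℝ) (x y : Fin N → E) : ENNReal :=
  ⨅ (τ : ℝ) (σ : ℝ → Fin N → E) (_ : 0 < τ) (_ : AbsolutelyContinuousOnInterval σ 0 τ)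
    (_ : σ 0 = x) (_ : σ τ = y), action m h σ 0 τ

/-- `γ : [0, +∞) → E^N` is a geodesic ray of the Jacobi-Maupertuis metric of level `h`: it is
absolutely continuous on compact intervals, and minimizes the action of `L + h` in free time. -/
def IsGeodesicRay (m : Fin N → ℝ) (h : ℝ) (γ : ℝ → Fin N → E) : Prop :=
  ∀ t, 0 ≤ t → AbsolutelyContinuousOnInterval γ 0 t ∧
    jmDist m h (γ 0) (γ t) = action m h γ 0 t

/-- The cone `C_a(α)` with axis `ℝ⁺ a` and angle `arccos α`. -/
def cone (m : Fin N → ℝ) (a : Fin N → E) (α : ℝ) : Set (Fin N → E) :=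
  {x | α * massNorm m x * massNorm m a ≤ massInner m x a}

/-- The cut cone `C_a(α, r)`: the cone minus the open ball of radius `r`. -/
def cutCone (m : Fin N → ℝ) (a : Fin N → E) (α r : ℝ) : Set (Fin N → E) :=
  cone m a α \ {x | massNorm m x < r}

/-- `α₀(a) = inf {α ∈ (0, 1) | C_a(α) ∩ Δ = {0}}`. -/
def alphaZero (m : Fin N → ℝ) (a : Fin N → E) : ℝ :=
  sInf {α | α ∈ Ioo (0 : ℝ) 1 ∧ cone m a α ∩ collisionSet N E = {0}}

end

end

end NBody

/-! Multiplying the `i`-th component by `√mᵢ` turns `E^N` with the mass inner product into a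
Euclidean space `V`. Since `α > α₀(a)`, there is `β < α` such that the cone of parameter `β`
contains no collision but its vertex. On this cone all mutual distances dominate a multiple of the
linear functional `q x = 2⟪x, a⟫ / ‖a‖²`, so that `U = O(1/q)`, `∇U = O(1/q²)` and `∇U` is
Lipschitz with constant `O(1/q³)` (`exists_newtonianOn_roundCone`). Everything else uses only
these bounds and Euler's identity `⟪∇U(x), x⟫ = -U(x)`, and is carried out for an abstract force
field on the far part `q ≥ ρ` of the cone, called the region (`FarField`).

*Rays.* Displacements of mean velocity close to `a` keep the cone invariant and increase `q` at
unit speed at least, so that forces along such curves are `O(1/(ρ + t)²)`. Prescribing the initial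
position `x` and the limit velocity `b` close to `a`, the velocity is a fixed point of a
contraction (`exists_sol`); the resulting curve is the ray from `x` with limit velocity `b`, and
rays depend in a Lipschitz way on `x` and `b` (`Sol.norm_sub_le`). For `b = a` the rays have limit
shape `a` and stay in the cut cone of parameter `α` (`ray_mem_cone`).

*Uniqueness among motions.* The velocity of a motion with limit shape `a` converges to `a`
(`vel_tendsto`). If the motion stays in the cut cone, then the Lagrange-Jacobi identity bounds the
total variation of its velocity by `O(1/r)` (`sol_of_motion`), so that it is one of the rays,
which are determined by their initial points.

*Calibration.* Let `X` be the vector field whose value at `x` is the initial velocity of the ray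
from `x` with limit velocity `b`. By conservation of energy and Euler's identity, the action of a
ray is an explicit function of its end points, velocities and duration; the limit of differences
of these functions is a generating function with gradient `X` and Lipschitz derivative
(`gen_quadratic`). Since `‖X‖² = ‖b‖² + 2U`, the action of level `‖b‖²/2` of a curve in the region
is the increment of the generating function plus the integral of `‖σ' - X(σ)‖²/2`. It is therefore
at least this increment, with equality exactly for rays.

*Curves leaving the region.* The generating function differs from `⟪x, a⟫` by a small multiple of
`‖x‖`, up to constants. The radial function `ψ = θ‖a‖‖x‖ + const` with `θ = (α + β)/2` exceeds it
on the boundary of the region and is exceeded by it in the smaller cone. An excursion from the set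
where `gen > ψ` costs more than the increment of `ψ`, because the Lipschitz constant of `ψ` is
less than `‖a‖` (`barrier`, `cone_barrier`). So the generating function bounds the action of all
curves between points of the cut cone, collisions or not, and rays minimize (`isMinimizing_ray`).

*Uniqueness among geodesic rays.* Let `η` be a geodesic ray with limit shape `a`, and let `b` be
the direction of the chord from `η(0)` to `η(s)`, of norm `‖a‖`. The ray from `η(0)` with limit
velocity `b` misses `η(s)` by a logarithm of the distance only, and correcting this error costs an
action that tends to zero (`exists_curve_of_add_smul`). Comparing with `η` and letting `s → ∞`, so
that `b → a`, shows that the action of `η` is the increment of the generating function for `a`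
(`curveAction_le_of_isMinimizing`); by calibration, `η` is a ray.
-/

namespace NBody

/-! ### Curves with dominated derivative -/

section Dominated

variable {V : Type*} [NormedAddCommGroup V] [NormedSpace ℝ V]

lemma norm_sub_le_of_norm_deriv_le {f f' : ℝ → V} {g g' : ℝ → ℝ}
    (hf : ∀ t, 0 ≤ t → HasDerivWithinAt f (f' t) (Ici 0) t)
    (hg : ∀ t, 0 ≤ t → HasDerivWithinAt g (g' t) (Ici 0) t)
    (h : ∀ t, 0 ≤ t → ‖f' t‖ ≤ g' t) {s t : ℝ} (hs : 0 ≤ s) (hst : s ≤ t) :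
    ‖f t - f s‖ ≤ g t - g s := by
  have hsub : Icc s t ⊆ Ici (0 : ℝ) := fun x hx => hs.trans hx.1
  refine image_norm_le_of_norm_deriv_right_le_deriv_boundary' (f := fun x => f x - f s)
    (f' := f') (B := fun x => g x - g s) (B' := g') (a := s) (b := t) ?_ ?_ (by simp) ?_ ?_
    (fun x hx => h x (hs.trans hx.1)) (right_mem_Icc.2 hst)
  · exact fun x hx => (((hf x (hs.trans hx.1)).continuousWithinAt).mono hsub).sub
      continuousWithinAt_const
  · exact fun x hx => (((hf x (hs.trans hx.1)).mono (Ici_subset_Ici.2 (hs.trans hx.1))).sub_const _)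
  · exact fun x hx => (((hg x (hs.trans hx.1)).continuousWithinAt).mono hsub).sub
      continuousWithinAt_const
  · exact fun x hx => (((hg x (hs.trans hx.1)).mono (Ici_subset_Ici.2 (hs.trans hx.1))).sub_const _)

lemma norm_lim_sub_le {V : Type*} [NormedAddCommGroup V] {f : ℝ → V} {g : ℝ → ℝ} {L : V} {l : ℝ}
    (h : ∀ s t, 0 ≤ s → s ≤ t → ‖f t - f s‖ ≤ g t - g s)
    (hf : Tendsto f atTop (𝓝 L)) (hg : Tendsto g atTop (𝓝 l)) {s : ℝ} (hs : 0 ≤ s) :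
    ‖L - f s‖ ≤ l - g s :=
  le_of_tendsto_of_tendsto ((hf.sub_const _).norm) (hg.sub_const _)
    ((eventually_ge_atTop s).mono fun t ht => h s t hs ht)

lemma exists_tendsto_of_norm_sub_le {V : Type*} [NormedAddCommGroup V] [CompleteSpace V]
    {f : ℝ → V} {g : ℝ → ℝ} {l : ℝ}
    (h : ∀ s t, 0 ≤ s → s ≤ t → ‖f t - f s‖ ≤ g t - g s)
    (hg : Tendsto g atTop (𝓝 l)) : ∃ L, Tendsto f atTop (𝓝 L) := by
  apply cauchySeq_tendsto_of_complete
  have hgc := hg.cauchySeq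
  rw [Metric.cauchySeq_iff']
  rw [Metric.cauchySeq_iff] at hgc
  intro e he
  obtain ⟨T, hT⟩ := hgc e he
  refine ⟨max T 0, fun t ht => ?_⟩
  have h1 := h (max T 0) t (le_max_right _ _) ht
  have h3 := hT t ((le_max_left _ _).trans ht) (max T 0) (le_max_left _ _)
  rw [Real.dist_eq] at h3
  rw [dist_eq_norm]
  exact h1.trans_lt ((le_abs_self _).trans_lt h3)

end Dominated

lemma hasDerivAt_neg_div {ρ t : ℝ} (k : ℝ) (h : ρ + t ≠ 0) :
    HasDerivAt (fun t => -(k / (ρ + t))) (k / (ρ + t) ^ 2) t := by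
  have h1 : HasDerivAt (fun t => ρ + t) 1 t := (hasDerivAt_id t).const_add ρ
  have := ((h1.inv h).const_mul k).neg
  refine this.congr_deriv ?_ |>.congr_of_eventuallyEq (Eventually.of_forall fun s => ?_)
  · field_simp
  · simp [div_eq_mul_inv]

lemma hasDerivAt_neg_div_sq {ρ t : ℝ} (k : ℝ) (h : ρ + t ≠ 0) :
    HasDerivAt (fun t => -(k / (2 * (ρ + t) ^ 2))) (k / (ρ + t) ^ 3) t := by
  have h1 : HasDerivAt (fun t => ρ + t) 1 t := (hasDerivAt_id t).const_add ρ
  have := (((h1.pow 2).inv (pow_ne_zero 2 h)).const_mul (k / 2)).neg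
  refine this.congr_deriv ?_ |>.congr_of_eventuallyEq (Eventually.of_forall fun s => ?_)
  · simp; field_simp
  · simp [div_eq_mul_inv]; ring

lemma tendsto_neg_div (k ρ : ℝ) : Tendsto (fun t => -(k / (ρ + t))) atTop (𝓝 0) := by
  have h : Tendsto (fun t : ℝ => ρ + t) atTop atTop := tendsto_atTop_add_const_left _ _ tendsto_id
  simpa using (h.const_div_atTop k).neg

lemma tendsto_neg_div_sq (k ρ : ℝ) : Tendsto (fun t => -(k / (2 * (ρ + t) ^ 2))) atTop (𝓝 0) := by
  have h : Tendsto (fun t : ℝ => ρ + t) atTop atTop := tendsto_atTop_add_const_left _ _ tendsto_id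
  have h2 : Tendsto (fun t : ℝ => 2 * (ρ + t) ^ 2) atTop atTop :=
    ((tendsto_pow_atTop (by norm_num)).comp h).const_mul_atTop (by norm_num)
  simpa using (h2.const_div_atTop k).neg

/-- A function that agrees to second order with a linear functional along the values of a curve can
be differentiated along the curve. -/
lemma hasDerivWithinAt_comp_of_quadratic {V : Type*} [NormedAddCommGroup V] [InnerProductSpace ℝ V]
    {f : V → ℝ} {G v : V} {C t : ℝ} {γ : ℝ → V} {T : Set ℝ}
    (hf : ∀ s ∈ T, |f (γ s) - f (γ t) - inner ℝ G (γ s - γ t)| ≤ C * ‖γ s - γ t‖ ^ 2)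
    (hγ : HasDerivWithinAt γ v T t) : HasDerivWithinAt (fun s => f (γ s)) (inner ℝ G v) T t := by
  have h1 : HasDerivWithinAt (fun s => inner ℝ G (γ s)) (inner ℝ G v) T t := by
    have := (hasDerivWithinAt_const t T G).inner ℝ hγ
    simpa using this
  have hO : (fun s => γ s - γ t) =O[𝓝[T] t] fun s => s - t := by
    have := hγ.isBigO_sub
    rwa [prod_pure, isBigO_map] at this
  have h2 : (fun s => f (γ s) - f (γ t) - inner ℝ G (γ s - γ t)) =o[𝓝[T] t] fun s => s - t := by
    have hb : (fun s => f (γ s) - f (γ t) - inner ℝ G (γ s - γ t)) =O[𝓝[T] t]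
        fun s => ‖γ s - γ t‖ ^ 2 :=
      IsBigO.of_bound C (eventually_mem_nhdsWithin.mono fun s hs => by
        simpa using hf s hs)
    refine hb.trans_isLittleO ((hO.norm_left.pow 2).trans_isLittleO ?_)
    have hz : (fun s : ℝ => s - t) =o[𝓝[T] t] fun _ => (1 : ℝ) := by
      rw [isLittleO_one_iff]
      have : Tendsto (fun s : ℝ => s - t) (𝓝 t) (𝓝 (t - t)) := tendsto_id.sub_const t
      simpa using this.mono_left nhdsWithin_le_nhds
    simpa [pow_two] using (isBigO_refl (fun s : ℝ => s - t) (𝓝[T] t)).mul_isLittleO hz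
  have h3 := (hasDerivWithinAt_iff_isLittleO.1 h1).add h2
  rw [hasDerivWithinAt_iff_isLittleO]
  refine h3.congr_left fun s => ?_
  simp only [inner_sub_right]
  ring

/-! ### Asymptotically uniform solutions of Newton's equation -/

/-- On the part `q > 0` of `dom`, the potential `u` with force field `F` decays like a Newtonian
potential: `u = O(1/q)` and `F = O(1/q²)`, with the corresponding first and second order bounds, and
`u` satisfies Euler's identity for homogeneous functions of degree `-1`. -/
structure NewtonianOn {V : Type*} [NormedAddCommGroup V] [InnerProductSpace ℝ V] (dom : Set V)
    (q : V →L[ℝ] ℝ) (u : V → ℝ) (F : V → V) (k : ℝ) : Prop where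
  k_nonneg : 0 ≤ k
  u_nonneg : ∀ x ∈ dom, 0 < q x → 0 ≤ u x
  u_le : ∀ x ∈ dom, 0 < q x → u x ≤ k / q x
  norm_F_le : ∀ x ∈ dom, 0 < q x → ‖F x‖ ≤ k / q x ^ 2
  lip : ∀ x ∈ dom, ∀ y ∈ dom, ∀ σ, 0 < σ → σ ≤ q x → σ ≤ q y → ‖F x - F y‖ ≤ k * ‖x - y‖ / σ ^ 3
  taylor : ∀ x ∈ dom, ∀ y ∈ dom, ∀ σ, 0 < σ → σ ≤ q x → σ ≤ q y →
    |u y - u x - inner ℝ (F x) (y - x)| ≤ k * ‖y - x‖ ^ 2 / σ ^ 3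
  euler : ∀ x ∈ dom, 0 < q x → inner ℝ (F x) x = -u x

/-- A Newtonian force field on a convex domain that is invariant under displacements of mean
velocity `ε`-close to `a`, where the linear functional `q` grows at least at unit speed along such
displacements. The far part of the domain is cut off at a level `ρ` of `q` beyond which the forces,
whose constant is `k`, are small compared with `ε`. -/
structure FarField (V : Type*) [NormedAddCommGroup V] [InnerProductSpace ℝ V] where
  a : V
  dom : Set V
  q : V →L[ℝ] ℝ
  u : V → ℝ
  F : V → V
  ε : ℝ
  k : ℝ
  ρ : ℝ
  newton : NewtonianOn dom q u F k
  ε_pos : 0 < ε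
  ρ_pos : 0 < ρ
  convex_dom : Convex ℝ dom
  add_mem : ∀ x ∈ dom, ∀ t, 0 ≤ t → ∀ w, ‖w - t • a‖ ≤ ε * t → x + w ∈ dom
  le_q : ∀ t, 0 ≤ t → ∀ w, ‖w - t • a‖ ≤ ε * t → t ≤ q w
  k_le : 4 * k ≤ ρ
  k_le_mul : 4 * k ≤ ρ * ε

namespace FarField

variable {V : Type*} [NormedAddCommGroup V] [InnerProductSpace ℝ V] (S : FarField V)

/-- The far part of the domain. -/
def region : Set V := {x | x ∈ S.dom ∧ S.ρ ≤ S.q x}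

/-- `γ` is a solution of Newton's equation on `[0, +∞)` with velocity `v`, starting at a point `x`
of the region, whose velocity stays close to `b` and converges to `b`. -/
structure Sol (b x : V) (γ v : ℝ → V) : Prop where
  mem : x ∈ S.region
  near : ‖b - S.a‖ ≤ S.ε / 2
  init : γ 0 = x
  deriv_pos : ∀ t, 0 ≤ t → HasDerivWithinAt γ (v t) (Ici 0) t
  deriv_vel : ∀ t, 0 ≤ t → HasDerivWithinAt v (S.F (γ t)) (Ici 0) t
  vel_near : ∀ t, 0 ≤ t → ‖v t - b‖ ≤ S.ε / 2
  lim : Tendsto v atTop (𝓝 b)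

variable {S}

lemma convex_region : Convex ℝ S.region :=
  S.convex_dom.inter (convex_halfSpace_ge S.q.isLinear S.ρ)

lemma add_mem_region {x w : V} {σ t : ℝ} (hx : x ∈ S.dom) (hσ : σ ≤ S.q x) (ht : 0 ≤ t)
    (hw : ‖w - t • S.a‖ ≤ S.ε * t) : x + w ∈ S.dom ∧ σ + t ≤ S.q (x + w) :=
  ⟨S.add_mem x hx t ht w hw, by rw [map_add]; exact add_le_add hσ (S.le_q t ht w hw)⟩

lemma k_div_le {σ : ℝ} (hσ : S.ρ ≤ σ) : S.k / σ ≤ S.ε / 4 ∧ S.k / σ ≤ 1 / 4 := by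
  have h0 := S.ρ_pos
  have h1 := S.k_le
  have h2 := S.k_le_mul
  have h3 := S.ε_pos
  have : 0 < σ := h0.trans_le hσ
  constructor
  · rw [div_le_iff₀ this]; nlinarith
  · rw [div_le_iff₀ this]; linarith

/-- Curves with velocity `ε`-close to `a` stay in the domain and climb the levels of `q`. -/
lemma mem_of_vel_near {b x : V} {γ v : ℝ → V} {σ : ℝ} (hb : ‖b - S.a‖ ≤ S.ε / 2)
    (hx : x ∈ S.dom) (hσ : σ ≤ S.q x) (h0 : γ 0 = x)
    (hγ : ∀ t, 0 ≤ t → HasDerivWithinAt γ (v t) (Ici 0) t)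
    (hv : ∀ t, 0 ≤ t → ‖v t - b‖ ≤ S.ε / 2) {t : ℝ} (ht : 0 ≤ t) :
    γ t ∈ S.dom ∧ σ + t ≤ S.q (γ t) := by
  have h1 : ∀ s, 0 ≤ s → HasDerivWithinAt (fun s => γ s - s • S.a) (v s - S.a) (Ici 0) s :=
    fun s hs =>
      ((hγ s hs).sub (((hasDerivAt_id s).smul_const S.a).hasDerivWithinAt)).congr_deriv (by simp)
  have h2 := norm_sub_le_of_norm_deriv_le (g := fun s => S.ε * s) (g' := fun _ => S.ε) h1
    (fun s _ => by simpa using ((hasDerivAt_id s).const_mul S.ε).hasDerivWithinAt)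
    (fun s hs => by
      calc ‖v s - S.a‖ = ‖(v s - b) + (b - S.a)‖ := by congr 1; abel
        _ ≤ _ := (norm_add_le _ _).trans (by linarith [hv s hs])) le_rfl ht
  have h3 := add_mem_region (w := γ t - x) hx hσ ht (by
    simp only [h0, zero_smul, sub_zero, mul_zero] at h2
    rwa [sub_right_comm])
  simpa using h3

section Sol

variable {b x : V} {γ v : ℝ → V}

lemma Sol.mem_dom (h : S.Sol b x γ v) {σ t : ℝ} (hσ : σ ≤ S.q x) (ht : 0 ≤ t) :
    γ t ∈ S.dom ∧ σ + t ≤ S.q (γ t) :=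
  mem_of_vel_near h.near h.mem.1 hσ h.init h.deriv_pos h.vel_near ht

lemma Sol.mem_region (h : S.Sol b x γ v) {t : ℝ} (ht : 0 ≤ t) : γ t ∈ S.region :=
  ⟨(h.mem_dom h.mem.2 ht).1, by linarith [(h.mem_dom h.mem.2 ht).2]⟩

lemma Sol.norm_force_le (h : S.Sol b x γ v) {σ t : ℝ} (h0 : 0 < σ) (hσ : σ ≤ S.q x) (ht : 0 ≤ t) :
    ‖S.F (γ t)‖ ≤ S.k / (σ + t) ^ 2 := by
  obtain ⟨h1, h2⟩ := h.mem_dom hσ ht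
  refine (S.newton.norm_F_le _ h1 (by linarith)).trans ?_
  have := S.newton.k_nonneg
  gcongr

lemma Sol.norm_vel_sub_le (h : S.Sol b x γ v) {σ t : ℝ} (h0 : 0 < σ) (hσ : σ ≤ S.q x)
    (ht : 0 ≤ t) : ‖v t - b‖ ≤ S.k / (σ + t) := by
  have h1 := norm_lim_sub_le (fun s t hs hst => norm_sub_le_of_norm_deriv_le h.deriv_vel
    (fun t ht => (hasDerivAt_neg_div S.k (ρ := σ) (by linarith)).hasDerivWithinAt)
    (fun t ht => h.norm_force_le h0 hσ ht) hs hst) h.lim (tendsto_neg_div _ _) ht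
  rw [norm_sub_rev]
  linarith

/-- Restarting a solution at a later time. -/
lemma Sol.shift (h : S.Sol b x γ v) {τ : ℝ} (hτ : 0 ≤ τ) :
    S.Sol b (γ τ) (fun t => γ (τ + t)) (fun t => v (τ + t)) where
  mem := h.mem_region hτ
  near := h.near
  init := by simp
  deriv_pos t ht := by
    have h1 := (h.deriv_pos (τ + t) (by linarith)).scomp t (h := fun t => τ + t) (h' := 1) (s := Ici 0)
      ((hasDerivAt_id t).const_add τ).hasDerivWithinAt
      (fun s hs => by simp only [mem_Ici] at *; linarith)
    simpa [Function.comp_def] using h1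
  deriv_vel t ht := by
    have h1 := (h.deriv_vel (τ + t) (by linarith)).scomp t (h := fun t => τ + t) (h' := 1) (s := Ici 0)
      ((hasDerivAt_id t).const_add τ).hasDerivWithinAt
      (fun s hs => by simp only [mem_Ici] at *; linarith)
    simpa [Function.comp_def] using h1
  vel_near t ht := h.vel_near _ (by linarith)
  lim := h.lim.comp (tendsto_atTop_add_const_left _ _ tendsto_id)

end Sol

section Energy

variable {b : V} {γ v : ℝ → V}

lemma potential_tendsto (hR : ∀ t, 0 ≤ t → γ t ∈ S.region)
    (hq : Tendsto (fun t => S.q (γ t)) atTop atTop) : Tendsto (fun t => S.u (γ t)) atTop (𝓝 0) := by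
  refine tendsto_of_tendsto_of_tendsto_of_le_of_le' tendsto_const_nhds (hq.const_div_atTop S.k) ?_ ?_
  · filter_upwards [eventually_ge_atTop 0] with t ht
    exact S.newton.u_nonneg _ (hR t ht).1 (S.ρ_pos.trans_le (hR t ht).2)
  · filter_upwards [eventually_ge_atTop 0] with t ht
    exact S.newton.u_le _ (hR t ht).1 (S.ρ_pos.trans_le (hR t ht).2)

/-- Conservation of energy, with the value of the energy read off at infinity. -/
lemma energy (hγ : ∀ t, 0 ≤ t → HasDerivWithinAt γ (v t) (Ici 0) t)
    (hv : ∀ t, 0 ≤ t → HasDerivWithinAt v (S.F (γ t)) (Ici 0) t)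
    (hR : ∀ t, 0 ≤ t → γ t ∈ S.region) (hq : Tendsto (fun t => S.q (γ t)) atTop atTop)
    (hl : Tendsto v atTop (𝓝 b)) {t : ℝ} (ht : 0 ≤ t) :
    ‖v t‖ ^ 2 = ‖b‖ ^ 2 + 2 * S.u (γ t) := by
  have hu : ∀ t, 0 ≤ t →
      HasDerivWithinAt (fun s => S.u (γ s)) (inner ℝ (S.F (γ t)) (v t)) (Ici 0) t := fun t ht =>
    hasDerivWithinAt_comp_of_quadratic (C := S.k / S.ρ ^ 3) (fun s hs =>
      (S.newton.taylor _ (hR t ht).1 _ (hR s hs).1 S.ρ S.ρ_pos (hR t ht).2 (hR s hs).2).trans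
        (le_of_eq (by ring))) (hγ t ht)
  have hd : ∀ s, 0 ≤ s → HasDerivWithinAt (fun s => ‖v s‖ ^ 2 - 2 * S.u (γ s)) 0 (Ici 0) s := by
    intro s hs
    refine ((hv s hs).norm_sq.sub ((hu s hs).const_mul 2)).congr_deriv ?_
    rw [real_inner_comm]; ring
  have hlim : Tendsto (fun s => ‖v s‖ ^ 2 - 2 * S.u (γ s)) atTop (𝓝 (‖b‖ ^ 2 - 2 * 0)) :=
    (hl.norm.pow 2).sub ((potential_tendsto hR hq).const_mul 2)
  have h1 := norm_lim_sub_le (fun s t hs hst => norm_sub_le_of_norm_deriv_le hd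
    (g := fun _ => 0) (g' := fun _ => 0) (fun t _ => hasDerivWithinAt_const _ _ _)
    (fun t _ => by simp) hs hst) hlim tendsto_const_nhds ht
  simp only [mul_zero, sub_zero, norm_le_zero_iff] at h1
  linarith

lemma Sol.energy {x : V} (h : S.Sol b x γ v) {t : ℝ} (ht : 0 ≤ t) :
    ‖v t‖ ^ 2 = ‖b‖ ^ 2 + 2 * S.u (γ t) := by
  refine FarField.energy h.deriv_pos h.deriv_vel (fun t ht => h.mem_region ht) ?_ h.lim ht
  refine tendsto_atTop_mono' _ ?_ (tendsto_atTop_add_const_left _ S.ρ tendsto_id)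
  filter_upwards [eventually_ge_atTop 0] with t ht using (h.mem_dom h.mem.2 ht).2

end Energy

section Stability

variable {b x : V} {γ v : ℝ → V} {b' x' : V} {γ' v' : ℝ → V} {σ : ℝ}

lemma Sol.deriv_sub (h : S.Sol b x γ v) (h' : S.Sol b' x' γ' v') {t : ℝ} (ht : 0 ≤ t) :
    HasDerivWithinAt (fun t => γ t - γ' t) (v t - v' t) (Ici 0) t :=
  (h.deriv_pos t ht).sub (h'.deriv_pos t ht)

/-- A linear bound for the separation of two solutions bounds the separation of their velocities:
integrate the Lipschitz bound for the force from infinity. -/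
lemma Sol.vel_sub_le_of_sub_le (h : S.Sol b x γ v) (h' : S.Sol b' x' γ' v') (h0 : 0 < σ)
    (hσ : σ ≤ S.q x) (hσ' : σ ≤ S.q x') {M N : ℝ} (hN : 0 ≤ N)
    (hb : ∀ t, 0 ≤ t → ‖γ t - γ' t‖ ≤ M + N * t) {t : ℝ} (ht : 0 ≤ t) :
    ‖(v t - v' t) - (b - b')‖ ≤ S.k * M / (2 * (σ + t) ^ 2) + S.k * N / (σ + t) := by
  have hk := S.newton.k_nonneg
  have h1 := norm_lim_sub_le (fun s t hs hst => norm_sub_le_of_norm_deriv_le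
    (fun t ht => (h.deriv_vel t ht).sub (h'.deriv_vel t ht))
    (fun t ht => ((hasDerivAt_neg_div_sq (S.k * M) (ρ := σ) (by linarith)).add
      (hasDerivAt_neg_div (S.k * N) (ρ := σ) (by linarith))).hasDerivWithinAt)
    (fun t ht => ?_) hs hst) (h.lim.sub h'.lim)
    ((tendsto_neg_div_sq _ _).add (tendsto_neg_div _ _)) ht
  · rw [norm_sub_rev]
    simp only [Pi.add_apply, Pi.sub_apply] at h1
    linarith
  · obtain ⟨h2, h3⟩ := h.mem_dom hσ ht
    obtain ⟨h4, h5⟩ := h'.mem_dom hσ' ht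
    refine (S.newton.lip _ h2 _ h4 (σ + t) (by linarith) h3 h5).trans ?_
    have h6 : S.k * ‖γ t - γ' t‖ / (σ + t) ^ 3 ≤ S.k * (M + N * (σ + t)) / (σ + t) ^ 3 := by
      have := hb t ht
      have : M + N * t ≤ M + N * (σ + t) := by nlinarith
      gcongr; linarith
    refine h6.trans (le_of_eq ?_)
    have : σ + t ≠ 0 := by linarith
    field_simp

/-- A linear bound `M + N t` for the separation of two solutions improves itself: `M` and `N` are
halved, up to the contribution of the data. -/
lemma Sol.sub_le_of_sub_le (h : S.Sol b x γ v) (h' : S.Sol b' x' γ' v') {M N : ℝ}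
    (hM : 0 ≤ M) (hN : 0 ≤ N)
    (hb : ∀ t, 0 ≤ t → ‖γ t - γ' t‖ ≤ M + N * t) {t : ℝ} (ht : 0 ≤ t) :
    ‖γ t - γ' t‖ ≤ (‖x - x'‖ + M / 2) + (‖b - b'‖ + N / 2) * t := by
  have hρ := S.ρ_pos
  have hk := S.newton.k_nonneg
  have hk1 := (k_div_le (S := S) le_rfl).2
  have h1 := norm_sub_le_of_norm_deriv_le (fun t ht => h.deriv_sub h' ht)
    (fun t ht => (((hasDerivAt_neg_div (S.k * M / 2) (ρ := S.ρ) (by linarith)).add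
      ((hasDerivAt_id t).const_mul (‖b - b'‖ + S.k * N / S.ρ)))).hasDerivWithinAt)
    (fun t ht => ?_) le_rfl ht
  · simp only [Pi.add_apply, id, h.init, h'.init, add_zero, mul_zero] at h1
    have h2 := norm_sub_norm_le (γ t - γ' t) (x - x')
    have h3 : 0 ≤ S.k * M / 2 / (S.ρ + t) := by positivity
    have h4 : S.k * M / 2 / S.ρ ≤ M / 2 := by
      calc _ = (S.k / S.ρ) * (M / 2) := by ring
        _ ≤ 1 / 4 * (M / 2) := by gcongr
        _ ≤ _ := by linarith
    have h5 : S.k * N / S.ρ * t ≤ N / 2 * t := by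
      calc _ = (S.k / S.ρ) * (N * t) := by ring
        _ ≤ 1 / 4 * (N * t) := by gcongr
        _ ≤ _ := by nlinarith [mul_nonneg hN ht]
    linarith
  · have h2 := h.vel_sub_le_of_sub_le h' hρ h.mem.2 h'.mem.2 hN hb ht
    have h3 := norm_sub_norm_le (v t - v' t) (b - b')
    have h4 : S.k * N / (S.ρ + t) ≤ S.k * N / S.ρ := by gcongr; linarith
    have h5 : S.k * M / (2 * (S.ρ + t) ^ 2) = S.k * M / 2 / (S.ρ + t) ^ 2 := by
      rw [div_div]
    linarith

/-- Two asymptotically uniform solutions separate at most linearly. An a priori linear bound is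
improved by a fixed contraction at every step, which leaves only the contribution of the data. -/
lemma Sol.norm_sub_le (h : S.Sol b x γ v) (h' : S.Sol b' x' γ' v') {t : ℝ} (ht : 0 ≤ t) :
    ‖γ t - γ' t‖ ≤ 2 * ‖x - x'‖ + 2 * ‖b - b'‖ * t := by
  have hε := S.ε_pos
  have key : ∀ n : ℕ, ∀ t, 0 ≤ t →
      ‖γ t - γ' t‖ ≤ 2 * ‖x - x'‖ + (2 * ‖b - b'‖ + S.ε / 2 ^ n) * t := by
    intro n
    induction n with
    | zero =>
      intro t ht
      have h1 := norm_sub_le_of_norm_deriv_le (fun t ht => h.deriv_sub h' ht)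
        (fun t ht => ((hasDerivAt_id t).const_mul (‖b - b'‖ + S.ε)).hasDerivWithinAt)
        (fun t ht => ?_) le_rfl ht
      · simp only [id, h.init, h'.init, mul_zero, sub_zero] at h1
        have h2 := norm_sub_norm_le (γ t - γ' t) (x - x')
        have := norm_nonneg (x - x')
        have := mul_nonneg (norm_nonneg (b - b')) ht
        simp only [pow_zero, div_one]
        nlinarith
      · have h2 := h.vel_near t ht
        have h3 := h'.vel_near t ht
        calc ‖v t - v' t‖ = ‖(b - b') + (v t - b) - (v' t - b')‖ := by congr 1; abel
          _ ≤ ‖b - b'‖ + ‖v t - b‖ + ‖v' t - b'‖ :=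
            (_root_.norm_sub_le _ _).trans (by gcongr; exact norm_add_le _ _)
          _ ≤ _ := by linarith
    | succ n ih =>
      intro t ht
      refine (h.sub_le_of_sub_le h' (by positivity) (by positivity) ih ht).trans (le_of_eq ?_)
      rw [pow_succ]
      field_simp
      ring
  refine ge_of_tendsto' (f := fun n : ℕ => 2 * ‖x - x'‖ + (2 * ‖b - b'‖ + S.ε / 2 ^ n) * t)
    (x := atTop) ?_ fun n => key n t ht
  have h2 : Tendsto (fun n : ℕ => S.ε / 2 ^ n) atTop (𝓝 0) :=
    tendsto_const_nhds.div_atTop (tendsto_pow_atTop_atTop_of_one_lt one_lt_two)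
  simpa using ((h2.const_add (2 * ‖b - b'‖)).mul_const t).const_add (2 * ‖x - x'‖)

lemma Sol.norm_vel_sub_sub_le (h : S.Sol b x γ v) (h' : S.Sol b' x' γ' v') (h0 : 0 < σ)
    (hσ : σ ≤ S.q x) (hσ' : σ ≤ S.q x') {t : ℝ} (ht : 0 ≤ t) :
    ‖(v t - v' t) - (b - b')‖ ≤
      S.k * ‖x - x'‖ / (σ + t) ^ 2 + 2 * S.k * ‖b - b'‖ / (σ + t) := by
  refine (h.vel_sub_le_of_sub_le h' h0 hσ hσ' (by positivity)
    (fun t ht => h.norm_sub_le h' ht) ht).trans (le_of_eq ?_)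
  have : σ + t ≠ 0 := by linarith
  field_simp

lemma Sol.unique (h : S.Sol b x γ v) (h' : S.Sol b x γ' v') {t : ℝ} (ht : 0 ≤ t) :
    γ t = γ' t ∧ v t = v' t := by
  constructor
  · have := h.norm_sub_le h' ht
    simp only [sub_self, norm_zero, mul_zero, zero_mul, add_zero, norm_le_zero_iff] at this
    exact sub_eq_zero.1 this
  · have := h.norm_vel_sub_sub_le h' S.ρ_pos h.mem.2 h'.mem.2 ht
    simp only [sub_self, norm_zero, mul_zero, zero_div, add_zero, sub_zero, norm_le_zero_iff] at this
    exact sub_eq_zero.1 this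

end Stability

end FarField

namespace FarField

variable {V : Type*} [NormedAddCommGroup V] [InnerProductSpace ℝ V]
  {S : FarField V}

/-! ### Existence of asymptotically uniform solutions -/

open BoundedContinuousFunction in
/-- The curve from `x` with velocity `b + v`. -/
noncomputable def path (b x : V) (v : ℝ →ᵇ V) (t : ℝ) : V := x + t • b + ∫ s in (0 : ℝ)..t, v s

section Path

open BoundedContinuousFunction

variable {b x : V}

lemma path_zero (v : ℝ →ᵇ V) : path b x v 0 = x := by simp [path]

lemma continuousOn_force : ContinuousOn S.F S.region := by
  have : ∀ x ∈ S.region, ∀ y ∈ S.region, ‖S.F x - S.F y‖ ≤ S.k / S.ρ ^ 3 * ‖x - y‖ :=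
    fun x hx y hy => (S.newton.lip x hx.1 y hy.1 S.ρ S.ρ_pos hx.2 hy.2).trans (le_of_eq (by ring))
  have hC : 0 ≤ S.k / S.ρ ^ 3 := by have := S.newton.k_nonneg; have := S.ρ_pos; positivity
  exact (LipschitzOnWith.of_dist_le_mul (K := ⟨_, hC⟩) fun x hx y hy => by
    rw [dist_eq_norm, dist_eq_norm]; exact this x hx y hy).continuousOn

variable [CompleteSpace V]

lemma hasDerivAt_path (v : ℝ →ᵇ V) (t : ℝ) : HasDerivAt (path b x v) (b + v t) t := by
  have h1 : HasDerivAt (fun t => ∫ s in (0 : ℝ)..t, v s) (v t) t :=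
    intervalIntegral.integral_hasDerivAt_right (v.continuous.intervalIntegrable _ _)
      (v.continuous.stronglyMeasurableAtFilter _ _) v.continuous.continuousAt
  exact ((((hasDerivAt_id t).smul_const b).const_add x).add h1).congr_deriv (by simp)

lemma path_mem (hb : ‖b - S.a‖ ≤ S.ε / 2) (hx : x ∈ S.region) {v : ℝ →ᵇ V}
    (hv : ‖v‖ ≤ S.ε / 2) {t : ℝ} (ht : 0 ≤ t) :
    path b x v t ∈ S.dom ∧ S.ρ + t ≤ S.q (path b x v t) :=
  mem_of_vel_near (γ := path b x v) (v := fun t => b + v t) hb hx.1 hx.2 (path_zero v)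
    (fun t _ => (hasDerivAt_path v t).hasDerivWithinAt)
    (fun t _ => by simpa using (v.norm_coe_le_norm t).trans hv) ht

lemma norm_path_sub_le (v w : ℝ →ᵇ V) {t : ℝ} (ht : 0 ≤ t) :
    ‖path b x v t - path b x w t‖ ≤ ‖v - w‖ * t := by
  have h1 := norm_sub_le_of_norm_deriv_le (f := fun t => path b x v t - path b x w t)
    (f' := fun t => v t - w t) (g := fun t => ‖v - w‖ * t) (g' := fun _ => ‖v - w‖)
    (fun t _ => (((hasDerivAt_path v t).sub (hasDerivAt_path w t)).hasDerivWithinAt).congr_deriv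
      (by simp))
    (fun t _ => by simpa using ((hasDerivAt_id t).const_mul ‖v - w‖).hasDerivWithinAt)
    (fun t _ => (v - w).norm_coe_le_norm t) le_rfl ht
  simpa [path_zero] using h1

/-- The primitive, vanishing at infinity, of the force along a path. It is continued by a constant to
negative times, so that it is a bounded continuous function on `ℝ`. -/
lemma exists_integrated_force (hb : ‖b - S.a‖ ≤ S.ε / 2) (hx : x ∈ S.region) (v : ℝ →ᵇ V)
    (hv : ‖v‖ ≤ S.ε / 2) : ∃ w : ℝ →ᵇ V, ‖w‖ ≤ S.ε / 2 ∧
      (∀ t, 0 ≤ t → HasDerivWithinAt w (S.F (path b x v t)) (Ici 0) t) ∧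
      Tendsto w atTop (𝓝 0) ∧ ∀ t, w t = w (max t 0) := by
  have hρ := S.ρ_pos
  have hk := S.newton.k_nonneg
  set G : ℝ → V := fun t => S.F (path b x v (max t 0)) with hG
  have hcp : Continuous (path b x v) :=
    continuous_iff_continuousAt.2 fun t => (hasDerivAt_path v t).continuousAt
  have hGc : Continuous G := continuousOn_force.comp_continuous (by fun_prop) fun t => by
    obtain ⟨h1, h2⟩ := path_mem hb hx hv (le_max_right t 0)
    exact ⟨h1, by linarith [le_max_right t 0]⟩
  set H : ℝ → V := fun t => ∫ s in (0 : ℝ)..t, G s with hH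
  have hHd : ∀ t, HasDerivAt H (G t) t := fun t =>
    intervalIntegral.integral_hasDerivAt_right (hGc.intervalIntegrable _ _)
      (hGc.stronglyMeasurableAtFilter _ _) hGc.continuousAt
  have hle : ∀ s t, 0 ≤ s → s ≤ t → ‖H t - H s‖ ≤ -(S.k / (S.ρ + t)) - -(S.k / (S.ρ + s)) :=
    fun s t hs hst => norm_sub_le_of_norm_deriv_le (fun t _ => (hHd t).hasDerivWithinAt)
      (fun t ht => (hasDerivAt_neg_div S.k (by linarith)).hasDerivWithinAt)
      (fun t ht => by
        obtain ⟨h1, h2⟩ := path_mem hb hx hv ht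
        simp only [hG, max_eq_left ht]
        refine (S.newton.norm_F_le _ h1 (by linarith)).trans ?_
        gcongr) hs hst
  obtain ⟨L, hL⟩ := exists_tendsto_of_norm_sub_le hle (tendsto_neg_div _ _)
  have hbd : ∀ t, ‖H (max t 0) - L‖ ≤ S.ε / 2 := fun t => by
    have h1 := norm_lim_sub_le hle hL (tendsto_neg_div _ _) (le_max_right t 0)
    rw [norm_sub_rev]
    refine h1.trans ?_
    have h2 := (k_div_le (S := S) (σ := S.ρ + max t 0) (by linarith [le_max_right t 0])).1
    linarith [S.ε_pos]
  have hHc : Continuous H := continuous_iff_continuousAt.2 fun t => (hHd t).continuousAt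
  refine ⟨BoundedContinuousFunction.ofNormedAddCommGroup (fun t => H (max t 0) - L)
    (by fun_prop) _ hbd, ?_, ?_, ?_, ?_⟩
  · exact BoundedContinuousFunction.norm_ofNormedAddCommGroup_le _ (by linarith [S.ε_pos]) hbd
  · intro t ht
    have h1 := ((hHd t).sub_const L).hasDerivWithinAt (s := Ici 0)
    simp only [hG, max_eq_left ht] at h1
    exact h1.congr (fun s hs => by simp [max_eq_left (mem_Ici.1 hs)]) (by simp [max_eq_left ht])
  · have h1 : Tendsto (fun t => H t - L) atTop (𝓝 0) := by simpa using hL.sub_const L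
    refine h1.congr' ?_
    filter_upwards [eventually_ge_atTop 0] with t ht
    simp [max_eq_left ht]
  · intro t; simp

/-- From every point of the region there is a solution with given limit velocity `b` close to `a`: the
deviation of its velocity from `b` is a fixed point of `v ↦ -∫_t^∞ F(path b x v)`, a contraction of a
ball of bounded continuous functions. -/
theorem exists_sol (hb : ‖b - S.a‖ ≤ S.ε / 2) (hx : x ∈ S.region) :
    ∃ γ v, S.Sol b x γ v := by
  have hρ := S.ρ_pos
  have hk := S.newton.k_nonneg
  have hε := S.ε_pos
  let B := Metric.closedBall (0 : ℝ →ᵇ V) (S.ε / 2)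
  have hB : ∀ v : B, ‖(v : ℝ →ᵇ V)‖ ≤ S.ε / 2 := fun v => mem_closedBall_zero_iff.1 v.2
  choose W hW1 hW2 hW3 hW4 using fun v : B => exists_integrated_force hb hx v (hB v)
  let Φ : B → B := fun v => ⟨W v, mem_closedBall_zero_iff.2 (hW1 v)⟩
  have : CompleteSpace B := Metric.isClosed_closedBall.completeSpace_coe
  have : Nonempty B := ⟨⟨0, Metric.mem_closedBall_self (by positivity)⟩⟩
  have hΦ : ContractingWith (1 / 4) Φ := by
    refine ⟨by rw [← NNReal.coe_lt_coe]; norm_num, LipschitzWith.of_dist_le_mul fun v w => ?_⟩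
    simp only [Subtype.dist_eq, dist_eq_norm, Φ, NNReal.coe_div, NNReal.coe_one, NNReal.coe_ofNat]
    rw [BoundedContinuousFunction.norm_le (by positivity)]
    intro t
    rw [BoundedContinuousFunction.sub_apply, hW4 v t, hW4 w t]
    set d := ‖(v : ℝ →ᵇ V) - w‖ with hd
    have h1 := norm_lim_sub_le (fun s t hs hst => norm_sub_le_of_norm_deriv_le
      (fun t ht => (hW2 v t ht).sub (hW2 w t ht))
      (fun t ht => (hasDerivAt_neg_div (S.k * d) (ρ := S.ρ) (by linarith)).hasDerivWithinAt)
      (fun t ht => ?_) hs hst) ((hW3 v).sub (hW3 w)) (tendsto_neg_div _ _) (le_max_right t 0)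
    · simp only [Pi.sub_apply, sub_self, zero_sub, norm_neg, neg_neg] at h1
      refine h1.trans ?_
      have h2 := (k_div_le (S := S) (σ := S.ρ + max t 0) (by linarith [le_max_right t 0])).2
      calc _ = S.k / (S.ρ + max t 0) * d := by ring
        _ ≤ _ := by gcongr
    · obtain ⟨h2, h3⟩ := path_mem hb hx (hB v) ht
      obtain ⟨h4, h5⟩ := path_mem hb hx (hB w) ht
      refine (S.newton.lip _ h2 _ h4 (S.ρ + t) (by linarith) h3 h5).trans ?_
      have h6 : S.k * ‖path b x v t - path b x w t‖ ≤ S.k * d * (S.ρ + t) := by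
        rw [mul_assoc]
        gcongr
        exact (norm_path_sub_le _ _ ht).trans (by gcongr; linarith)
      refine (div_le_div_of_nonneg_right h6 (by positivity)).trans (le_of_eq ?_)
      have : S.ρ + t ≠ 0 := by linarith
      field_simp
  obtain ⟨v, hv⟩ : ∃ v : B, W v = v :=
    ⟨hΦ.fixedPoint, congrArg Subtype.val hΦ.fixedPoint_isFixedPt⟩
  refine ⟨path b x v, fun t => b + (v : ℝ →ᵇ V) t, hx, hb, path_zero _,
    fun t _ => (hasDerivAt_path _ t).hasDerivWithinAt, fun t ht => ?_, fun t _ => ?_, ?_⟩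
  · have := hW2 v t ht
    rw [hv] at this
    exact this.const_add b
  · simpa using ((v : ℝ →ᵇ V).norm_coe_le_norm t).trans (hB v)
  · have := hW3 v
    rw [hv] at this
    simpa using this.const_add b

end Path

/-! ### The rays and their initial velocities -/

variable [CompleteSpace V]

open Classical in
/-- The solution from `x` with limit velocity `b` (junk unless `x` is in the region and `b` is close
to the central direction). -/
noncomputable def ray (S : FarField V) (b x : V) : ℝ → V :=
  if h : ‖b - S.a‖ ≤ S.ε / 2 ∧ x ∈ S.region then (exists_sol h.1 h.2).choose else fun _ => x

open Classical in
/-- The velocity of `ray S b x`. -/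
noncomputable def rayVel (S : FarField V) (b x : V) : ℝ → V :=
  if h : ‖b - S.a‖ ≤ S.ε / 2 ∧ x ∈ S.region then (exists_sol h.1 h.2).choose_spec.choose else 0

/-- The initial velocity of the ray from `x` with limit velocity `b`, as a vector field in `x`. -/
noncomputable def field (S : FarField V) (b x : V) : V := rayVel S b x 0

lemma sol_ray {b x : V} (hb : ‖b - S.a‖ ≤ S.ε / 2) (hx : x ∈ S.region) :
    S.Sol b x (ray S b x) (rayVel S b x) := by
  have h : ‖b - S.a‖ ≤ S.ε / 2 ∧ x ∈ S.region := ⟨hb, hx⟩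
  simp only [ray, rayVel, dif_pos h]
  exact (exists_sol h.1 h.2).choose_spec.choose_spec

section Field

variable {b x y : V}

/-- Rays are integral curves of the field of initial velocities. -/
lemma rayVel_eq_field (hb : ‖b - S.a‖ ≤ S.ε / 2) (hx : x ∈ S.region)
    {t : ℝ} (ht : 0 ≤ t) : rayVel S b x t = field S b (ray S b x t) := by
  have h := sol_ray hb hx
  have := ((h.shift ht).unique (sol_ray hb (h.mem_region ht)) le_rfl).2
  simpa [field] using this

lemma norm_field_sub_le (hb : ‖b - S.a‖ ≤ S.ε / 2) (hx : x ∈ S.region) :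
    ‖field S b x - b‖ ≤ S.k / S.ρ := by
  simpa [field] using (sol_ray hb hx).norm_vel_sub_le S.ρ_pos hx.2 le_rfl

lemma norm_field_sq (hb : ‖b - S.a‖ ≤ S.ε / 2) (hx : x ∈ S.region) :
    ‖field S b x‖ ^ 2 = ‖b‖ ^ 2 + 2 * S.u x := by
  have h := (sol_ray hb hx).energy le_rfl
  rwa [(sol_ray hb hx).init] at h

lemma norm_field_sub_field_param_le (hb : ‖b - S.a‖ ≤ S.ε / 2) (hx : x ∈ S.region)
    {b' : V} (hb' : ‖b' - S.a‖ ≤ S.ε / 2) :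
    ‖field S b x - field S b' x‖ ≤ 2 * ‖b - b'‖ := by
  have h := (sol_ray hb hx).norm_vel_sub_sub_le (sol_ray hb' hx) S.ρ_pos hx.2 hx.2 le_rfl
  have h1 := norm_sub_norm_le (field S b x - field S b' x) (b - b')
  have h2 : 2 * S.k * ‖b - b'‖ / (S.ρ + 0) = 2 * (S.k / S.ρ) * ‖b - b'‖ := by rw [add_zero]; ring
  have h3 := (k_div_le (S := S) le_rfl).2
  have h4 : 2 * (S.k / S.ρ) * ‖b - b'‖ ≤ 2 * (1 / 4) * ‖b - b'‖ := by gcongr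
  simp only [sub_self, norm_zero, mul_zero, zero_div, zero_add, h2] at h
  unfold field at *
  linarith [norm_nonneg (b - b')]

lemma norm_field_sub_field_le (hb : ‖b - S.a‖ ≤ S.ε / 2) (hx : x ∈ S.region)
    (hy : y ∈ S.region) {σ : ℝ} (h0 : 0 < σ) (hσ : σ ≤ S.q x) (hσ' : σ ≤ S.q y) :
    ‖field S b x - field S b y‖ ≤ S.k / σ ^ 2 * ‖x - y‖ := by
  have h := (sol_ray hb hx).norm_vel_sub_sub_le (sol_ray hb hy) h0 hσ hσ' le_rfl
  simp only [sub_self, norm_zero, mul_zero, zero_div, add_zero, sub_zero] at h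
  exact h.trans (le_of_eq (by ring))

end Field

end FarField

/-- Mean value inequality for a function with a second order expansion on a convex set. -/
lemma abs_sub_le_of_quadratic {V : Type*} [NormedAddCommGroup V] [InnerProductSpace ℝ V]
    {f : V → ℝ} {G : V → V} {C ν : ℝ} {R : Set V} (hR : Convex ℝ R)
    (hf : ∀ x ∈ R, ∀ y ∈ R, |f y - f x - inner ℝ (G x) (y - x)| ≤ C * ‖y - x‖ ^ 2)
    (hG : ∀ x ∈ R, ‖G x‖ ≤ ν) {x y : V} (hx : x ∈ R) (hy : y ∈ R) :
    |f y - f x| ≤ ν * ‖y - x‖ := by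
  have hmem : ∀ s ∈ Icc (0 : ℝ) 1, x + s • (y - x) ∈ R := fun s hs =>
    hR.add_smul_sub_mem hx hy hs
  have hd : ∀ s ∈ Icc (0 : ℝ) 1, HasDerivWithinAt (fun s : ℝ => f (x + s • (y - x)))
      (inner ℝ (G (x + s • (y - x))) (y - x)) (Icc 0 1) s := fun s hs =>
    hasDerivWithinAt_comp_of_quadratic (C := C) (γ := fun s : ℝ => x + s • (y - x))
      (fun r hr => hf _ (hmem s hs) _ (hmem r hr))
      (((((hasDerivAt_id s).smul_const (y - x)).const_add x).hasDerivWithinAt).congr_deriv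
        (by simp))
  have := (convex_Icc (0 : ℝ) 1).norm_image_sub_le_of_norm_hasDerivWithin_le (C := ν * ‖y - x‖) hd
    (fun s hs => (norm_inner_le_norm _ _).trans (by gcongr; exact hG _ (hmem s hs)))
    (left_mem_Icc.2 zero_le_one) (right_mem_Icc.2 zero_le_one)
  simpa using this

namespace FarField

variable {V : Type*} [NormedAddCommGroup V] [InnerProductSpace ℝ V]
  {S : FarField V}

/-! ### The generating function of the field of rays -/

section Difference

variable {b x y : V} {γ v γ' v' : ℝ → V}

lemma Sol.norm_vel_sub_le_of_eq (h : S.Sol b x γ v) (h' : S.Sol b y γ' v') {t : ℝ} (ht : 0 ≤ t) :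
    ‖v' t - v t‖ ≤ S.k * ‖y - x‖ / (S.ρ + t) ^ 2 := by
  simpa using h'.norm_vel_sub_sub_le h S.ρ_pos h'.mem.2 h.mem.2 ht

lemma Sol.norm_le (h : S.Sol b x γ v) {t : ℝ} (ht : 0 ≤ t) :
    ‖γ t‖ ≤ (‖x‖ / S.ρ + ‖b‖ + S.ε) * (S.ρ + t) := by
  have hρ := S.ρ_pos
  have hε := S.ε_pos
  have h1 := norm_sub_le_of_norm_deriv_le (g := fun t => (‖b‖ + S.ε) * t) h.deriv_pos
    (fun t _ => ((hasDerivAt_id t).const_mul (‖b‖ + S.ε)).hasDerivWithinAt)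
    (fun t ht => by
      have h2 := h.vel_near t ht
      have h3 := norm_sub_norm_le (v t) b
      simp only [mul_one]; linarith) le_rfl ht
  have h2 := norm_sub_norm_le (γ t) (γ 0)
  rw [h.init] at h1 h2
  have h4 : (‖x‖ / S.ρ + ‖b‖ + S.ε) * (S.ρ + t) =
      ‖x‖ + ‖x‖ / S.ρ * t + (‖b‖ + S.ε) * S.ρ + (‖b‖ + S.ε) * t := by
    field_simp; ring
  have h5 : 0 ≤ ‖x‖ / S.ρ * t := by positivity
  have h6 : 0 ≤ (‖b‖ + S.ε) * S.ρ := by positivity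
  simp only [mul_zero, sub_zero] at h1
  linarith

lemma Sol.exists_tendsto_sub [CompleteSpace V] (h : S.Sol b x γ v) (h' : S.Sol b y γ' v') :
    ∃ L, Tendsto (fun t => γ' t - γ t) atTop (𝓝 L) :=
  exists_tendsto_of_norm_sub_le (fun s t hs hst =>
    norm_sub_le_of_norm_deriv_le (fun t ht => h'.deriv_sub h ht)
      (fun t ht => (hasDerivAt_neg_div (S.k * ‖y - x‖) (ρ := S.ρ)
        (by linarith [S.ρ_pos])).hasDerivWithinAt)
      (fun t ht => h.norm_vel_sub_le_of_eq h' ht) hs hst) (tendsto_neg_div _ _)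

lemma Sol.tendsto_inner_sub (h : S.Sol b x γ v) (h' : S.Sol b y γ' v') {L : V}
    (hL : Tendsto (fun t => γ' t - γ t) atTop (𝓝 L)) :
    Tendsto (fun t => inner ℝ (γ' t) (v' t) - inner ℝ (γ t) (v t)) atTop (𝓝 (inner ℝ L b)) := by
  have hρ := S.ρ_pos
  have hk := S.newton.k_nonneg
  set A := ‖x‖ / S.ρ + ‖b‖ + S.ε
  have h1 : Tendsto (fun t => inner ℝ (γ t) (v' t - v t)) atTop (𝓝 0) := by
    refine squeeze_zero_norm' ?_ (by simpa using (tendsto_neg_div (A * (S.k * ‖y - x‖)) S.ρ).neg)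
    filter_upwards [eventually_ge_atTop 0] with t ht
    have h2 : (0 : ℝ) < S.ρ + t := by linarith
    calc ‖(inner ℝ (γ t) (v' t - v t) : ℝ)‖ ≤ ‖γ t‖ * ‖v' t - v t‖ := norm_inner_le_norm _ _
      _ ≤ (A * (S.ρ + t)) * (S.k * ‖y - x‖ / (S.ρ + t) ^ 2) := by
        have h3 := h.norm_le ht
        have h4 := h.norm_vel_sub_le_of_eq h' ht
        have h5 : 0 ≤ A * (S.ρ + t) := (norm_nonneg _).trans h3
        gcongr
      _ = A * (S.k * ‖y - x‖) / (S.ρ + t) := by field_simp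
  have h2 := (hL.inner (𝕜 := ℝ) h'.lim).add h1
  rw [add_zero] at h2
  refine h2.congr fun t => ?_
  rw [inner_sub_left, inner_sub_right]; ring

/-- Second order expansion of the increment of the generating function. The derivative of
`2⟪γ', v'⟫ - 2⟪γ, v⟫ - ⟪v, γ' - γ⟫` is of second order by conservation of energy and Euler's
identity. -/
lemma Sol.quadratic (h : S.Sol b x γ v) (h' : S.Sol b y γ' v') {L : V}
    (hL : Tendsto (fun t => γ' t - γ t) atTop (𝓝 L)) :
    |2 * inner ℝ y (v' 0) - 2 * inner ℝ x (v 0) - inner ℝ L b - inner ℝ (v 0) (y - x)| ≤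
      5 * S.k / (2 * S.ρ ^ 2) * ‖y - x‖ ^ 2 := by
  have hρ := S.ρ_pos
  have hk := S.newton.k_nonneg
  set M := ‖y - x‖
  let Q : ℝ → ℝ := fun t => 2 * (inner ℝ (γ' t) (v' t) - inner ℝ (γ t) (v t)) -
    inner ℝ (v t) (γ' t - γ t)
  let Q' : ℝ → ℝ := fun t => (S.u (γ' t) - S.u (γ t) - inner ℝ (S.F (γ t)) (γ' t - γ t)) +
    ‖v' t - v t‖ ^ 2 / 2
  have hQ : ∀ t, 0 ≤ t → HasDerivWithinAt Q (Q' t) (Ici 0) t := by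
    intro t ht
    have h1 := ((((h'.deriv_pos t ht).inner ℝ (h'.deriv_vel t ht)).sub
      ((h.deriv_pos t ht).inner ℝ (h.deriv_vel t ht))).const_mul 2).sub
      ((h.deriv_vel t ht).inner ℝ (h'.deriv_sub h ht))
    refine h1.congr_deriv ?_
    obtain ⟨m1, q1⟩ := h.mem_dom h.mem.2 ht
    obtain ⟨m2, q2⟩ := h'.mem_dom h'.mem.2 ht
    have e1 := S.newton.euler _ m1 (by linarith)
    have e2 := S.newton.euler _ m2 (by linarith)
    have e3 := h.energy ht
    have e4 := h'.energy ht
    have e5 : ‖v' t - v t‖ ^ 2 = ‖v' t‖ ^ 2 - 2 * inner ℝ (v t) (v' t) + ‖v t‖ ^ 2 := by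
      rw [norm_sub_sq_real, real_inner_comm]
    rw [real_inner_comm (S.F (γ' t)), real_inner_comm (S.F (γ t)), e1, e2, real_inner_self_eq_norm_sq,
      real_inner_self_eq_norm_sq, inner_sub_right (v t), real_inner_self_eq_norm_sq]
    simp only [Q', e5]
    linarith
  have hQb : ∀ t, 0 ≤ t → ‖Q' t‖ ≤ 5 * S.k * M ^ 2 / (S.ρ + t) ^ 3 := by
    intro t ht
    obtain ⟨m1, q1⟩ := h.mem_dom h.mem.2 ht
    obtain ⟨m2, q2⟩ := h'.mem_dom h'.mem.2 ht
    have hp : 0 < S.ρ + t := by linarith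
    have b1 := S.newton.taylor _ m1 _ m2 _ hp q1 q2
    have b2 : ‖γ' t - γ t‖ ≤ 2 * M := by simpa using h'.norm_sub_le h ht
    have b3 := h.norm_vel_sub_le_of_eq h' ht
    have b4 : S.k * ‖γ' t - γ t‖ ^ 2 / (S.ρ + t) ^ 3 ≤ S.k * (2 * M) ^ 2 / (S.ρ + t) ^ 3 := by
      gcongr
    have b5 : ‖v' t - v t‖ ^ 2 / 2 ≤ S.k * M ^ 2 / (S.ρ + t) ^ 3 := by
      have c1 : S.k ≤ S.ρ + t := by linarith [S.k_le]
      calc ‖v' t - v t‖ ^ 2 / 2 ≤ ‖v' t - v t‖ ^ 2 := by linarith [sq_nonneg ‖v' t - v t‖]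
        _ ≤ (S.k * M / (S.ρ + t) ^ 2) ^ 2 := by gcongr
        _ = S.k * M ^ 2 * S.k / (S.ρ + t) ^ 4 := by field_simp
        _ ≤ S.k * M ^ 2 * (S.ρ + t) / (S.ρ + t) ^ 4 := by gcongr
        _ = _ := by field_simp
    calc ‖Q' t‖ ≤ |S.u (γ' t) - S.u (γ t) - inner ℝ (S.F (γ t)) (γ' t - γ t)| +
          |‖v' t - v t‖ ^ 2 / 2| := abs_add_le _ _
      _ ≤ S.k * (2 * M) ^ 2 / (S.ρ + t) ^ 3 + S.k * M ^ 2 / (S.ρ + t) ^ 3 := by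
        rw [abs_of_nonneg (by positivity : 0 ≤ ‖v' t - v t‖ ^ 2 / 2)]
        exact add_le_add (b1.trans b4) b5
      _ = _ := by ring
  have hQl : Tendsto Q atTop (𝓝 (2 * inner ℝ L b - inner ℝ b L)) :=
    ((h.tendsto_inner_sub h' hL).const_mul 2).sub (h.lim.inner hL)
  have := norm_lim_sub_le (fun s t hs hst => norm_sub_le_of_norm_deriv_le hQ
    (fun t ht => (hasDerivAt_neg_div_sq (5 * S.k * M ^ 2) (ρ := S.ρ) (by linarith)).hasDerivWithinAt)
    hQb hs hst) hQl (tendsto_neg_div_sq _ _) le_rfl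
  simp only [Q, h.init, h'.init, add_zero, zero_sub, neg_neg, real_inner_comm L b] at this
  rw [norm_sub_rev, Real.norm_eq_abs] at this
  calc _ = |2 * (inner ℝ y (v' 0) - inner ℝ x (v 0)) - inner ℝ (v 0) (y - x) -
        (2 * inner ℝ L b - inner ℝ L b)| := by congr 1; ring
    _ ≤ _ := this
    _ = _ := by ring

end Difference

variable [CompleteSpace V]

/-- The generating function of the field of rays with limit velocity `b`, normalized to take the
value `⟪p, b⟫` at `p`. By Euler's identity the action of a ray is an explicit function of its end
points, velocities and duration; the generating function is what remains of it in the limit. -/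
noncomputable def gen (S : FarField V) (b p x : V) : ℝ :=
  inner ℝ p b + (2 * inner ℝ x (field S b x) - 2 * inner ℝ p (field S b p) -
    limUnder atTop fun t => inner ℝ (ray S b x t - ray S b p t) b)

section Gen

variable {b p x y : V}

lemma gen_base : gen S b p p = inner ℝ p b := by
  simp [gen, tendsto_const_nhds.limUnder_eq]

/-- The gradient of the generating function is the field of initial velocities. -/
lemma gen_quadratic (hb : ‖b - S.a‖ ≤ S.ε / 2) (hp : p ∈ S.region) (hx : x ∈ S.region)
    (hy : y ∈ S.region) :
    |gen S b p y - gen S b p x - inner ℝ (field S b x) (y - x)| ≤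
      5 * S.k / (2 * S.ρ ^ 2) * ‖y - x‖ ^ 2 := by
  have sp := sol_ray hb hp
  have sx := sol_ray hb hx
  have sy := sol_ray hb hy
  obtain ⟨L, hL⟩ := sx.exists_tendsto_sub sy
  obtain ⟨Lx, hLx⟩ := sp.exists_tendsto_sub sx
  have hLy : Tendsto (fun t => ray S b y t - ray S b p t) atTop (𝓝 (L + Lx)) :=
    (hL.add hLx).congr fun t => by abel
  have e1 : limUnder atTop (fun t => inner ℝ (ray S b x t - ray S b p t) b) = inner ℝ Lx b :=
    (hLx.inner tendsto_const_nhds).limUnder_eq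
  have e2 : limUnder atTop (fun t => inner ℝ (ray S b y t - ray S b p t) b) = inner ℝ (L + Lx) b :=
    (hLy.inner tendsto_const_nhds).limUnder_eq
  refine le_trans (le_of_eq ?_) (sx.quadratic sy hL)
  rw [gen, gen, e1, e2, inner_add_left]
  simp only [field]
  congr 1
  ring

lemma abs_gen_sub_le (hb : ‖b - S.a‖ ≤ S.ε / 2) (hp : p ∈ S.region) (hx : x ∈ S.region)
    (hy : y ∈ S.region) : |gen S b p y - gen S b p x| ≤ (‖b‖ + S.ε) * ‖y - x‖ := by
  refine abs_sub_le_of_quadratic convex_region (fun x hx y hy => gen_quadratic hb hp hx hy)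
    (fun x hx => ?_) hx hy
  have h1 := norm_field_sub_le hb hx
  have h2 := (k_div_le (S := S) le_rfl).1
  have h3 := norm_sub_norm_le (field S b x) b
  linarith [S.ε_pos]

lemma abs_gen_sub_inner_le (hb : ‖b - S.a‖ ≤ S.ε / 2) (hp : p ∈ S.region) (hx : x ∈ S.region) :
    |gen S b p x - inner ℝ x b| ≤ S.k / S.ρ * ‖x - p‖ := by
  have := abs_sub_le_of_quadratic (f := fun x => gen S b p x - inner ℝ x b)
    (G := fun x => field S b x - b) convex_region
    (fun x hx y hy => by
      refine le_trans (le_of_eq ?_) (gen_quadratic hb hp hx hy)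
      rw [inner_sub_left, real_inner_comm _ b, inner_sub_left]
      congr 1; ring)
    (fun x hx => norm_field_sub_le hb hx) hp hx
  simpa [gen_base] using this

lemma abs_gen_sub_gen_param_le {b' : V} (hb : ‖b - S.a‖ ≤ S.ε / 2) (hb' : ‖b' - S.a‖ ≤ S.ε / 2)
    (hp : p ∈ S.region) (hx : x ∈ S.region) (hy : y ∈ S.region) :
    |(gen S b p y - gen S b p x) - (gen S b' p y - gen S b' p x)| ≤
      2 * ‖b - b'‖ * ‖y - x‖ := by
  have := abs_sub_le_of_quadratic (f := fun x => gen S b p x - gen S b' p x)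
    (G := fun x => field S b x - field S b' x) convex_region
    (fun x hx y hy => by
      have h1 := gen_quadratic hb hp hx hy
      have h2 := gen_quadratic hb' hp hx hy
      have h3 := abs_sub _ _ |>.trans (add_le_add h1 h2)
      refine le_trans (le_of_eq ?_) (h3.trans (le_of_eq (two_mul _).symm |>.trans
        (le_of_eq (mul_assoc _ _ _).symm)))
      rw [inner_sub_left]
      congr 1; ring)
    (fun x hx => norm_field_sub_field_param_le hb hx hb') hx hy
  refine le_trans (le_of_eq ?_) this
  congr 1; ring

end Gen

end FarField

/-! ### Absolutely continuous curves -/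

lemma absolutelyContinuousOnInterval_of_dist_le {X Y : Type*} [PseudoMetricSpace X]
    [PseudoMetricSpace Y] {f : ℝ → X} {g : ℝ → Y} {K s t : ℝ}
    (hf : AbsolutelyContinuousOnInterval f s t)
    (h : ∀ x ∈ uIcc s t, ∀ y ∈ uIcc s t, dist (g x) (g y) ≤ K * dist (f x) (f y)) :
    AbsolutelyContinuousOnInterval g s t := by
  have hf0 := Tendsto.const_mul K hf
  rw [mul_zero] at hf0
  refine squeeze_zero' (Eventually.of_forall fun E => Finset.sum_nonneg fun _ _ => dist_nonneg)
    ?_ hf0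
  refine eventually_inf_principal.2 (Eventually.of_forall fun E hE => ?_)
  rw [Finset.mul_sum]
  exact Finset.sum_le_sum fun i hi => h _ (hE.1 i hi).1 _ (hE.1 i hi).2

section Scalar

variable {f : ℝ → ℝ} {s t : ℝ} {G : ℝ → ENNReal}

lemma ofReal_sub_le_lintegral_deriv (hf : AbsolutelyContinuousOnInterval f s t) (hst : s ≤ t) :
    ENNReal.ofReal (f t - f s) ≤ ∫⁻ r in Icc s t, ENNReal.ofReal (deriv f r) := by
  rw [← hf.integral_deriv_eq_sub, intervalIntegral.integral_of_le hst, ← integral_Icc_eq_integral_Ioc]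
  have hi : IntegrableOn (deriv f) (Icc s t) := by
    have := hf.intervalIntegrable_deriv
    rwa [intervalIntegrable_iff_integrableOn_Icc_of_le hst] at this
  apply ENNReal.ofReal_le_of_le_toReal
  rw [integral_eq_lintegral_pos_part_sub_lintegral_neg_part hi]
  linarith [ENNReal.toReal_nonneg (a := ∫⁻ r in Icc s t, ENNReal.ofReal (-deriv f r))]

lemma ofReal_sub_le_lintegral (hf : AbsolutelyContinuousOnInterval f s t) (hst : s ≤ t)
    (hG : ∀ᵐ r ∂volume.restrict (Icc s t), ENNReal.ofReal (deriv f r) ≤ G r) :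
    ENNReal.ofReal (f t - f s) ≤ ∫⁻ r in Icc s t, G r :=
  (ofReal_sub_le_lintegral_deriv hf hst).trans (lintegral_mono_ae hG)

lemma lintegral_ofReal_deriv_lt_top (hf : AbsolutelyContinuousOnInterval f s t) (hst : s ≤ t) :
    ∫⁻ r in Icc s t, ENNReal.ofReal (deriv f r) < ⊤ := by
  have hi : IntegrableOn (deriv f) (Icc s t) := by
    have := hf.intervalIntegrable_deriv
    rwa [intervalIntegrable_iff_integrableOn_Icc_of_le hst] at this
  exact hi.lintegral_lt_top

lemma ae_eq_of_lintegral_le {f : ℝ → ℝ} (hf : AbsolutelyContinuousOnInterval f s t) (hst : s ≤ t)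
    (hG : ∀ᵐ r ∂volume.restrict (Icc s t), ENNReal.ofReal (deriv f r) ≤ G r)
    (hGm : AEMeasurable G (volume.restrict (Icc s t)))
    (hle : ∫⁻ r in Icc s t, G r ≤ ENNReal.ofReal (f t - f s)) :
    ∀ᵐ r ∂volume.restrict (Icc s t), ENNReal.ofReal (deriv f r) = G r :=
  ae_eq_of_ae_le_of_lintegral_le hG (lintegral_ofReal_deriv_lt_top hf hst).ne hGm
    (hle.trans (ofReal_sub_le_lintegral_deriv hf hst))

end Scalar

section Action

variable {V : Type*} [NormedAddCommGroup V] [InnerProductSpace ℝ V]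

/-- The action of the Lagrangian `‖v‖² / 2 + U + h` along the curve `σ`. -/
noncomputable def curveAction (U : V → ENNReal) (h : ℝ) (σ : ℝ → V) (s t : ℝ) : ENNReal :=
  ∫⁻ r in Icc s t, (ENNReal.ofReal (‖deriv σ r‖ ^ 2 / 2) + U (σ r) + ENNReal.ofReal h)

variable {U : V → ENNReal} {h : ℝ} {σ : ℝ → V} {s r t : ℝ}

lemma curveAction_add (hsr : s ≤ r) (hrt : r ≤ t) :
    curveAction U h σ s r + curveAction U h σ r t = curveAction U h σ s t := by
  unfold curveAction
  rw [setLIntegral_congr (Ioc_ae_eq_Icc (a := r) (b := t)).symm, ← Icc_union_Ioc_eq_Icc hsr hrt,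
    lintegral_union measurableSet_Ioc]
  exact disjoint_left.2 fun x hx hx' => not_lt.2 hx.2 hx'.1

lemma ofReal_mul_le_curveAction :
    ENNReal.ofReal h * ENNReal.ofReal (t - s) ≤ curveAction U h σ s t := by
  have : ∫⁻ r in Icc s t, ENNReal.ofReal h ≤ curveAction U h σ s t :=
    lintegral_mono fun r => le_add_self
  simpa using this

lemma ae_restrict_Icc_of_Ioo {P : ℝ → Prop} (h : ∀ᵐ r, r ∈ Ioo s t → P r) :
    ∀ᵐ r ∂volume.restrict (Icc s t), P r := by
  rw [← Measure.restrict_congr_set Ioo_ae_eq_Icc, ae_restrict_iff' measurableSet_Ioo]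
  exact h

variable [FiniteDimensional ℝ V]

lemma ae_hasDerivAt (hσ : AbsolutelyContinuousOnInterval σ s t) (hst : s ≤ t) :
    ∀ᵐ r ∂volume.restrict (Icc s t), r ∈ Ioo s t ∧ HasDerivAt σ (deriv σ r) r := by
  apply ae_restrict_Icc_of_Ioo
  filter_upwards [hσ.boundedVariationOn.ae_differentiableAt_of_mem_uIcc] with r hr hrm
  exact ⟨hrm, (hr (by rw [uIcc_of_le hst]; exact Ioo_subset_Icc_self hrm)).hasDerivAt⟩

/-- A curve is at least as expensive as its displacement at any slope `c`, with a gain proportional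
to its duration when `c` is subcritical, that is `c² / 2 < h`. -/
lemma ofReal_norm_sub_le_curveAction (hσ : AbsolutelyContinuousOnInterval σ s t) (hst : s ≤ t)
    {c : ℝ} (hc : 0 ≤ c) (hh : 0 ≤ h) :
    ENNReal.ofReal (c * ‖σ t - σ s‖ + (h - c ^ 2 / 2) * (t - s)) ≤ curveAction U h σ s t := by
  obtain ⟨e, he, hed⟩ : ∃ e : V, ‖e‖ ≤ 1 ∧ inner ℝ e (σ t - σ s) = ‖σ t - σ s‖ := by
    rcases eq_or_ne (σ t - σ s) 0 with h0 | h0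
    · exact ⟨0, by simp, by simp [h0]⟩
    · have h1 : ‖σ t - σ s‖ ≠ 0 := norm_ne_zero_iff.2 h0
      refine ⟨‖σ t - σ s‖⁻¹ • (σ t - σ s), ?_, ?_⟩
      · rw [norm_smul, norm_inv, norm_norm, inv_mul_cancel₀ h1]
      · rw [real_inner_smul_left, real_inner_self_eq_norm_sq]; field_simp
  let f : ℝ → ℝ := fun r => c * inner ℝ e (σ r) + (h - c ^ 2 / 2) * r
  have hf : AbsolutelyContinuousOnInterval f s t := by
    have h1 : AbsolutelyContinuousOnInterval (fun r => c * inner ℝ e (σ r)) s t := by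
      refine absolutelyContinuousOnInterval_of_dist_le (K := c) hσ fun x _ y _ => ?_
      rw [Real.dist_eq, ← mul_sub, ← inner_sub_right, abs_mul, abs_of_nonneg hc, dist_eq_norm]
      gcongr
      exact (abs_real_inner_le_norm _ _).trans (mul_le_of_le_one_left (norm_nonneg _) he)
    have h2 : ContDiffOn ℝ 1 (fun r : ℝ => (h - c ^ 2 / 2) * r) (uIcc s t) := by fun_prop
    exact h1.add h2.absolutelyContinuousOnInterval
  have hfe : f t - f s = c * ‖σ t - σ s‖ + (h - c ^ 2 / 2) * (t - s) := by
    rw [← hed, inner_sub_right]; simp only [f]; ring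
  rw [← hfe]
  refine ofReal_sub_le_lintegral hf hst ?_
  filter_upwards [ae_hasDerivAt hσ hst] with r hr
  have h1 : HasDerivAt f (c * inner ℝ e (deriv σ r) + (h - c ^ 2 / 2)) r := by
    have h2 := (((hasDerivAt_const r e).inner ℝ hr.2).const_mul c).add
      ((hasDerivAt_id r).const_mul (h - c ^ 2 / 2))
    exact h2.congr_deriv (by simp)
  rw [h1.deriv]
  have h3 : inner ℝ e (deriv σ r) ≤ ‖deriv σ r‖ :=
    (real_inner_le_norm _ _).trans (mul_le_of_le_one_left (norm_nonneg _) he)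
  have h4 : c * inner ℝ e (deriv σ r) + (h - c ^ 2 / 2) ≤ ‖deriv σ r‖ ^ 2 / 2 + h := by
    nlinarith [sq_nonneg (‖deriv σ r‖ - c), mul_le_mul_of_nonneg_left h3 hc]
  refine (ENNReal.ofReal_le_ofReal h4).trans ?_
  rw [ENNReal.ofReal_add (by positivity) hh]
  gcongr
  exact le_self_add

end Action

namespace FarField

variable {V : Type*} [NormedAddCommGroup V] [InnerProductSpace ℝ V] [FiniteDimensional ℝ V]
  [CompleteSpace V] {S : FarField V}

/-! ### Calibration of curves in the region -/

section Calibration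

variable {b p : V} {U : V → ENNReal} {σ : ℝ → V} {s t : ℝ}

omit [FiniteDimensional ℝ V] in
lemma continuousOn_field (hb : ‖b - S.a‖ ≤ S.ε / 2) : ContinuousOn (field S b) S.region := by
  have hC : 0 ≤ S.k / S.ρ ^ 2 := by have := S.newton.k_nonneg; have := S.ρ_pos; positivity
  exact (LipschitzOnWith.of_dist_le_mul (K := ⟨_, hC⟩) fun x hx y hy => by
    rw [dist_eq_norm, dist_eq_norm]
    exact norm_field_sub_field_le hb hx hy S.ρ_pos hx.2 hy.2).continuousOn

omit [FiniteDimensional ℝ V] in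
lemma absolutelyContinuous_gen (hb : ‖b - S.a‖ ≤ S.ε / 2) (hp : p ∈ S.region) (hst : s ≤ t)
    (hσ : AbsolutelyContinuousOnInterval σ s t) (hR : ∀ r ∈ Icc s t, σ r ∈ S.region) :
    AbsolutelyContinuousOnInterval (fun r => gen S b p (σ r)) s t := by
  rw [← uIcc_of_le hst] at hR
  refine absolutelyContinuousOnInterval_of_dist_le (K := ‖b‖ + S.ε) hσ fun x hx y hy => ?_
  rw [Real.dist_eq, dist_eq_norm]
  exact abs_gen_sub_le hb hp (hR y hy) (hR x hx)

lemma ae_deriv_gen (hb : ‖b - S.a‖ ≤ S.ε / 2) (hp : p ∈ S.region) (hst : s ≤ t)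
    (hσ : AbsolutelyContinuousOnInterval σ s t) (hR : ∀ r ∈ Icc s t, σ r ∈ S.region) :
    ∀ᵐ r ∂volume.restrict (Icc s t),
      deriv (fun r => gen S b p (σ r)) r = inner ℝ (field S b (σ r)) (deriv σ r) := by
  filter_upwards [ae_hasDerivAt hσ hst] with r hr
  have h1 := hasDerivWithinAt_comp_of_quadratic (f := gen S b p) (T := Icc s t)
    (fun x hx => gen_quadratic hb hp (hR r (Ioo_subset_Icc_self hr.1)) (hR x hx))
    hr.2.hasDerivWithinAt
  exact (h1.hasDerivAt (Icc_mem_nhds hr.1.1 hr.1.2)).deriv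

omit [FiniteDimensional ℝ V] in
lemma lagrangian_eq (hb : ‖b - S.a‖ ≤ S.ε / 2) (hU : ∀ x ∈ S.region, U x = ENNReal.ofReal (S.u x))
    {x w : V} (hx : x ∈ S.region) :
    ENNReal.ofReal (‖w‖ ^ 2 / 2) + U x + ENNReal.ofReal (‖b‖ ^ 2 / 2) =
      ENNReal.ofReal (inner ℝ (field S b x) w + ‖w - field S b x‖ ^ 2 / 2) := by
  have hu := S.newton.u_nonneg x hx.1 (S.ρ_pos.trans_le hx.2)
  rw [hU x hx, ← ENNReal.ofReal_add (by positivity) hu, ← ENNReal.ofReal_add (by positivity)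
    (by positivity)]
  congr 1
  rw [norm_sub_sq_real, norm_field_sq hb hx, real_inner_comm]
  ring

/-- The generating function bounds the action from below, in the region. -/
lemma ofReal_gen_sub_le (hb : ‖b - S.a‖ ≤ S.ε / 2) (hp : p ∈ S.region)
    (hU : ∀ x ∈ S.region, U x = ENNReal.ofReal (S.u x)) (hst : s ≤ t)
    (hσ : AbsolutelyContinuousOnInterval σ s t) (hR : ∀ r ∈ Icc s t, σ r ∈ S.region) :
    ENNReal.ofReal (gen S b p (σ t) - gen S b p (σ s)) ≤
      curveAction U (‖b‖ ^ 2 / 2) σ s t := by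
  refine ofReal_sub_le_lintegral (absolutelyContinuous_gen hb hp hst hσ hR) hst ?_
  filter_upwards [ae_deriv_gen hb hp hst hσ hR, ae_restrict_mem measurableSet_Icc] with r hr hrm
  rw [hr, lagrangian_eq hb hU (hR r hrm)]
  exact ENNReal.ofReal_le_ofReal (by linarith [sq_nonneg ‖deriv σ r - field S b (σ r)‖])

/-- Curves whose action is the increment of the generating function are integral curves. -/
lemma ae_deriv_eq_field (hb : ‖b - S.a‖ ≤ S.ε / 2) (hb0 : b ≠ 0) (hp : p ∈ S.region)
    (hU : ∀ x ∈ S.region, U x = ENNReal.ofReal (S.u x)) (hst : s ≤ t)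
    (hσ : AbsolutelyContinuousOnInterval σ s t) (hR : ∀ r ∈ Icc s t, σ r ∈ S.region)
    (hle : curveAction U (‖b‖ ^ 2 / 2) σ s t ≤
      ENNReal.ofReal (gen S b p (σ t) - gen S b p (σ s))) :
    ∀ᵐ r ∂volume.restrict (Icc s t), deriv σ r = field S b (σ r) := by
  have hσc : ContinuousOn σ (Icc s t) := by
    have := hσ.continuousOn
    rwa [uIcc_of_le hst] at this
  have hXc : ContinuousOn (fun r => field S b (σ r)) (Icc s t) :=
    (continuousOn_field hb).comp hσc hR
  have hXm := hXc.aestronglyMeasurable measurableSet_Icc (μ := volume)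
  have hdm : AEStronglyMeasurable (deriv σ) (volume.restrict (Icc s t)) :=
    aestronglyMeasurable_deriv _ _
  have hm : AEMeasurable (fun r => ENNReal.ofReal (inner ℝ (field S b (σ r)) (deriv σ r) +
      ‖deriv σ r - field S b (σ r)‖ ^ 2 / 2)) (volume.restrict (Icc s t)) :=
    ((hXm.inner hdm).aemeasurable.add
      (((hdm.sub hXm).norm.aemeasurable.pow_const 2).div_const 2)).ennreal_ofReal
  have hd := ae_deriv_gen hb hp hst hσ hR
  have hact : curveAction U (‖b‖ ^ 2 / 2) σ s t = ∫⁻ r in Icc s t,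
      ENNReal.ofReal (inner ℝ (field S b (σ r)) (deriv σ r) +
        ‖deriv σ r - field S b (σ r)‖ ^ 2 / 2) :=
    setLIntegral_congr_fun measurableSet_Icc fun r hr => lagrangian_eq hb hU (hR r hr)
  rw [hact] at hle
  have key := ae_eq_of_lintegral_le (absolutelyContinuous_gen hb hp hst hσ hR) hst (by
    filter_upwards [hd] with r hr
    rw [hr]
    exact ENNReal.ofReal_le_ofReal (by linarith [sq_nonneg ‖deriv σ r - field S b (σ r)‖])) hm hle
  filter_upwards [key, hd, ae_restrict_mem measurableSet_Icc] with r h1 h2 hrm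
  rw [h2] at h1
  have hpos : 0 < inner ℝ (field S b (σ r)) (deriv σ r) +
      ‖deriv σ r - field S b (σ r)‖ ^ 2 / 2 := by
    rw [← ENNReal.ofReal_pos, ← lagrangian_eq hb hU (hR r hrm)]
    have : 0 < ‖b‖ ^ 2 / 2 := by have := norm_pos_iff.2 hb0; positivity
    exact (ENNReal.ofReal_pos.2 this).trans_le le_add_self
  have h3 : inner ℝ (field S b (σ r)) (deriv σ r) = inner ℝ (field S b (σ r)) (deriv σ r) +
      ‖deriv σ r - field S b (σ r)‖ ^ 2 / 2 := by
    have h4 : 0 < inner ℝ (field S b (σ r)) (deriv σ r) := by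
      rw [← ENNReal.ofReal_pos, h1]; exact ENNReal.ofReal_pos.2 hpos
    exact (ENNReal.ofReal_eq_ofReal_iff h4.le hpos.le).1 h1
  have h5 : ‖deriv σ r - field S b (σ r)‖ ^ 2 = 0 := by linarith
  exact sub_eq_zero.1 (norm_eq_zero.1 (pow_eq_zero_iff two_ne_zero |>.1 h5))

/-- The action of a curve whose velocity is close to the field exceeds the increment of the
generating function only to second order. -/
lemma curveAction_le_of_near (hb : ‖b - S.a‖ ≤ S.ε / 2) (hp : p ∈ S.region)
    (hU : ∀ x ∈ S.region, U x = ENNReal.ofReal (S.u x)) (hst : s ≤ t)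
    (hσ : AbsolutelyContinuousOnInterval σ s t) (hR : ∀ r ∈ Icc s t, σ r ∈ S.region) {δ : ℝ}
    (hδ : ∀ r ∈ Ioo s t, ‖deriv σ r - field S b (σ r)‖ ≤ δ) :
    curveAction U (‖b‖ ^ 2 / 2) σ s t ≤
      ENNReal.ofReal (gen S b p (σ t) - gen S b p (σ s) + δ ^ 2 / 2 * (t - s)) := by
  have hd := ae_deriv_gen hb hp hst hσ hR
  have hac := absolutelyContinuous_gen hb hp hst hσ hR
  have hi : IntegrableOn (deriv fun r => gen S b p (σ r)) (Icc s t) := by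
    have := hac.intervalIntegrable_deriv
    rwa [intervalIntegrable_iff_integrableOn_Icc_of_le hst] at this
  have hc : IntegrableOn (fun _ : ℝ => δ ^ 2 / 2) (Icc s t) := by simp
  have hle : ∀ᵐ r ∂volume.restrict (Icc s t),
      ENNReal.ofReal (‖deriv σ r‖ ^ 2 / 2) + U (σ r) + ENNReal.ofReal (‖b‖ ^ 2 / 2) ≤
        ENNReal.ofReal (deriv (fun r => gen S b p (σ r)) r + δ ^ 2 / 2) ∧
      0 ≤ deriv (fun r => gen S b p (σ r)) r + δ ^ 2 / 2 := by
    filter_upwards [hd, ae_restrict_mem measurableSet_Icc,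
      ae_restrict_Icc_of_Ioo (Eventually.of_forall fun r (hr : r ∈ Ioo s t) => hr)] with r h1 hr hr'
    have h2 : ‖deriv σ r - field S b (σ r)‖ ^ 2 ≤ δ ^ 2 := by gcongr; exact hδ r hr'
    rw [h1]
    constructor
    · rw [lagrangian_eq hb hU (hR r hr)]
      exact ENNReal.ofReal_le_ofReal (by linarith)
    · have h3 : inner ℝ (field S b (σ r)) (deriv σ r) + ‖deriv σ r - field S b (σ r)‖ ^ 2 / 2 =
          ‖deriv σ r‖ ^ 2 / 2 + ‖field S b (σ r)‖ ^ 2 / 2 := by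
        rw [norm_sub_sq_real, real_inner_comm]; ring
      have := sq_nonneg ‖deriv σ r‖
      have := sq_nonneg ‖field S b (σ r)‖
      linarith
  calc curveAction U (‖b‖ ^ 2 / 2) σ s t
      ≤ ∫⁻ r in Icc s t, ENNReal.ofReal (deriv (fun r => gen S b p (σ r)) r + δ ^ 2 / 2) :=
        lintegral_mono_ae (hle.mono fun r hr => hr.1)
    _ = ENNReal.ofReal (∫ r in Icc s t, (deriv (fun r => gen S b p (σ r)) r + δ ^ 2 / 2)) :=
        (ofReal_integral_eq_lintegral_ofReal (hi.add hc) (hle.mono fun r hr => hr.2)).symm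
    _ = _ := by
        rw [integral_add hi hc, integral_Icc_eq_integral_Ioc, ← intervalIntegral.integral_of_le hst,
          hac.integral_deriv_eq_sub]
        simp [hst, mul_comm]

end Calibration

end FarField

namespace FarField

variable {V : Type*} [NormedAddCommGroup V] [InnerProductSpace ℝ V] {S : FarField V}

/-! ### Rays as calibrated curves -/

section Rays

variable {b x : V} {γ v : ℝ → V}

lemma Sol.hasDerivAt (h : S.Sol b x γ v) {t : ℝ} (ht : 0 < t) : HasDerivAt γ (v t) t :=
  (h.deriv_pos t ht.le).hasDerivAt (Ici_mem_nhds ht)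

lemma Sol.dist_le (h : S.Sol b x γ v) {s t : ℝ} (hs : 0 ≤ s) (ht : 0 ≤ t) :
    dist (γ s) (γ t) ≤ (‖b‖ + S.ε) * dist s t := by
  have key : ∀ s t, 0 ≤ s → s ≤ t → dist (γ s) (γ t) ≤ (‖b‖ + S.ε) * dist s t := by
    intro s t hs hst
    have h1 := norm_sub_le_of_norm_deriv_le (g := fun t => (‖b‖ + S.ε) * t) h.deriv_pos
      (fun t _ => ((hasDerivAt_id t).const_mul (‖b‖ + S.ε)).hasDerivWithinAt)
      (fun t ht => by
        have h2 := h.vel_near t ht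
        have h3 := norm_sub_norm_le (v t) b
        have := S.ε_pos
        simp only [mul_one]; linarith) hs hst
    rw [dist_eq_norm, norm_sub_rev, Real.dist_eq, abs_sub_comm, abs_of_nonneg (by linarith)]
    linarith
  rcases le_total s t with hst | hst
  · exact key s t hs hst
  · rw [dist_comm, dist_comm s]; exact key t s ht hst

lemma Sol.absolutelyContinuous (h : S.Sol b x γ v) {s t : ℝ} (hs : 0 ≤ s) (ht : 0 ≤ t) :
    AbsolutelyContinuousOnInterval γ s t := by
  have hC : 0 ≤ ‖b‖ + S.ε := by have := S.ε_pos; positivity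
  refine LipschitzOnWith.absolutelyContinuousOnInterval (K := ⟨_, hC⟩)
    (LipschitzOnWith.of_dist_le_mul fun r hr r' hr' => h.dist_le ?_ ?_)
  · exact (le_min hs ht).trans hr.1
  · exact (le_min hs ht).trans hr'.1

/-- A solution departs at most logarithmically from the uniform motion with its limit velocity. -/
lemma Sol.norm_pos_sub_le (h : S.Sol b x γ v) {t : ℝ} (ht : 0 ≤ t) :
    ‖γ t - x - t • b‖ ≤ S.k * Real.log ((S.ρ + t) / S.ρ) ∧ ‖γ t - x - t • b‖ ≤ S.k / S.ρ * t := by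
  have hρ := S.ρ_pos
  have hk := S.newton.k_nonneg
  have hd : ∀ t, 0 ≤ t → HasDerivWithinAt (fun t => γ t - x - t • b) (v t - b) (Ici 0) t :=
    fun t ht => (((h.deriv_pos t ht).sub_const x).sub
      ((hasDerivAt_id t).smul_const b).hasDerivWithinAt).congr_deriv (by simp)
  constructor
  · have h1 := norm_sub_le_of_norm_deriv_le (g := fun t => S.k * Real.log (S.ρ + t)) hd
      (fun t ht => ((((hasDerivAt_id t).const_add S.ρ).log (by simp; linarith)).const_mul
        S.k).hasDerivWithinAt)
      (fun t ht => (h.norm_vel_sub_le hρ h.mem.2 ht).trans (le_of_eq (by simp; ring))) le_rfl ht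
    simp only [h.init, zero_smul, sub_self, sub_zero, add_zero] at h1
    rw [Real.log_div (by linarith) hρ.ne', mul_sub]
    exact h1
  · have h1 := norm_sub_le_of_norm_deriv_le (g := fun t => S.k / S.ρ * t) hd
      (fun t ht => ((hasDerivAt_id t).const_mul (S.k / S.ρ)).hasDerivWithinAt)
      (fun t ht => (h.norm_vel_sub_le hρ h.mem.2 ht).trans (by
        rw [mul_one]; gcongr; linarith)) le_rfl ht
    simpa [h.init] using h1

end Rays

variable [FiniteDimensional ℝ V] [CompleteSpace V]

section Calibrated

variable {b p x : V} {U : V → ENNReal} {σ : ℝ → V} {t : ℝ}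

/-- The rays are the only absolutely continuous integral curves of the field. -/
lemma eq_ray_of_ae_deriv (hb : ‖b - S.a‖ ≤ S.ε / 2) {τ : ℝ} (hτ : 0 ≤ τ)
    (hσ : AbsolutelyContinuousOnInterval σ 0 τ) (hR : ∀ r ∈ Icc 0 τ, σ r ∈ S.region)
    (hd : ∀ᵐ r ∂volume.restrict (Icc 0 τ), deriv σ r = field S b (σ r)) :
    σ τ = ray S b (σ 0) τ := by
  have h := sol_ray hb (hR 0 (left_mem_Icc.2 hτ))
  set γ := ray S b (σ 0)
  set L := S.k / S.ρ ^ 2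
  let g : ℝ → ℝ := fun r => ‖σ r - γ r‖
  -- Grönwall's argument: the integrating factor `E` makes `‖σ - γ‖² E` nonincreasing
  let E : ℝ → ℝ := fun r => Real.exp (-(2 * L) * r)
  have hgac : AbsolutelyContinuousOnInterval g 0 τ :=
    absolutelyContinuousOnInterval_of_dist_le (K := 1) (hσ.sub (h.absolutelyContinuous le_rfl hτ))
      fun x _ y _ => by
        rw [one_mul, Real.dist_eq, dist_eq_norm]; exact abs_norm_sub_norm_le _ _
  have hEac : AbsolutelyContinuousOnInterval E 0 τ :=
    ContDiffOn.absolutelyContinuousOnInterval (by fun_prop)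
  have hac := (hgac.mul hgac).mul hEac
  have hderiv : ∀ᵐ r ∂volume.restrict (Icc 0 τ), deriv (g * g * E) r ≤ 0 := by
    filter_upwards [hd, ae_hasDerivAt hσ hτ] with r hr hr'
    have h1 := (hr'.2.sub (h.hasDerivAt hr'.1.1)).norm_sq
    have h2 : HasDerivAt E (E r * (-(2 * L) * 1)) r :=
      ((hasDerivAt_id r).const_mul (-(2 * L))).exp
    have h3 := h1.mul h2
    have h4 : g * g * E = (fun r => ‖(σ - γ) r‖ ^ 2) * E := by
      ext r; simp [g, pow_two]
    rw [h4, h3.deriv]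
    have hm := hR r (Ioo_subset_Icc_self hr'.1)
    have hm' := h.mem_region hr'.1.1.le
    have h5 := norm_field_sub_field_le hb hm hm' S.ρ_pos hm.2 hm'.2
    have h6 : rayVel S b (σ 0) r = field S b (γ r) :=
      rayVel_eq_field hb (hR 0 (left_mem_Icc.2 hτ)) hr'.1.1.le
    rw [hr, h6]
    have h7 : inner ℝ ((σ - γ) r) (field S b (σ r) - field S b (γ r)) ≤ L * ‖(σ - γ) r‖ ^ 2 := by
      refine (real_inner_le_norm _ _).trans ?_
      calc _ ≤ ‖(σ - γ) r‖ * (L * ‖(σ - γ) r‖) := by gcongr; exact h5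
        _ = _ := by ring
    have h8 : 0 ≤ E r := (Real.exp_pos _).le
    nlinarith [mul_le_mul_of_nonneg_right h7 h8]
  have hint := hac.integral_deriv_eq_sub
  rw [intervalIntegral.integral_of_le hτ, ← integral_Icc_eq_integral_Ioc] at hint
  have hle := integral_nonpos_of_ae hderiv
  have h0 : (g * g * E) 0 = 0 := by simp [g, γ, h.init]
  rw [hint, h0, sub_zero] at hle
  have hE : 0 < E τ := Real.exp_pos _
  have h9 : g τ * g τ ≤ 0 := by
    by_contra hcon
    exact absurd hle (not_le.2 (mul_pos (not_le.1 hcon) hE))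
  have h10 : g τ = 0 := by nlinarith [mul_self_nonneg (g τ)]
  exact sub_eq_zero.1 (norm_eq_zero.1 h10)

/-- The generating function calibrates the rays. -/
lemma curveAction_ray_le (hb : ‖b - S.a‖ ≤ S.ε / 2) (hp : p ∈ S.region)
    (hU : ∀ x ∈ S.region, U x = ENNReal.ofReal (S.u x)) (hx : x ∈ S.region) (ht : 0 ≤ t) :
    curveAction U (‖b‖ ^ 2 / 2) (ray S b x) 0 t ≤
      ENNReal.ofReal (gen S b p (ray S b x t) - gen S b p x) := by
  have h := sol_ray hb hx
  have := curveAction_le_of_near (δ := 0) hb hp hU ht (h.absolutelyContinuous le_rfl ht)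
    (fun r hr => h.mem_region hr.1) (fun r hr => by
      rw [(h.hasDerivAt hr.1).deriv, rayVel_eq_field hb hx hr.1.le]; simp)
  simpa [h.init] using this

/-- The point `x + T b` can be reached from `x` at an action that exceeds the increment of the
generating function by little: the ray from `x` misses this point by a logarithm of `T` only, and
this error can be distributed evenly over the time interval. -/
lemma exists_curve_of_add_smul (hb : ‖b - S.a‖ ≤ S.ε / 2) (hp : p ∈ S.region)
    (hU : ∀ x ∈ S.region, U x = ENNReal.ofReal (S.u x)) (hx : x ∈ S.region) {T : ℝ} (hT : 0 < T) :
    ∃ σ : ℝ → V, AbsolutelyContinuousOnInterval σ 0 T ∧ σ 0 = x ∧ σ T = x + T • b ∧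
      curveAction U (‖b‖ ^ 2 / 2) σ 0 T ≤ ENNReal.ofReal (gen S b p (x + T • b) - gen S b p x +
        2 * (S.k * Real.log ((S.ρ + T) / S.ρ)) ^ 2 / T) := by
  have hρ := S.ρ_pos
  have hk := S.newton.k_nonneg
  have h := sol_ray hb hx
  set γ := ray S b x
  set e : V := x + T • b - γ T with he
  obtain ⟨he1, he2⟩ := h.norm_pos_sub_le hT.le
  have hee : ‖e‖ = ‖γ T - x - T • b‖ := by rw [he, norm_sub_rev, sub_sub]
  rw [← hee] at he1 he2
  have hk4 := k_div_le (S := S) le_rfl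
  let σ : ℝ → V := fun s => γ s + (s / T) • e
  have hmem : ∀ s, 0 ≤ s → σ s ∈ S.dom ∧ S.ρ + s ≤ S.q (σ s) := by
    intro s hs
    have h1 := add_mem_region (w := σ s - x) hx.1 hx.2 hs (by
      have e1 : σ s - x - s • S.a = (γ s - x - s • b) + ((s / T) • e + s • (b - S.a)) := by
        simp only [σ]; module
      have e2 : ‖(s / T) • e‖ ≤ S.k / S.ρ * s := by
        rw [norm_smul, Real.norm_of_nonneg (by positivity)]
        calc s / T * ‖e‖ ≤ s / T * (S.k / S.ρ * T) := by gcongr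
          _ = _ := by field_simp
      have e3 : ‖s • (b - S.a)‖ ≤ s * (S.ε / 2) := by
        rw [norm_smul, Real.norm_of_nonneg hs]; gcongr
      have e4 := (h.norm_pos_sub_le hs).2
      have e5 : S.k / S.ρ * s ≤ S.ε / 4 * s :=
        mul_le_mul_of_nonneg_right hk4.1 hs
      rw [e1]
      refine (norm_add_le _ _).trans ?_
      have := norm_add_le ((s / T) • e) (s • (b - S.a))
      linarith)
    simpa using h1
  have hreg : ∀ s, 0 ≤ s → σ s ∈ S.region := fun s hs =>
    ⟨(hmem s hs).1, by linarith [(hmem s hs).2]⟩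
  have hac : AbsolutelyContinuousOnInterval σ 0 T :=
    (h.absolutelyContinuous le_rfl hT.le).add (g := fun s => (s / T) • e)
      (ContDiffOn.absolutelyContinuousOnInterval (by fun_prop))
  have h0 : σ 0 = x := by simp [σ, γ, h.init]
  have h1 : σ T = x + T • b := by simp [σ, he, hT.ne']
  refine ⟨σ, hac, h0, h1, ?_⟩
  have key := curveAction_le_of_near (δ := 2 * ‖e‖ / T) hb hp hU hT.le hac
    (fun s hs => hreg s hs.1) (fun s hs => by
      have d1 : HasDerivAt σ (rayVel S b x s + (1 / T) • e) s :=
        (h.hasDerivAt hs.1).add (((hasDerivAt_id s).div_const T).smul_const e)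
      rw [d1.deriv, rayVel_eq_field hb hx hs.1.le]
      have d2 := norm_field_sub_field_le hb (h.mem_region hs.1.le) (hreg s hs.1.le)
        (σ := S.ρ + s) (by linarith [hs.1]) (h.mem_dom h.mem.2 hs.1.le).2 (hmem s hs.1.le).2
      have d3 : ‖γ s - σ s‖ = s / T * ‖e‖ := by
        simp only [σ, sub_add_cancel_left, norm_neg, norm_smul]
        rw [Real.norm_of_nonneg (by have := hs.1.le; positivity)]
      have d4 : S.k / (S.ρ + s) ^ 2 * ‖γ s - σ s‖ ≤ ‖e‖ / T := by
        have hp : 0 < S.ρ + s := by linarith [hs.1]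
        have hs0 := hs.1.le
        rw [d3]
        calc S.k / (S.ρ + s) ^ 2 * (s / T * ‖e‖) = S.k * s / (S.ρ + s) ^ 2 * (‖e‖ / T) := by ring
          _ ≤ 1 * (‖e‖ / T) := by
            gcongr
            rw [div_le_one (by positivity)]
            have : S.k ≤ S.ρ + s := by linarith [S.k_le]
            nlinarith
          _ = _ := one_mul _
      calc ‖field S b (γ s) + (1 / T) • e - field S b (σ s)‖
          = ‖(1 / T) • e + (field S b (γ s) - field S b (σ s))‖ := by congr 1; abel
        _ ≤ ‖(1 / T) • e‖ + ‖field S b (γ s) - field S b (σ s)‖ := norm_add_le _ _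
        _ ≤ ‖e‖ / T + ‖e‖ / T := by
          refine add_le_add (le_of_eq ?_) (d2.trans d4)
          rw [norm_smul, Real.norm_of_nonneg (by positivity)]; ring
        _ = _ := by ring)
  rw [h0, h1] at key
  refine key.trans (ENNReal.ofReal_le_ofReal ?_)
  have : (2 * ‖e‖ / T) ^ 2 / 2 * (T - 0) = 2 * ‖e‖ ^ 2 / T := by field_simp; ring
  rw [this]
  gcongr

end Calibrated

/-! ### Curves leaving the region -/

section Barrier

variable {b p : V} {U : V → ENNReal} {σ : ℝ → V} {O : Set V} {ψ : V → ℝ} {c s τ : ℝ}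

/-- Let `O` be the set where the generating function exceeds a function `ψ` with small Lipschitz
constant. Excursions from `O` are more expensive than the increment of `ψ`, so that the generating
function bounds the action of all curves between points of `O`, and a curve whose action attains
this bound stays in the region. -/
lemma barrier (hb : ‖b - S.a‖ ≤ S.ε / 2) (hp : p ∈ S.region)
    (hU : ∀ x ∈ S.region, U x = ENNReal.ofReal (S.u x)) (hc : 0 ≤ c) (hcb : c < ‖b‖)
    (hψ : ∀ x y, ψ x - ψ y ≤ c * ‖x - y‖) (hO : IsOpen O) (hOR : closure O ⊆ S.region)
    (hcl : ∀ x ∈ closure O, ψ x ≤ gen S b p x)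
    (hout : ∀ x ∈ S.region, x ∉ O → gen S b p x ≤ ψ x) (hτ : s ≤ τ)
    (hσ : AbsolutelyContinuousOnInterval σ s τ) (h0 : σ s ∈ O) (h1 : σ τ ∈ O) :
    ENNReal.ofReal (gen S b p (σ τ) - gen S b p (σ s)) ≤ curveAction U (‖b‖ ^ 2 / 2) σ s τ ∧
    (curveAction U (‖b‖ ^ 2 / 2) σ s τ ≤ ENNReal.ofReal (gen S b p (σ τ) - gen S b p (σ s)) →
      ∀ r ∈ Icc s τ, σ r ∈ S.region) := by
  have hσc : ContinuousOn σ (Icc s τ) := by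
    have := hσ.continuousOn
    rwa [uIcc_of_le hτ] at this
  by_cases hall : ∀ r ∈ Icc s τ, σ r ∈ O
  · have hR : ∀ r ∈ Icc s τ, σ r ∈ S.region := fun r hr => hOR (subset_closure (hall r hr))
    exact ⟨ofReal_gen_sub_le hb hp hU hτ hσ hR, fun _ => hR⟩
  have hBc : IsCompact (Icc s τ ∩ σ ⁻¹' Oᶜ) :=
    isCompact_Icc.of_isClosed_subset
      (hσc.preimage_isClosed_of_isClosed isClosed_Icc hO.isClosed_compl) inter_subset_left
  have hBn : (Icc s τ ∩ σ ⁻¹' Oᶜ).Nonempty := by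
    push Not at hall
    obtain ⟨r, hr, hr'⟩ := hall
    exact ⟨r, hr, hr'⟩
  -- the first exit from `O` and the last entry into `O`
  obtain ⟨t₁, ⟨ht₁, ho₁⟩, hmin⟩ := hBc.exists_isLeast hBn
  obtain ⟨t₂, ⟨ht₂, ho₂⟩, hmax⟩ := hBc.exists_isGreatest hBn
  have h12 : t₁ ≤ t₂ := hmin ⟨ht₂, ho₂⟩
  have hbefore : ∀ r ∈ Ico s t₁, σ r ∈ O := fun r hr => by
    by_contra hcon
    exact absurd (hmin ⟨⟨hr.1, hr.2.le.trans ht₁.2⟩, hcon⟩) (not_le.2 hr.2)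
  have hafter : ∀ r ∈ Ioc t₂ τ, σ r ∈ O := fun r hr => by
    by_contra hcon
    exact absurd (hmax ⟨⟨ht₂.1.trans hr.1.le, hr.2⟩, hcon⟩) (not_le.2 hr.1)
  have hpos₁ : s < t₁ := lt_of_le_of_ne ht₁.1 fun h => ho₁ (h ▸ h0)
  have hpos₂ : t₂ < τ := lt_of_le_of_ne ht₂.2 fun h => ho₂ (h ▸ h1)
  have hc₁ : σ t₁ ∈ closure O :=
    ((hσc t₁ ht₁).mono (Ico_subset_Icc_self.trans (Icc_subset_Icc_right ht₁.2))).mem_closure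
      (by rw [closure_Ico hpos₁.ne]; exact right_mem_Icc.2 hpos₁.le) hbefore
  have hc₂ : σ t₂ ∈ closure O :=
    ((hσc t₂ ht₂).mono (Ioc_subset_Icc_self.trans (Icc_subset_Icc_left ht₂.1))).mem_closure
      (by rw [closure_Ioc hpos₂.ne]; exact left_mem_Icc.2 hpos₂.le) hafter
  have hR₁ : ∀ r ∈ Icc s t₁, σ r ∈ S.region := fun r hr => by
    rcases hr.2.eq_or_lt with h | h
    · rw [h]; exact hOR hc₁
    · exact hOR (subset_closure (hbefore r ⟨hr.1, h⟩))
  have hR₂ : ∀ r ∈ Icc t₂ τ, σ r ∈ S.region := fun r hr => by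
    rcases hr.1.eq_or_lt with h | h
    · rw [← h]; exact hOR hc₂
    · exact hOR (subset_closure (hafter r ⟨h, hr.2⟩))
  have hac : ∀ r r', r ∈ Icc s τ → r' ∈ Icc s τ → AbsolutelyContinuousOnInterval σ r r' :=
    fun r r' hs ht => hσ.mono (by
      rw [uIcc_of_le hτ]; exact ordConnected_Icc.uIcc_subset hs ht)
  have m0 : s ∈ Icc s τ := left_mem_Icc.2 hτ
  have mτ : τ ∈ Icc s τ := right_mem_Icc.2 hτ
  have hh : 0 ≤ ‖b‖ ^ 2 / 2 := by positivity
  have a1 := ofReal_gen_sub_le hb hp hU ht₁.1 (hac _ _ m0 ht₁) hR₁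
  have a2 := ofReal_norm_sub_le_curveAction (U := U) (hac _ _ ht₁ ht₂) h12 hc hh
  have a3 := ofReal_gen_sub_le hb hp hU ht₂.2 (hac _ _ ht₂ mτ) hR₂
  set D := gen S b p (σ τ) - gen S b p (σ s) with hD
  set μ := ‖b‖ ^ 2 / 2 - c ^ 2 / 2 with hμ
  have hμ0 : 0 < μ := by
    have : c ^ 2 < ‖b‖ ^ 2 := by gcongr
    linarith
  -- between `t₁` and `t₂` the generating function increases by no more than `ψ`
  have hsum : D + μ * (t₂ - t₁) ≤ (gen S b p (σ t₁) - gen S b p (σ s)) +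
      (c * ‖σ t₂ - σ t₁‖ + μ * (t₂ - t₁)) + (gen S b p (σ τ) - gen S b p (σ t₂)) := by
    have := hψ (σ t₂) (σ t₁)
    have := hcl _ hc₁
    have := hout _ (hOR hc₂) ho₂
    linarith
  have htot : ENNReal.ofReal (D + μ * (t₂ - t₁)) ≤ curveAction U (‖b‖ ^ 2 / 2) σ s τ := by
    rw [← curveAction_add (s := s) (r := t₂) ht₂.1 ht₂.2, ← curveAction_add (s := s) ht₁.1 h12]
    exact (ENNReal.ofReal_le_ofReal hsum).trans (ENNReal.ofReal_add_le.trans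
      (add_le_add (ENNReal.ofReal_add_le.trans (add_le_add a1 a2)) a3))
  refine ⟨(ENNReal.ofReal_le_ofReal ?_).trans htot, fun hle => ?_⟩
  · have := mul_nonneg hμ0.le (sub_nonneg.2 h12); linarith
  · have hb0 : 0 < ‖b‖ := hc.trans_lt hcb
    have hτ0 : s < τ := hpos₁.trans_le ht₁.2
    have hDpos : 0 < D := by
      rw [← ENNReal.ofReal_pos]
      refine lt_of_lt_of_le ?_ (ofReal_mul_le_curveAction.trans hle)
      refine ENNReal.mul_pos (ENNReal.ofReal_pos.2 (by positivity)).ne' ?_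
      exact (ENNReal.ofReal_pos.2 (by linarith)).ne'
    have hle2 := (ENNReal.ofReal_le_ofReal_iff hDpos.le).1 (htot.trans hle)
    have heq : t₁ = t₂ := by
      by_contra hne
      have := mul_pos hμ0 (sub_pos.2 (lt_of_le_of_ne h12 hne))
      linarith
    intro r hr
    rcases le_total r t₁ with h | h
    · exact hR₁ r ⟨hr.1, h⟩
    · exact hR₂ r ⟨heq ▸ h, hr.2⟩

end Barrier

end FarField

namespace FarField

variable {V : Type*} [NormedAddCommGroup V] [InnerProductSpace ℝ V] {S : FarField V}

/-! ### Motions with given limit shape -/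

section Motion

variable {η w : ℝ → V}

lemma eventually_le_q (hl : (fun t : ℝ => η t - t • S.a) =o[atTop] fun t : ℝ => t) :
    ∀ᶠ t in atTop, t ≤ S.q (η t) := by
  filter_upwards [hl.bound S.ε_pos, eventually_ge_atTop 0] with t h1 ht
  exact S.le_q t ht _ (by rwa [Real.norm_of_nonneg ht] at h1)

/-- The velocity of a motion with limit shape `a` converges to `a`: on `[t, 2t]` the velocity varies
by `O(1/t)` only, while its mean is `a + o(1)`. -/
lemma vel_tendsto (hη : ∀ t, 0 ≤ t → HasDerivWithinAt η (w t) (Ici 0) t)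
    (hw : ∀ t, 0 ≤ t → HasDerivWithinAt w (S.F (η t)) (Ici 0) t)
    (hR : ∀ t, 0 ≤ t → η t ∈ S.region)
    (hl : (fun t : ℝ => η t - t • S.a) =o[atTop] fun t : ℝ => t) : Tendsto w atTop (𝓝 S.a) := by
  have hk := S.newton.k_nonneg
  rw [Metric.tendsto_atTop]
  intro e he
  obtain ⟨t₀, ht₀⟩ := eventually_atTop.1 (((hl.bound (by positivity : 0 < e / 8)).and
    (eventually_le_q hl)).and (eventually_gt_atTop (max 0 (4 * S.k / e))))
  refine ⟨t₀, fun t ht => ?_⟩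
  obtain ⟨⟨h1, -⟩, h3⟩ := ht₀ t ht
  have htp : 0 < t := (le_max_left _ _).trans_lt h3
  obtain ⟨⟨h4, -⟩, -⟩ := ht₀ (2 * t) (by linarith)
  have hF : ∀ s, t ≤ s → ‖S.F (η s)‖ ≤ S.k / t ^ 2 := fun s hs => by
    have h5 := (ht₀ s (ht.trans hs)).1.2
    refine (S.newton.norm_F_le _ (hR s (htp.le.trans hs)).1 (by linarith)).trans ?_
    gcongr
    linarith
  have hwd : ∀ s ∈ Icc t (2 * t), ‖w s - w t‖ ≤ S.k / t := fun s hs => by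
    have := norm_image_sub_le_of_norm_deriv_right_le_segment (f := w) (a := t) (b := 2 * t)
      (fun r hr => ((hw r (htp.le.trans hr.1)).continuousWithinAt).mono
        fun z hz => htp.le.trans hz.1)
      (fun r hr => (hw r (htp.le.trans hr.1)).mono (Ici_subset_Ici.2 (htp.le.trans hr.1)))
      (fun r hr => hF r hr.1) s hs
    refine this.trans ?_
    calc S.k / t ^ 2 * (s - t) ≤ S.k / t ^ 2 * t := by gcongr; linarith [hs.2]
      _ = _ := by field_simp
  have hηd : ‖η (2 * t) - η t - t • w t‖ ≤ S.k := by
    have hd : ∀ r, 0 ≤ r → HasDerivWithinAt (fun r => η r - r • w t) (w r - w t) (Ici 0) r :=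
      fun r hr => ((hη r hr).sub ((hasDerivAt_id r).smul_const (w t)).hasDerivWithinAt).congr_deriv
        (by simp)
    have := norm_image_sub_le_of_norm_deriv_right_le_segment (f := fun r => η r - r • w t)
      (a := t) (b := 2 * t)
      (fun r hr => ((hd r (htp.le.trans hr.1)).continuousWithinAt).mono
        fun z hz => htp.le.trans hz.1)
      (fun r hr => (hd r (htp.le.trans hr.1)).mono (Ici_subset_Ici.2 (htp.le.trans hr.1)))
      (fun r hr => hwd r (Ico_subset_Icc_self hr)) (2 * t) (right_mem_Icc.2 (by linarith))
    refine le_trans (le_of_eq ?_) (this.trans (le_of_eq ?_))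
    · congr 1; module
    · field_simp; ring
  rw [Real.norm_of_nonneg htp.le] at h1
  rw [Real.norm_of_nonneg (by linarith)] at h4
  have h5 : t * ‖w t - S.a‖ ≤ e / 8 * (2 * t) + e / 8 * t + S.k := by
    calc t * ‖w t - S.a‖ = ‖t • (w t - S.a)‖ := by rw [norm_smul, Real.norm_of_nonneg htp.le]
      _ = ‖(η (2 * t) - (2 * t) • S.a) - (η t - t • S.a) - (η (2 * t) - η t - t • w t)‖ := by
        congr 1; module
      _ ≤ ‖η (2 * t) - (2 * t) • S.a‖ + ‖η t - t • S.a‖ + ‖η (2 * t) - η t - t • w t‖ :=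
        (norm_sub_le _ _).trans (by gcongr; exact norm_sub_le _ _)
      _ ≤ _ := by gcongr
  have h6 : 4 * S.k < e * t := by
    have := (le_max_right _ _).trans_lt h3
    rw [div_lt_iff₀ he] at this
    linarith
  rw [dist_eq_norm]
  by_contra hcon
  nlinarith [mul_le_mul_of_nonneg_left (not_lt.1 hcon) htp.le]

/-- A motion in the far region with limit shape `a` and `‖η‖ ≥ r` is asymptotically uniform. By the
Lagrange-Jacobi identity `⟪η, η'⟫` grows at rate at least `‖a‖²`, so that `1 / ‖η‖²` is dominated by
the derivative of an arctangent of total variation `O(1/r)`. -/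
lemma sol_of_motion {κ r : ℝ} (ha : S.a ≠ 0) (hκ : 0 ≤ κ) (hr : 0 < r)
    (hrε : 4 * Real.pi * κ * (‖S.a‖ + 1) ≤ ‖S.a‖ ^ 2 * r * S.ε)
    (hη : ∀ t, 0 ≤ t → HasDerivWithinAt η (w t) (Ici 0) t)
    (hw : ∀ t, 0 ≤ t → HasDerivWithinAt w (S.F (η t)) (Ici 0) t)
    (hR : ∀ t, 0 ≤ t → η t ∈ S.region) (hηr : ∀ t, 0 ≤ t → r ≤ ‖η t‖)
    (hF : ∀ t, 0 ≤ t → ‖S.F (η t)‖ ≤ κ / ‖η t‖ ^ 2)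
    (hl : (fun t : ℝ => η t - t • S.a) =o[atTop] fun t : ℝ => t) : S.Sol S.a (η 0) η w := by
  have hlim := vel_tendsto hη hw hR hl
  have hA : 0 < ‖S.a‖ := norm_pos_iff.2 ha
  set A := ‖S.a‖
  have hen : ∀ t, 0 ≤ t → ‖w t‖ ^ 2 = A ^ 2 + 2 * S.u (η t) := fun t ht =>
    energy hη hw hR (tendsto_atTop_mono' _ (eventually_le_q hl) tendsto_id) hlim ht
  have hu0 : ∀ t, 0 ≤ t → 0 ≤ S.u (η t) := fun t ht =>
    S.newton.u_nonneg _ (hR t ht).1 (S.ρ_pos.trans_le (hR t ht).2)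
  have hwC : ∀ t, 0 ≤ t → ‖w t‖ ≤ A + 1 := fun t ht => by
    have h1 := (S.newton.u_le _ (hR t ht).1 (S.ρ_pos.trans_le (hR t ht).2)).trans
      (k_div_le (hR t ht).2).2
    have h2 := hen t ht
    refine abs_le_of_sq_le_sq' ?_ (by linarith) |>.2
    nlinarith
  set C := A + 1 with hC
  have hCpos : 0 < C := by linarith
  let g : ℝ → ℝ := fun t => inner ℝ (η t) (w t)
  have hg : ∀ t, 0 ≤ t → HasDerivWithinAt g (A ^ 2 + S.u (η t)) (Ici 0) t := fun t ht => by
    refine ((hη t ht).inner ℝ (hw t ht)).congr_deriv ?_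
    rw [real_inner_comm, S.newton.euler _ (hR t ht).1 (S.ρ_pos.trans_le (hR t ht).2),
      real_inner_self_eq_norm_sq, hen t ht]
    ring
  -- `g = ⟪η, η'⟫` satisfies `g' ≥ A²` and `|g| ≤ C ‖η‖`, hence `1 / ‖η‖² ≤ 2 / (r² + (g / C)²)`,
  -- which is at most a multiple of the derivative of `arctan (g / (C r))`
  set B := 2 * κ * C / (A ^ 2 * r) with hB
  have hB0 : 0 ≤ B := by positivity
  let H : ℝ → ℝ := fun t => B * Real.arctan (g t / (C * r))
  have hH : ∀ t, 0 ≤ t → HasDerivWithinAt H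
      (B * (1 / (1 + (g t / (C * r)) ^ 2) * ((A ^ 2 + S.u (η t)) / (C * r)))) (Ici 0) t :=
    fun t ht => (((hg t ht).div_const (C * r)).arctan).const_mul B
  have hdom : ∀ t, 0 ≤ t → ‖S.F (η t)‖ ≤
      B * (1 / (1 + (g t / (C * r)) ^ 2) * ((A ^ 2 + S.u (η t)) / (C * r))) := fun t ht => by
    have hn : 0 < ‖η t‖ := hr.trans_le (hηr t ht)
    refine (hF t ht).trans ?_
    have e1 : B * (1 / (1 + (g t / (C * r)) ^ 2) * ((A ^ 2 + S.u (η t)) / (C * r))) =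
        (2 * κ / (r ^ 2 + (g t / C) ^ 2)) * ((A ^ 2 + S.u (η t)) / A ^ 2) := by
      rw [hB]; field_simp
    have e2 : 1 ≤ (A ^ 2 + S.u (η t)) / A ^ 2 := by
      rw [le_div_iff₀ (by positivity)]; linarith [hu0 t ht]
    have e3 : (g t / C) ^ 2 ≤ ‖η t‖ ^ 2 := by
      rw [sq_le_sq, abs_div, abs_of_pos hCpos, abs_norm, div_le_iff₀ hCpos]
      exact (abs_real_inner_le_norm _ _).trans (by gcongr; exact hwC t ht)
    have e4 : r ^ 2 ≤ ‖η t‖ ^ 2 := by gcongr; exact hηr t ht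
    rw [e1]
    calc κ / ‖η t‖ ^ 2 = 2 * κ / (‖η t‖ ^ 2 + ‖η t‖ ^ 2) := by field_simp; ring
      _ ≤ 2 * κ / (r ^ 2 + (g t / C) ^ 2) := by gcongr
      _ ≤ _ := le_mul_of_one_le_right (by positivity) e2
  refine ⟨hR 0 le_rfl, by simpa using (half_pos S.ε_pos).le, rfl, hη, hw, fun t ht => ?_, hlim⟩
  have hvar : ∀ s, t ≤ s → ‖w s - w t‖ ≤ S.ε / 2 := fun s hs => by
    refine (norm_sub_le_of_norm_deriv_le hw hH hdom ht hs).trans ?_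
    have a1 := (Real.arctan_lt_pi_div_two (g s / (C * r))).le
    have a2 := (Real.neg_pi_div_two_lt_arctan (g t / (C * r))).le
    have a3 : H s - H t ≤ B * Real.pi := by
      simp only [H]; rw [← mul_sub]; gcongr; linarith
    refine a3.trans ?_
    rw [hB, div_mul_eq_mul_div, div_le_iff₀ (by positivity)]
    linarith
  have := le_of_tendsto ((hlim.sub_const (w t)).norm)
    ((eventually_ge_atTop t).mono fun s hs => hvar s hs)
  rwa [norm_sub_rev] at this

end Motion

end FarField

/-! ### Round cones -/

section Cone

variable {V : Type*} [NormedAddCommGroup V] [InnerProductSpace ℝ V]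

/-- The cone of half angle `arccos β` around `a`. -/
def roundCone (a : V) (β : ℝ) : Set V := {x | β * ‖x‖ * ‖a‖ ≤ inner ℝ x a}

/-- The linear functional vanishing on the orthogonal complement of `a` with value `2` at `a`. -/
noncomputable def axial (a : V) : V →L[ℝ] ℝ := (2 / ‖a‖ ^ 2) • innerSL ℝ a

variable {a : V} {β : ℝ}

lemma axial_apply (x : V) : axial a x = 2 / ‖a‖ ^ 2 * inner ℝ x a := by
  simp [axial, real_inner_comm]

lemma isClosed_roundCone : IsClosed (roundCone a β) :=
  isClosed_le (by fun_prop) (by fun_prop)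

lemma convex_roundCone (hβ : 0 ≤ β) : Convex ℝ (roundCone a β) := by
  intro x hx y hy s t hs ht _
  simp only [roundCone, mem_ofPred_eq, inner_add_left, real_inner_smul_left] at *
  have h1 : ‖s • x + t • y‖ ≤ s * ‖x‖ + t * ‖y‖ := by
    refine (norm_add_le _ _).trans (le_of_eq ?_)
    rw [norm_smul, norm_smul, Real.norm_of_nonneg hs, Real.norm_of_nonneg ht]
  have h2 : β * ‖s • x + t • y‖ * ‖a‖ ≤ β * (s * ‖x‖ + t * ‖y‖) * ‖a‖ := by gcongr
  nlinarith [mul_le_mul_of_nonneg_left hx hs, mul_le_mul_of_nonneg_left hy ht]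

lemma add_mem_roundCone (hβ : 0 ≤ β) (hβ1 : β ≤ 1) {ε : ℝ}
    (hε : ε ≤ (1 - β) * ‖a‖ / 2) {x w : V} {t : ℝ} (hx : x ∈ roundCone a β) (ht : 0 ≤ t)
    (hw : ‖w - t • a‖ ≤ ε * t) : x + w ∈ roundCone a β := by
  simp only [roundCone, mem_ofPred_eq, inner_add_left] at *
  set z := w - t • a
  have hwz : w = t • a + z := by simp [z]
  have h1 : inner ℝ w a = t * ‖a‖ ^ 2 + inner ℝ z a := by
    rw [hwz, inner_add_left, real_inner_smul_left, real_inner_self_eq_norm_sq]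
  have h2 : -(‖z‖ * ‖a‖) ≤ inner ℝ z a := neg_le_of_abs_le (abs_real_inner_le_norm _ _)
  have h3 : ‖x + w‖ ≤ ‖x‖ + t * ‖a‖ + ‖z‖ := by
    rw [hwz, ← add_assoc]
    refine (norm_add_le _ _).trans (add_le_add_left ((norm_add_le _ _).trans ?_) _)
    rw [norm_smul, Real.norm_of_nonneg ht]
  have h4 : β * ‖x + w‖ * ‖a‖ ≤ β * (‖x‖ + t * ‖a‖ + ‖z‖) * ‖a‖ := by gcongr
  have ha := norm_nonneg a
  have h5 : (1 + β) * ‖z‖ ≤ (1 - β) * ‖a‖ * t := by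
    have : (1 + β) * ‖z‖ ≤ 2 * (ε * t) := by
      have := norm_nonneg z
      nlinarith
    nlinarith [mul_le_mul_of_nonneg_right hε ht]
  nlinarith [mul_le_mul_of_nonneg_right h5 ha]

lemma le_axial (ha : a ≠ 0) {ε : ℝ} (hε : ε ≤ ‖a‖ / 2) {w : V} {t : ℝ} (ht : 0 ≤ t)
    (hw : ‖w - t • a‖ ≤ ε * t) : t ≤ axial a w := by
  have hA : 0 < ‖a‖ := norm_pos_iff.2 ha
  set z := w - t • a
  have hwz : w = t • a + z := by simp [z]
  have h1 : inner ℝ w a = t * ‖a‖ ^ 2 + inner ℝ z a := by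
    rw [hwz, inner_add_left, real_inner_smul_left, real_inner_self_eq_norm_sq]
  have h2 : -(‖z‖ * ‖a‖) ≤ inner ℝ z a := neg_le_of_abs_le (abs_real_inner_le_norm _ _)
  rw [axial_apply, h1, div_mul_eq_mul_div, le_div_iff₀ (by positivity)]
  have h3 : ‖z‖ ≤ ‖a‖ / 2 * t := hw.trans (by gcongr)
  nlinarith [mul_le_mul_of_nonneg_right h3 hA.le]

/-- The far field of a Newtonian force field on a round cone. -/
noncomputable def coneField {u : V → ℝ} {F : V → V} {k ε ρ : ℝ} (ha : a ≠ 0) (hβ : 0 ≤ β)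
    (hβ1 : β ≤ 1) (hN : NewtonianOn (roundCone a β) (axial a) u F k) (hε : 0 < ε)
    (hεβ : ε ≤ (1 - β) * ‖a‖ / 2) (hρ : 0 < ρ) (hk : 4 * k ≤ ρ) (hkε : 4 * k ≤ ρ * ε) :
    FarField V where
  a := a
  dom := roundCone a β
  q := axial a
  u := u
  F := F
  ε := ε
  k := k
  ρ := ρ
  newton := hN
  ε_pos := hε
  ρ_pos := hρ
  convex_dom := convex_roundCone hβ
  add_mem _ hx _ ht _ hw := add_mem_roundCone hβ hβ1 hεβ hx ht hw
  le_q _ ht _ hw := le_axial ha (hεβ.trans (by nlinarith [norm_nonneg a])) ht hw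
  k_le := hk
  k_le_mul := hkε

end Cone

lemma isLittleO_log_pow (n : ℕ) {ρ : ℝ} (hρ : 0 < ρ) :
    (fun T : ℝ => Real.log ((ρ + T) / ρ) ^ n) =o[atTop] fun T : ℝ => T := by
  have h1 : Tendsto (fun T : ℝ => (ρ + T) / ρ) atTop atTop :=
    (tendsto_atTop_add_const_left _ _ tendsto_id).atTop_div_const hρ
  refine (Real.isLittleO_pow_log_id_atTop.comp_tendsto h1).trans_isBigO ?_
  refine IsBigO.of_bound (2 / ρ) ?_
  filter_upwards [eventually_ge_atTop ρ] with T hT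
  simp only [Function.comp, id]
  rw [Real.norm_of_nonneg (div_nonneg (by linarith) hρ.le), Real.norm_of_nonneg (by linarith),
    div_mul_eq_mul_div]
  gcongr
  linarith

namespace FarField

variable {V : Type*} [NormedAddCommGroup V] [InnerProductSpace ℝ V]

/-! ### The barrier of a round cone -/

/-- The far field `S` lives on the round cone of parameter `β`, and its constants are small enough
for the smaller cone of parameter `α`. -/
structure IsConical (S : FarField V) (α β : ℝ) : Prop where
  a_ne : S.a ≠ 0
  β_pos : 0 < β
  β_lt : β < α
  α_lt : α < 1
  dom_eq : S.dom = roundCone S.a β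
  q_eq : S.q = axial S.a
  ε_le : S.ε ≤ (1 - α) * ‖S.a‖ / 2
  ε_le' : S.ε ≤ α * ‖S.a‖
  k_le_gap : S.k ≤ S.ρ * ((α - β) * ‖S.a‖ / 8)

lemma exists_isConical {a : V} {α β k : ℝ} {u : V → ℝ} {F : V → V} (ha : a ≠ 0) (hβ : 0 < β)
    (hβα : β < α) (hα : α < 1) (hN : NewtonianOn (roundCone a β) (axial a) u F k) :
    ∃ S : FarField V, S.IsConical α β ∧ S.a = a ∧ S.u = u ∧ S.F = F := by
  have hA : 0 < ‖a‖ := norm_pos_iff.2 ha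
  have hk := hN.k_nonneg
  set ε := min ((1 - α) * ‖a‖ / 2) (α * ‖a‖) with hε
  set ν := (α - β) * ‖a‖ / 8 with hν
  have hε0 : 0 < ε := lt_min (by nlinarith) (by nlinarith)
  have hν0 : 0 < ν := by have : 0 < α - β := by linarith
                         positivity
  set ρ := 1 + 4 * k + 4 * k / ε + k / ν with hρ
  have h1 : 0 ≤ 4 * k / ε := by positivity
  have h2 : 0 ≤ k / ν := by positivity
  have h3 : 4 * k / ε * ε ≤ ρ * ε := by gcongr; linarith
  have h4 : k / ν * ν ≤ ρ * ν := by gcongr; linarith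
  rw [div_mul_cancel₀ _ hε0.ne'] at h3
  rw [div_mul_cancel₀ _ hν0.ne'] at h4
  refine ⟨coneField ha hβ.le (hβα.trans hα).le hN hε0
    ((min_le_left _ _).trans (by gcongr)) (by linarith : 0 < ρ)
    (by linarith) h3, ⟨ha, hβ, hβα, hα, rfl, rfl, min_le_left _ _, min_le_right _ _, h4⟩,
    rfl, rfl, rfl⟩

variable {S : FarField V} {α β : ℝ}

/-- A quarter of the difference of the slopes, along the boundary of either cone, of the functional
`⟪x, a⟫` and of the barrier. -/
noncomputable def gap (S : FarField V) (α β : ℝ) : ℝ := (α - β) * ‖S.a‖ / 8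

/-- The base point of the generating functions, on the axis of the cone. -/
noncomputable def basePoint (S : FarField V) : V := (S.ρ / 2) • S.a

/-- A radial function that exceeds the generating functions on the boundary of the region, and is
exceeded by them in the smaller cone, away from the vertex. -/
noncomputable def barrierFun (S : FarField V) (α β : ℝ) (x : V) : ℝ :=
  (α + β) / 2 * ‖S.a‖ * ‖x‖ + (gap S α β * ‖basePoint S‖ + S.ρ * ‖S.a‖ ^ 2 / 2)

section Conical

variable (hS : S.IsConical α β)

include hS

lemma gap_pos : 0 < gap S α β := by
  have h1 := norm_pos_iff.2 hS.a_ne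
  have h2 : 0 < α - β := sub_pos.2 hS.β_lt
  unfold gap; positivity

lemma mem_region_iff {x : V} : x ∈ S.region ↔
    β * ‖x‖ * ‖S.a‖ ≤ inner ℝ x S.a ∧ S.ρ * ‖S.a‖ ^ 2 / 2 ≤ inner ℝ x S.a := by
  have h1 := norm_pos_iff.2 hS.a_ne
  simp only [region, hS.dom_eq, hS.q_eq, roundCone, mem_ofPred_eq, axial_apply]
  rw [div_mul_eq_mul_div, le_div_iff₀ (by positivity)]
  constructor <;> rintro ⟨h2, h3⟩ <;> exact ⟨h2, by linarith⟩

lemma isClosed_region : IsClosed S.region := by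
  have : S.region = S.dom ∩ {x | S.ρ ≤ S.q x} := rfl
  rw [this, hS.dom_eq]
  exact isClosed_roundCone.inter (isClosed_le continuous_const S.q.continuous)

lemma basePoint_mem : basePoint S ∈ S.region := by
  have hρ := S.ρ_pos
  have h1 := norm_pos_iff.2 hS.a_ne
  rw [mem_region_iff hS, basePoint, real_inner_smul_left, real_inner_self_eq_norm_sq, norm_smul,
    Real.norm_of_nonneg (by positivity)]
  have h2 : β ≤ 1 := (hS.β_lt.trans hS.α_lt).le
  constructor
  · calc β * (S.ρ / 2 * ‖S.a‖) * ‖S.a‖ = β * (S.ρ / 2 * ‖S.a‖ ^ 2) := by ring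
      _ ≤ 1 * (S.ρ / 2 * ‖S.a‖ ^ 2) := by gcongr
      _ = _ := one_mul _
  · linarith

lemma mem_region_of_mem {r : ℝ}
    (hr : 2 * (gap S α β * ‖basePoint S‖) + S.ρ * ‖S.a‖ ^ 2 / 2 < 2 * gap S α β * r) {x : V}
    (hx : x ∈ roundCone S.a α) (hxr : r ≤ ‖x‖) : x ∈ S.region := by
  have hg := gap_pos hS
  have hA := norm_nonneg S.a
  have hx0 := norm_nonneg x
  have hp := norm_nonneg (basePoint S)
  have hx' : α * ‖x‖ * ‖S.a‖ ≤ inner ℝ x S.a := hx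
  have h1 : 2 * gap S α β * r ≤ 2 * gap S α β * ‖x‖ := by gcongr
  have h2 : 2 * gap S α β * ‖x‖ = (α - β) / 4 * (‖x‖ * ‖S.a‖) := by unfold gap; ring
  have h3 : 0 ≤ ‖x‖ * ‖S.a‖ := by positivity
  have h4 := mul_nonneg hg.le hp
  rw [mem_region_iff hS]
  constructor
  · nlinarith [mul_le_mul_of_nonneg_right hS.β_lt.le h3]
  · nlinarith [mul_le_mul_of_nonneg_right (by linarith [hS.β_lt, hS.β_pos] : (α - β) / 4 ≤ α) h3]

variable [CompleteSpace V] {b : V}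

lemma abs_gen_sub_axis_le (hb : ‖b - S.a‖ ≤ S.ε / 2) (hb' : ‖b - S.a‖ ≤ gap S α β) {x : V}
    (hx : x ∈ S.region) : |gen S b (basePoint S) x - inner ℝ x S.a| ≤
      2 * gap S α β * ‖x‖ + gap S α β * ‖basePoint S‖ := by
  have hρ := S.ρ_pos
  have hg := gap_pos hS
  have h1 := abs_gen_sub_inner_le hb (basePoint_mem hS) hx
  have h2 : S.k / S.ρ ≤ gap S α β := by
    rw [div_le_iff₀ hρ, mul_comm]; exact hS.k_le_gap
  have h3 : S.k / S.ρ * ‖x - basePoint S‖ ≤ gap S α β * (‖x‖ + ‖basePoint S‖) := by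
    gcongr; exact norm_sub_le _ _
  have h4 : |inner ℝ x (b - S.a)| ≤ ‖x‖ * gap S α β :=
    (abs_real_inner_le_norm _ _).trans (by gcongr)
  have h5 : gen S b (basePoint S) x - inner ℝ x S.a =
      (gen S b (basePoint S) x - inner ℝ x b) + inner ℝ x (b - S.a) := by
    rw [inner_sub_right]; ring
  rw [h5]
  refine (abs_add_le _ _).trans ?_
  linarith

lemma continuousOn_gen_sub_barrier (hb : ‖b - S.a‖ ≤ S.ε / 2) :
    ContinuousOn (fun x => gen S b (basePoint S) x - barrierFun S α β x) S.region := by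
  have hC : 0 ≤ ‖b‖ + S.ε := by have := S.ε_pos; positivity
  have h1 : ContinuousOn (gen S b (basePoint S)) S.region :=
    (LipschitzOnWith.of_dist_le_mul (K := ⟨_, hC⟩) fun x hx y hy => by
      rw [Real.dist_eq, dist_eq_norm]
      exact abs_gen_sub_le hb (basePoint_mem hS) hy hx).continuousOn
  exact h1.sub (by unfold barrierFun; fun_prop)

variable [FiniteDimensional ℝ V] {U : V → ENNReal} {r : ℝ}

/-- In the smaller cone, away from the vertex, the generating functions bound the action of all
curves. -/
lemma cone_barrier (hb : ‖b - S.a‖ ≤ S.ε / 2) (hb' : ‖b - S.a‖ ≤ gap S α β) (hbn : ‖b‖ = ‖S.a‖)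
    (hU : ∀ x ∈ S.region, U x = ENNReal.ofReal (S.u x))
    (hr : 2 * (gap S α β * ‖basePoint S‖) + S.ρ * ‖S.a‖ ^ 2 / 2 < 2 * gap S α β * r)
    {σ : ℝ → V} {s τ : ℝ} (hτ : s ≤ τ) (hσ : AbsolutelyContinuousOnInterval σ s τ)
    (h0 : σ s ∈ roundCone S.a α) (h0r : r ≤ ‖σ s‖)
    (h1 : σ τ ∈ roundCone S.a α) (h1r : r ≤ ‖σ τ‖) :
    ENNReal.ofReal (gen S b (basePoint S) (σ τ) - gen S b (basePoint S) (σ s)) ≤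
      curveAction U (‖S.a‖ ^ 2 / 2) σ s τ ∧
    (curveAction U (‖S.a‖ ^ 2 / 2) σ s τ ≤
      ENNReal.ofReal (gen S b (basePoint S) (σ τ) - gen S b (basePoint S) (σ s)) →
      ∀ t ∈ Icc s τ, σ t ∈ S.region) := by
  have hg := gap_pos hS
  have hA : 0 < ‖S.a‖ := norm_pos_iff.2 hS.a_ne
  have hβ := hS.β_pos
  have hα := hS.α_lt
  have hβα := hS.β_lt
  have hα0 : 0 < α := hβ.trans hβα
  have hc := continuousOn_gen_sub_barrier hS hb
  let W : Set V := {x | β * ‖x‖ * ‖S.a‖ < inner ℝ x S.a} ∩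
    {x | S.ρ * ‖S.a‖ ^ 2 / 2 < inner ℝ x S.a}
  have hW : IsOpen W :=
    (isOpen_lt (by fun_prop) (by fun_prop)).inter (isOpen_lt (by fun_prop) (by fun_prop))
  have hWR : W ⊆ S.region := fun x hx => (mem_region_iff hS).2 ⟨le_of_lt hx.1, le_of_lt hx.2⟩
  let O : Set V := W ∩ (fun x => gen S b (basePoint S) x - barrierFun S α β x) ⁻¹' Ioi 0
  have hO : IsOpen O := (hc.mono hWR).isOpen_inter_preimage hW isOpen_Ioi
  have hclosed : IsClosed (S.region ∩
      (fun x => gen S b (basePoint S) x - barrierFun S α β x) ⁻¹' Ici 0) :=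
    hc.preimage_isClosed_of_isClosed (isClosed_region hS) isClosed_Ici
  have hcl : closure O ⊆ S.region ∩
      (fun x => gen S b (basePoint S) x - barrierFun S α β x) ⁻¹' Ici 0 :=
    closure_minimal (fun x hx => ⟨hWR hx.1, by
      have := hx.2
      simp only [mem_preimage, mem_Ioi, mem_Ici] at this ⊢
      exact this.le⟩) hclosed
  have hslope : (α + β) / 2 * ‖S.a‖ = β * ‖S.a‖ + 4 * gap S α β := by unfold gap; ring
  have hslope' : α * ‖S.a‖ = (α + β) / 2 * ‖S.a‖ + 4 * gap S α β := by unfold gap; ring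
  have hmem : ∀ x ∈ roundCone S.a α, r ≤ ‖x‖ → x ∈ O := fun x hx hxr => by
    have hR := mem_region_of_mem hS hr hx hxr
    have e1 := (abs_le.1 (abs_gen_sub_axis_le hS hb hb' hR)).1
    have hx' : α * ‖x‖ * ‖S.a‖ ≤ inner ℝ x S.a := hx
    have hx0 := norm_nonneg x
    have e2 : 2 * gap S α β * r ≤ 2 * gap S α β * ‖x‖ := by gcongr
    have e3 : 0 ≤ gap S α β * ‖basePoint S‖ := by positivity
    have e4 : α * ‖x‖ * ‖S.a‖ = (α + β) / 2 * ‖S.a‖ * ‖x‖ + 4 * gap S α β * ‖x‖ := by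
      linear_combination ‖x‖ * hslope'
    have e5 : (α + β) / 2 * ‖S.a‖ * ‖x‖ = β * ‖x‖ * ‖S.a‖ + 4 * gap S α β * ‖x‖ := by
      linear_combination ‖x‖ * hslope
    have e6 : 0 ≤ β * ‖x‖ * ‖S.a‖ := by positivity
    have e7 := S.ρ_pos
    have e8 : 0 < S.ρ * ‖S.a‖ ^ 2 / 2 := by positivity
    refine ⟨⟨show β * ‖x‖ * ‖S.a‖ < inner ℝ x S.a by linarith,
      show S.ρ * ‖S.a‖ ^ 2 / 2 < inner ℝ x S.a by linarith⟩, ?_⟩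
    simp only [mem_preimage, mem_Ioi, barrierFun]
    linarith
  have key := barrier (b := b) (p := basePoint S) (O := O) (ψ := barrierFun S α β)
    (c := (α + β) / 2 * ‖S.a‖) hb (basePoint_mem hS) hU (by positivity)
    (by rw [hbn]; nlinarith) (fun x y => by
      have := norm_sub_norm_le x y
      simp only [barrierFun]
      have h2 : 0 ≤ (α + β) / 2 * ‖S.a‖ := by positivity
      nlinarith [mul_le_mul_of_nonneg_left this h2]) hO
    (fun x hx => (hcl hx).1) (fun x hx => sub_nonneg.1 (hcl hx).2)
    (fun x hx hxO => by
      by_contra hcon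
      rw [not_le] at hcon
      refine hxO ⟨?_, by simpa using hcon⟩
      have e1 := (abs_le.1 (abs_gen_sub_axis_le hS hb hb' hx)).2
      have hx0 := norm_nonneg x
      have e5 : (α + β) / 2 * ‖S.a‖ * ‖x‖ = β * ‖x‖ * ‖S.a‖ + 4 * gap S α β * ‖x‖ := by
        linear_combination ‖x‖ * hslope
      have e6 : 0 ≤ β * ‖x‖ * ‖S.a‖ := by positivity
      have e7 : 0 < S.ρ * ‖S.a‖ ^ 2 / 2 := by have := S.ρ_pos; positivity
      have e8 : 0 ≤ gap S α β * ‖x‖ := by positivity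
      simp only [barrierFun] at hcon
      exact ⟨show β * ‖x‖ * ‖S.a‖ < inner ℝ x S.a by linarith,
      show S.ρ * ‖S.a‖ ^ 2 / 2 < inner ℝ x S.a by linarith⟩)
    hτ hσ (hmem _ h0 h0r) (hmem _ h1 h1r)
  rwa [hbn] at key

end Conical

end FarField

/-! ### Curves with a limit shape -/

section LimitShape

variable {V : Type*} [NormedAddCommGroup V] [InnerProductSpace ℝ V] {a : V} {η : ℝ → V}

lemma tendsto_inv_smul_of_limitShape (hl : (fun t : ℝ => η t - t • a) =o[atTop] fun t : ℝ => t)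
    (x : V) : Tendsto (fun t : ℝ => t⁻¹ • (η t - x)) atTop (𝓝 a) := by
  have h1 : Tendsto (fun t : ℝ => t⁻¹ • (η t - t • a)) atTop (𝓝 0) := by
    rw [tendsto_zero_iff_norm_tendsto_zero]
    refine hl.norm_norm.tendsto_div_nhds_zero.congr fun t => ?_
    rw [norm_smul, norm_inv, div_eq_inv_mul]
  have h2 : Tendsto (fun t : ℝ => t⁻¹ • x) atTop (𝓝 0) := by
    simpa using (tendsto_inv_atTop_zero (𝕜 := ℝ)).smul_const x
  have h3 := (h1.sub h2).add_const a
  simp only [sub_zero, zero_add] at h3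
  refine h3.congr' ?_
  filter_upwards [eventually_gt_atTop 0] with t ht
  rw [smul_sub, smul_sub, smul_smul, inv_mul_cancel₀ ht.ne']
  module

lemma tendsto_norm_sub_of_limitShape (ha : a ≠ 0)
    (hl : (fun t : ℝ => η t - t • a) =o[atTop] fun t : ℝ => t) (x : V) :
    Tendsto (fun t : ℝ => ‖η t - x‖) atTop atTop := by
  have h1 := (tendsto_inv_smul_of_limitShape hl x).norm.pos_mul_atTop (norm_pos_iff.2 ha) tendsto_id
  refine h1.congr' ?_
  filter_upwards [eventually_gt_atTop 0] with t ht
  rw [norm_smul, norm_inv, Real.norm_of_nonneg ht.le, id]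
  field_simp

lemma eventually_mem_roundCone_of_limitShape (ha : a ≠ 0) {α : ℝ} (hα : α < 1)
    (hl : (fun t : ℝ => η t - t • a) =o[atTop] fun t : ℝ => t) :
    ∀ᶠ t in atTop, η t ∈ roundCone a α := by
  have h1 := tendsto_inv_smul_of_limitShape hl 0
  simp only [sub_zero] at h1
  have hA : 0 < ‖a‖ := norm_pos_iff.2 ha
  have h2 : IsOpen {z : V | α * ‖z‖ * ‖a‖ < inner ℝ z a} := isOpen_lt (by fun_prop) (by fun_prop)
  have h3 : a ∈ {z : V | α * ‖z‖ * ‖a‖ < inner ℝ z a} := by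
    simp only [mem_ofPred_eq, real_inner_self_eq_norm_sq]
    nlinarith [mul_pos hA hA]
  filter_upwards [h1.eventually_mem (h2.mem_nhds h3), eventually_gt_atTop 0] with t h4 ht
  simp only [norm_smul, norm_inv, Real.norm_of_nonneg ht.le, real_inner_smul_left] at h4
  have h5 := mul_le_mul_of_nonneg_left h4.le ht.le
  rw [mul_inv_cancel_left₀ ht.ne'] at h5
  refine le_trans (le_of_eq ?_) h5
  field_simp

end LimitShape

/-- The curve `η` minimizes the action in free time between its initial point and each of its points.
Competitors have positive duration. -/
def IsMinimizing {V : Type*} [NormedAddCommGroup V] [InnerProductSpace ℝ V] (U : V → ENNReal)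
    (h : ℝ) (η : ℝ → V) : Prop :=
  ∀ t, 0 ≤ t → AbsolutelyContinuousOnInterval η 0 t ∧
    ∀ (τ : ℝ) (σ : ℝ → V), 0 < τ → AbsolutelyContinuousOnInterval σ 0 τ → σ 0 = η 0 → σ τ = η t →
      curveAction U h η 0 t ≤ curveAction U h σ 0 τ

namespace FarField

variable {V : Type*} [NormedAddCommGroup V] [InnerProductSpace ℝ V] [CompleteSpace V]
  {S : FarField V} {α β r : ℝ}

/-! ### Rays in round cones -/

omit [CompleteSpace V] in
lemma norm_center_sub_le : ‖S.a - S.a‖ ≤ S.ε / 2 := by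
  simpa using (half_pos S.ε_pos).le

/-- The smaller cone is invariant under the rays with limit velocity `a`, which move away from the
vertex. -/
lemma ray_mem_cone (hS : S.IsConical α β) {x : V} (hx : x ∈ roundCone S.a α) (hxR : x ∈ S.region)
    {t : ℝ} (ht : 0 ≤ t) : ray S S.a x t ∈ roundCone S.a α ∧ ‖x‖ ≤ ‖ray S S.a x t‖ := by
  have h := sol_ray norm_center_sub_le hxR
  have hα : 0 < α := hS.β_pos.trans hS.β_lt
  have h1 : ‖ray S S.a x t - x - t • S.a‖ ≤ S.ε * t := by
    refine (h.norm_pos_sub_le ht).2.trans ?_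
    gcongr
    exact (k_div_le le_rfl).1.trans (by linarith [S.ε_pos])
  constructor
  · simpa using add_mem_roundCone hα.le hS.α_lt.le hS.ε_le hx ht h1
  · rcases eq_or_ne x 0 with h0 | h0
    · simp [h0]
    have hn : 0 < ‖x‖ := norm_pos_iff.2 h0
    set z := ray S S.a x t - x - t • S.a
    have e1 : ray S S.a x t = x + t • S.a + z := by simp only [z]; module
    have e2 : inner ℝ (ray S S.a x t) x = ‖x‖ ^ 2 + t * inner ℝ x S.a + inner ℝ z x := by
      rw [e1, inner_add_left, inner_add_left, real_inner_smul_left, real_inner_self_eq_norm_sq,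
        real_inner_comm]
    have e3 : -(‖z‖ * ‖x‖) ≤ inner ℝ z x := neg_le_of_abs_le (abs_real_inner_le_norm _ _)
    have e4 : α * ‖x‖ * ‖S.a‖ ≤ inner ℝ x S.a := hx
    have e5 : ‖z‖ * ‖x‖ ≤ α * ‖S.a‖ * t * ‖x‖ := by
      gcongr
      exact h1.trans (by gcongr; exact hS.ε_le')
    have e6 := mul_le_mul_of_nonneg_left e4 ht
    have e7 := real_inner_le_norm (ray S S.a x t) x
    by_contra hcon
    nlinarith

lemma ray_limitShape {x : V} (hx : x ∈ S.region) :
    (fun t : ℝ => ray S S.a x t - t • S.a) =o[atTop] fun t : ℝ => t := by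
  have h := sol_ray norm_center_sub_le hx
  have h1 : (fun t : ℝ => ray S S.a x t - x - t • S.a) =o[atTop] fun t : ℝ => t := by
    have h2 := (isLittleO_log_pow 1 S.ρ_pos).const_mul_left S.k
    refine IsBigO.trans_isLittleO (IsBigO.of_bound 1 ?_) h2
    filter_upwards [eventually_ge_atTop 0] with t ht
    rw [one_mul, pow_one]
    exact (h.norm_pos_sub_le ht).1.trans (le_abs_self _)
  have h3 : (fun _ : ℝ => x) =o[atTop] fun t : ℝ => t :=
    isLittleO_const_left.2 (Or.inr tendsto_abs_atTop_atTop)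
  refine (h1.add h3).congr_left fun t => ?_
  abel

variable [FiniteDimensional ℝ V] {U : V → ENNReal}

/-- Calibrated by the generating function, rays minimize among all curves of the space. -/
lemma isMinimizing_ray (hS : S.IsConical α β)
    (hU : ∀ x ∈ S.region, U x = ENNReal.ofReal (S.u x))
    (hr : 2 * (gap S α β * ‖basePoint S‖) + S.ρ * ‖S.a‖ ^ 2 / 2 < 2 * gap S α β * r)
    {x : V} (hx : x ∈ roundCone S.a α) (hxr : r ≤ ‖x‖) :
    IsMinimizing U (‖S.a‖ ^ 2 / 2) (ray S S.a x) := by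
  intro t ht
  have hxR := mem_region_of_mem hS hr hx hxr
  have h := sol_ray norm_center_sub_le hxR
  refine ⟨h.absolutelyContinuous le_rfl ht, fun τ σ hτ hσ h0 h1 => ?_⟩
  rw [h.init] at h0
  obtain ⟨m1, m2⟩ := ray_mem_cone hS hx hxR ht
  refine (curveAction_ray_le norm_center_sub_le (basePoint_mem hS) hU hxR ht).trans ?_
  have := (cone_barrier hS norm_center_sub_le (by simpa using (gap_pos hS).le) rfl hU hr hτ.le hσ
    (h0 ▸ hx) (h0 ▸ hxr) (h1 ▸ m1) (h1 ▸ hxr.trans m2)).1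
  rwa [h0, h1] at this

/-- The action of a minimizing curve with limit shape `a` is the increment of the generating
function. For the directions `b` of the chords from `x` to far points of the curve, the rays with
limit velocity `b` almost reach these points, which gives the bound for the generating function
with parameter `b` up to an error that vanishes in the limit. -/
lemma curveAction_le_of_isMinimizing (hS : S.IsConical α β)
    (hU : ∀ x ∈ S.region, U x = ENNReal.ofReal (S.u x))
    (hr : 2 * (gap S α β * ‖basePoint S‖) + S.ρ * ‖S.a‖ ^ 2 / 2 < 2 * gap S α β * r)
    {η : ℝ → V} (hx : η 0 ∈ roundCone S.a α) (hxr : r ≤ ‖η 0‖)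
    (hη : IsMinimizing U (‖S.a‖ ^ 2 / 2) η)
    (hl : (fun t : ℝ => η t - t • S.a) =o[atTop] fun t : ℝ => t) {t : ℝ} (ht : 0 ≤ t)
    (htc : η t ∈ roundCone S.a α) (htr : r ≤ ‖η t‖) :
    curveAction U (‖S.a‖ ^ 2 / 2) η 0 t ≤
      ENNReal.ofReal (gen S S.a (basePoint S) (η t) - gen S S.a (basePoint S) (η 0)) := by
  have hA : 0 < ‖S.a‖ := norm_pos_iff.2 hS.a_ne
  have hg := gap_pos hS
  have hp := basePoint_mem hS
  have hxR := mem_region_of_mem hS hr hx hxr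
  have htR := mem_region_of_mem hS hr htc htr
  set x := η 0 with hx0
  -- the chord from `x` to `η s`, travelled at the speed `‖a‖` prescribed by the energy, in time `T s`
  let b : ℝ → V := fun s => (‖S.a‖ / ‖η s - x‖) • (η s - x)
  let T : ℝ → ℝ := fun s => ‖η s - x‖ / ‖S.a‖
  have hinf := tendsto_norm_sub_of_limitShape hS.a_ne hl x
  have hT : Tendsto T atTop atTop := hinf.atTop_div_const hA
  have hb : Tendsto b atTop (𝓝 S.a) := by
    have h1 := tendsto_inv_smul_of_limitShape hl x
    have h2 : Tendsto (fun s : ℝ => (‖S.a‖ / ‖s⁻¹ • (η s - x)‖) • (s⁻¹ • (η s - x))) atTop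
        (𝓝 ((‖S.a‖ / ‖S.a‖) • S.a)) := ((tendsto_const_nhds (x := ‖S.a‖)).div h1.norm hA.ne').smul h1
    rw [div_self hA.ne', one_smul] at h2
    refine h2.congr' ?_
    filter_upwards [eventually_gt_atTop 0] with s hs
    rw [norm_smul, norm_inv, Real.norm_of_nonneg hs.le, smul_smul]
    congr 1
    field_simp
  have hbd : Tendsto (fun s => ‖b s - S.a‖) atTop (𝓝 0) := by
    simpa using (hb.sub_const S.a).norm
  let z : ℝ → ℝ := fun s => gen S S.a (basePoint S) (η t) - gen S S.a (basePoint S) x +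
    2 * ‖b s - S.a‖ * ‖η t - x‖ + 2 * (S.k * Real.log ((S.ρ + T s) / S.ρ)) ^ 2 / T s
  have hz : Tendsto z atTop (𝓝 (gen S S.a (basePoint S) (η t) - gen S S.a (basePoint S) x)) := by
    have h1 : Tendsto (fun s => 2 * (S.k * Real.log ((S.ρ + T s) / S.ρ)) ^ 2 / T s) atTop
        (𝓝 0) := by
      have h2 := ((isLittleO_log_pow 2 S.ρ_pos).tendsto_div_nhds_zero.comp hT).const_mul (2 * S.k ^ 2)
      rw [mul_zero] at h2
      refine h2.congr fun s => ?_
      simp only [Function.comp]; ring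
    have h3 := (((hbd.const_mul 2).mul_const ‖η t - x‖).const_add
      (gen S S.a (basePoint S) (η t) - gen S S.a (basePoint S) x)).add h1
    simpa using h3
  refine ge_of_tendsto ((ENNReal.continuous_ofReal.tendsto _).comp hz) ?_
  filter_upwards [hbd.eventually (gt_mem_nhds (half_pos S.ε_pos)),
    hbd.eventually (gt_mem_nhds hg), hinf.eventually (eventually_gt_atTop 0),
    eventually_ge_atTop t, eventually_mem_roundCone_of_limitShape hS.a_ne hS.α_lt hl,
    (tendsto_norm_sub_of_limitShape hS.a_ne hl 0).eventually (eventually_ge_atTop r)]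
    with s hs1 hs2 hs3 hst hsc hsr
  rw [sub_zero] at hsr
  have hbn : ‖b s‖ = ‖S.a‖ := by
    simp only [b]
    rw [norm_smul, Real.norm_of_nonneg (by positivity), div_mul_cancel₀ _ hs3.ne']
  have hTs : 0 < T s := by positivity
  have hyT : x + T s • b s = η s := by
    simp only [b, T]
    rw [smul_smul, div_mul_div_cancel₀ hA.ne', div_self hs3.ne', one_smul, add_sub_cancel]
  obtain ⟨σ, hσ, hσ0, hσ1, hσa⟩ := exists_curve_of_add_smul hs1.le hp hU hxR hTs
  rw [hyT] at hσ1 hσa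
  rw [hbn] at hσa
  have h1 := ((hη s (ht.trans hst)).2 (T s) σ hTs hσ hσ0 hσ1).trans hσa
  have hact : AbsolutelyContinuousOnInterval η t s := (hη s (ht.trans hst)).1.mono (by
    rw [uIcc_of_le (ht.trans hst), uIcc_of_le hst]; exact Icc_subset_Icc_left ht)
  have h2 := (cone_barrier hS hs1.le hs2.le hbn hU hr hst hact htc htr hsc hsr).1
  rw [← curveAction_add ht hst] at h1
  have h3 := (add_le_add_right h2 (curveAction U (‖S.a‖ ^ 2 / 2) η 0 t)).trans h1
  set P := gen S (b s) (basePoint S) (η s) - gen S (b s) (basePoint S) (η t) with hP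
  set Z := gen S (b s) (basePoint S) (η t) - gen S (b s) (basePoint S) x +
    2 * (S.k * Real.log ((S.ρ + T s) / S.ρ)) ^ 2 / T s with hZ
  have h4 : gen S (b s) (basePoint S) (η s) - gen S (b s) (basePoint S) x +
      2 * (S.k * Real.log ((S.ρ + T s) / S.ρ)) ^ 2 / T s = Z + P := by rw [hP, hZ]; ring
  rw [h4] at h3
  have h5 := (ENNReal.add_le_add_iff_right ENNReal.ofReal_ne_top).1 (h3.trans ENNReal.ofReal_add_le)
  refine h5.trans (ENNReal.ofReal_le_ofReal ?_)
  have h6 := (abs_le.1 (abs_gen_sub_gen_param_le hs1.le norm_center_sub_le hp hxR htR)).2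
  simp only [z, hZ]
  linarith

/-- Minimizing curves with limit shape `a` are calibrated on arbitrarily long intervals, hence rays. -/
lemma eq_ray_of_isMinimizing (hS : S.IsConical α β)
    (hU : ∀ x ∈ S.region, U x = ENNReal.ofReal (S.u x))
    (hr : 2 * (gap S α β * ‖basePoint S‖) + S.ρ * ‖S.a‖ ^ 2 / 2 < 2 * gap S α β * r)
    {η : ℝ → V} (hx : η 0 ∈ roundCone S.a α) (hxr : r ≤ ‖η 0‖)
    (hη : IsMinimizing U (‖S.a‖ ^ 2 / 2) η)
    (hl : (fun t : ℝ => η t - t • S.a) =o[atTop] fun t : ℝ => t) {t : ℝ} (ht : 0 ≤ t) :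
    η t = ray S S.a (η 0) t := by
  obtain ⟨s, hst, hsc, hsr⟩ := ((eventually_ge_atTop t).and
    ((eventually_mem_roundCone_of_limitShape hS.a_ne hS.α_lt hl).and
    ((tendsto_norm_sub_of_limitShape hS.a_ne hl 0).eventually (eventually_ge_atTop r)))).exists
  rw [sub_zero] at hsr
  have hs0 := ht.trans hst
  have h1 := curveAction_le_of_isMinimizing hS hU hr hx hxr hη hl hs0 hsc hsr
  have hac := (hη s hs0).1
  have hR := (cone_barrier hS norm_center_sub_le (by simpa using (gap_pos hS).le) rfl hU hr hs0 hac
    hx hxr hsc hsr).2 h1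
  have hd := ae_deriv_eq_field norm_center_sub_le hS.a_ne (basePoint_mem hS) hU hs0 hac hR h1
  have hsub : Icc 0 t ⊆ Icc 0 s := Icc_subset_Icc_right hst
  exact eq_ray_of_ae_deriv norm_center_sub_le ht (hη t ht).1 (fun r hr => hR r (hsub hr))
    (ae_restrict_of_ae_restrict_of_subset hsub hd)

omit [FiniteDimensional ℝ V] in
/-- A motion in the smaller cone, away from the vertex, with limit shape `a` is a ray. -/
lemma eq_ray_of_motion (hS : S.IsConical α β)
    (hr : 2 * (gap S α β * ‖basePoint S‖) + S.ρ * ‖S.a‖ ^ 2 / 2 < 2 * gap S α β * r) (hr0 : 0 < r)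
    (hr1 : 4 * Real.pi * (S.k * ‖S.a‖ ^ 2 / (4 * α ^ 2)) * (‖S.a‖ + 1) ≤ ‖S.a‖ ^ 2 * r * S.ε)
    {η w : ℝ → V} (hη : ∀ t, 0 ≤ t → HasDerivWithinAt η (w t) (Ici 0) t)
    (hw : ∀ t, 0 ≤ t → HasDerivWithinAt w (S.F (η t)) (Ici 0) t)
    (hc : ∀ t, 0 ≤ t → η t ∈ roundCone S.a α) (hηr : ∀ t, 0 ≤ t → r ≤ ‖η t‖)
    (hl : (fun t : ℝ => η t - t • S.a) =o[atTop] fun t : ℝ => t) {t : ℝ} (ht : 0 ≤ t) :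
    η t = ray S S.a (η 0) t := by
  have hA : 0 < ‖S.a‖ := norm_pos_iff.2 hS.a_ne
  have hα : 0 < α := hS.β_pos.trans hS.β_lt
  have hk := S.newton.k_nonneg
  have hR : ∀ t, 0 ≤ t → η t ∈ S.region := fun t ht => mem_region_of_mem hS hr (hc t ht) (hηr t ht)
  have hF : ∀ t, 0 ≤ t → ‖S.F (η t)‖ ≤ S.k * ‖S.a‖ ^ 2 / (4 * α ^ 2) / ‖η t‖ ^ 2 := fun t ht => by
    have hn : 0 < ‖η t‖ := hr0.trans_le (hηr t ht)
    have h1 : 2 * α / ‖S.a‖ * ‖η t‖ ≤ S.q (η t) := by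
      have h2 : α * ‖η t‖ * ‖S.a‖ ≤ inner ℝ (η t) S.a := hc t ht
      rw [hS.q_eq, axial_apply]
      calc 2 * α / ‖S.a‖ * ‖η t‖ = 2 / ‖S.a‖ ^ 2 * (α * ‖η t‖ * ‖S.a‖) := by field_simp
        _ ≤ _ := by gcongr
    have h3 : 0 < 2 * α / ‖S.a‖ * ‖η t‖ := by positivity
    refine (S.newton.norm_F_le _ (hR t ht).1 (h3.trans_le h1)).trans ?_
    calc S.k / S.q (η t) ^ 2 ≤ S.k / (2 * α / ‖S.a‖ * ‖η t‖) ^ 2 := by gcongr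
      _ = _ := by field_simp; ring
  have h := sol_of_motion hS.a_ne (by positivity) hr0 hr1 hη hw hR hηr hF hl
  exact (h.unique (sol_ray norm_center_sub_le (hR 0 le_rfl)) ht).1

end FarField

/-! ### Sums of Newtonian pair potentials -/

section Pairs

variable {E : Type*} [NormedAddCommGroup E] [InnerProductSpace ℝ E]

lemma norm_kernel_sub_le {z w : E} {s : ℝ} (hs : 0 < s) (hz : s ≤ ‖z‖) (hw : s ≤ ‖w‖) :
    ‖(1 / ‖z‖ ^ 3) • z - (1 / ‖w‖ ^ 3) • w‖ ≤ 4 * ‖z - w‖ / s ^ 3 := by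
  have hz0 := hs.trans_le hz
  have hw0 := hs.trans_le hw
  have e : (1 / ‖z‖ ^ 3) • z - (1 / ‖w‖ ^ 3) • w
      = (1 / ‖z‖ ^ 3) • (z - w) + (1 / ‖z‖ ^ 3 - 1 / ‖w‖ ^ 3) • w := by module
  have h1 : ‖(1 / ‖z‖ ^ 3) • (z - w)‖ ≤ ‖z - w‖ / s ^ 3 := by
    rw [norm_smul, Real.norm_of_nonneg (by positivity), one_div_mul_eq_div]
    gcongr
  have h2 : ‖(1 / ‖z‖ ^ 3 - 1 / ‖w‖ ^ 3) • w‖ ≤ 3 * ‖z - w‖ / s ^ 3 := by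
    have e2 : 1 / ‖z‖ ^ 3 - 1 / ‖w‖ ^ 3 = (‖w‖ - ‖z‖) *
        (1 / (‖z‖ ^ 3 * ‖w‖) + 1 / (‖z‖ ^ 2 * ‖w‖ ^ 2) + 1 / (‖z‖ * ‖w‖ ^ 3)) := by
      field_simp
      ring
    have e3 : |‖w‖ - ‖z‖| ≤ ‖z - w‖ := by
      rw [abs_sub_comm]; exact abs_norm_sub_norm_le z w
    rw [norm_smul, Real.norm_eq_abs, e2, abs_mul, abs_of_nonneg (a := _ + _ + _) (by positivity),
      mul_assoc]
    have e4 : (1 / (‖z‖ ^ 3 * ‖w‖) + 1 / (‖z‖ ^ 2 * ‖w‖ ^ 2) + 1 / (‖z‖ * ‖w‖ ^ 3)) * ‖w‖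
        = 1 / ‖z‖ ^ 3 + 1 / (‖z‖ ^ 2 * ‖w‖) + 1 / (‖z‖ * ‖w‖ ^ 2) := by
      field_simp
    have e5 : 1 / ‖z‖ ^ 3 + 1 / (‖z‖ ^ 2 * ‖w‖) + 1 / (‖z‖ * ‖w‖ ^ 2)
        ≤ 1 / s ^ 3 + 1 / (s ^ 2 * s) + 1 / (s * s ^ 2) := by gcongr
    calc _ ≤ ‖z - w‖ * (1 / s ^ 3 + 1 / (s ^ 2 * s) + 1 / (s * s ^ 2)) := by
          rw [e4]
          exact mul_le_mul e3 e5 (by positivity) (norm_nonneg _)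
      _ = _ := by field_simp; ring
  rw [e]
  refine (norm_add_le _ _).trans ((add_le_add h1 h2).trans (le_of_eq ?_))
  ring

lemma abs_inv_norm_taylor_le {z w : E} {s : ℝ} (hs : 0 < s) (hz : s ≤ ‖z‖) (hw : s ≤ ‖w‖) :
    |1 / ‖w‖ - 1 / ‖z‖ + 1 / ‖z‖ ^ 3 * inner ℝ z (w - z)| ≤ 2 * ‖w - z‖ ^ 2 / s ^ 3 := by
  have hz0 := hs.trans_le hz
  have hw0 := hs.trans_le hw
  have e : ‖w‖ ^ 2 = ‖z‖ ^ 2 + 2 * inner ℝ z (w - z) + ‖w - z‖ ^ 2 := by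
    rw [← norm_add_sq_real, add_sub_cancel]
  have e1 : inner ℝ z (w - z) = (‖w‖ ^ 2 - ‖z‖ ^ 2 - ‖w - z‖ ^ 2) / 2 := by linarith
  have h2 : (‖z‖ - ‖w‖) ^ 2 ≤ ‖w - z‖ ^ 2 := by
    rw [← sq_abs, abs_sub_comm]
    gcongr
    exact abs_norm_sub_norm_le w z
  -- the inner product is a function of the norms, so that the remainder is explicit
  have e2 : 1 / ‖w‖ - 1 / ‖z‖ + 1 / ‖z‖ ^ 3 * inner ℝ z (w - z)
      = (‖z‖ - ‖w‖) ^ 2 * (1 / (‖z‖ ^ 2 * ‖w‖) + 1 / (2 * ‖z‖ ^ 3))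
        - ‖w - z‖ ^ 2 * (1 / (2 * ‖z‖ ^ 3)) := by
    rw [e1]
    field_simp
    ring
  have h3 : 1 / (‖z‖ ^ 2 * ‖w‖) + 1 / (2 * ‖z‖ ^ 3) ≤ 1 / (s ^ 2 * s) + 1 / (2 * s ^ 3) := by gcongr
  have h4 : 1 / (2 * ‖z‖ ^ 3) ≤ 1 / (2 * s ^ 3) := by gcongr
  have h5 : 1 / (s ^ 2 * s) + 1 / (2 * s ^ 3) ≤ 2 / s ^ 3 := by
    rw [← pow_succ, show 1 / s ^ (2 + 1) + 1 / (2 * s ^ 3) = (3 / 2) / s ^ 3 by field_simp; ring]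
    gcongr
    norm_num
  have h6 : 1 / (2 * s ^ 3) ≤ 2 / s ^ 3 := by
    rw [show 1 / (2 * s ^ 3) = (1 / 2) / s ^ 3 by field_simp]
    gcongr
    norm_num
  have h7 : 0 ≤ 1 / (‖z‖ ^ 2 * ‖w‖) + 1 / (2 * ‖z‖ ^ 3) := by positivity
  have h8 : 0 ≤ 1 / (2 * ‖z‖ ^ 3) := by positivity
  have h9 := mul_le_mul h2 (h3.trans h5) h7 (sq_nonneg _)
  have h10 := mul_le_mul_of_nonneg_left (h4.trans h6) (sq_nonneg ‖w - z‖)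
  have h11 := mul_nonneg (sq_nonneg (‖z‖ - ‖w‖)) h7
  have h12 := mul_nonneg (sq_nonneg ‖w - z‖) h8
  have h13 : 2 * ‖w - z‖ ^ 2 / s ^ 3 = ‖w - z‖ ^ 2 * (2 / s ^ 3) := by ring
  rw [e2, h13, abs_le]
  constructor <;> linarith

lemma norm_le_of_forall_inner_le {V : Type*} [NormedAddCommGroup V] [InnerProductSpace ℝ V] {w : V}
    {C : ℝ} (hC : 0 ≤ C) (h : ∀ y, |inner ℝ w y| ≤ C * ‖y‖) : ‖w‖ ≤ C := by
  have h1 := h w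
  rw [real_inner_self_eq_norm_sq, abs_of_nonneg (sq_nonneg _)] at h1
  rcases (norm_nonneg w).eq_or_lt with h2 | h2
  · exact h2 ▸ hC
  · nlinarith

/-- A sum of pair potentials `μ / ‖D x‖`, each a Newtonian potential of a linear function `D` of the
configuration, is Newtonian wherever the functions `‖D x‖` dominate a multiple of `q`. -/
lemma exists_newtonianOn_of_pairs {V ι : Type*} [NormedAddCommGroup V] [InnerProductSpace ℝ V]
    {P : Finset ι} {D : ι → V →L[ℝ] E} {μ : ι → ℝ} {c : ℝ} {dom : Set V} {q : V →L[ℝ] ℝ}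
    {u : V → ℝ} {F : V → V} (hμ : ∀ p ∈ P, 0 ≤ μ p) (hc : 0 < c)
    (hD : ∀ x ∈ dom, 0 < q x → ∀ p ∈ P, c * q x ≤ ‖D p x‖)
    (hu : ∀ x, u x = ∑ p ∈ P, μ p * (1 / ‖D p x‖))
    (hF : ∀ x y, inner ℝ (F x) y = -∑ p ∈ P, μ p * (1 / ‖D p x‖ ^ 3 * inner ℝ (D p x) (D p y))) :
    ∃ k, NewtonianOn dom q u F k := by
  set M := ∑ p ∈ P, μ p with hM
  set K := ∑ p ∈ P, ‖D p‖ with hK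
  have hM0 : 0 ≤ M := Finset.sum_nonneg hμ
  have hK0 : 0 ≤ K := Finset.sum_nonneg fun p _ => norm_nonneg _
  have hDK : ∀ p ∈ P, ∀ x, ‖D p x‖ ≤ K * ‖x‖ := fun p hp x => (D p).le_of_opNorm_le
    (Finset.single_le_sum (f := fun p => ‖D p‖) (fun p _ => norm_nonneg _) hp) x
  have hsum : ∀ {f : ι → ℝ} {B : ℝ}, (∀ p ∈ P, |f p| ≤ B) → |∑ p ∈ P, μ p * f p| ≤ M * B := by
    intro f B h
    rw [hM, Finset.sum_mul]
    refine (Finset.abs_sum_le_sum_abs _ _).trans (Finset.sum_le_sum fun p hp => ?_)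
    rw [abs_mul, abs_of_nonneg (hμ p hp)]
    exact mul_le_mul_of_nonneg_left (h p hp) (hμ p hp)
  have hs : ∀ {x : V} {σ : ℝ}, x ∈ dom → 0 < σ → σ ≤ q x → ∀ p ∈ P, c * σ ≤ ‖D p x‖ :=
    fun hx hσ hσq p hp => (mul_le_mul_of_nonneg_left hσq hc.le).trans
      (hD _ hx (hσ.trans_le hσq) p hp)
  have hk1 : 0 ≤ M / c := by positivity
  have hk2 : 0 ≤ M * K / c ^ 2 := by positivity
  have hk3 : 0 ≤ 4 * (M * K ^ 2) / c ^ 3 := by positivity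
  refine ⟨M / c + M * K / c ^ 2 + 4 * (M * K ^ 2) / c ^ 3, by positivity, ?_, ?_, ?_, ?_, ?_, ?_⟩
  · intro x _ _
    rw [hu]
    exact Finset.sum_nonneg fun p hp => mul_nonneg (hμ p hp) (by positivity)
  · intro x hx hq
    have h1 : |∑ p ∈ P, μ p * (1 / ‖D p x‖)| ≤ M * (1 / (c * q x)) := hsum fun p hp => by
      rw [abs_of_nonneg (by positivity)]
      exact one_div_le_one_div_of_le (by positivity) (hD x hx hq p hp)
    rw [hu]
    refine (le_abs_self _).trans (h1.trans ?_)
    rw [show M * (1 / (c * q x)) = M / c / q x by field_simp]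
    gcongr
    linarith
  · intro x hx hq
    have h1 : ‖F x‖ ≤ M * K / c ^ 2 / q x ^ 2 := by
      refine norm_le_of_forall_inner_le (by positivity) fun y => ?_
      rw [hF, abs_neg]
      refine (hsum (B := K * ‖y‖ / (c * q x) ^ 2) fun p hp => ?_).trans (le_of_eq (by field_simp))
      have h2 := hD x hx hq p hp
      have h3 : 0 < ‖D p x‖ := lt_of_lt_of_le (by positivity) h2
      rw [abs_mul, abs_of_nonneg (by positivity : 0 ≤ 1 / ‖D p x‖ ^ 3)]
      calc 1 / ‖D p x‖ ^ 3 * |inner ℝ (D p x) (D p y)|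
          ≤ 1 / ‖D p x‖ ^ 3 * (‖D p x‖ * (K * ‖y‖)) := by
            gcongr
            exact (abs_real_inner_le_norm _ _).trans (by gcongr; exact hDK p hp y)
        _ = K * ‖y‖ / ‖D p x‖ ^ 2 := by field_simp
        _ ≤ _ := by gcongr
    refine h1.trans ?_
    gcongr
    linarith
  · intro x hx y hy σ hσ hσx hσy
    have h1 : ‖F x - F y‖ ≤ 4 * (M * K ^ 2) / c ^ 3 * ‖x - y‖ / σ ^ 3 := by
      refine norm_le_of_forall_inner_le (by positivity) fun w => ?_
      rw [inner_sub_left, hF, hF, ← abs_neg,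
        show ∀ a b : ℝ, -(-a - -b) = a - b by intros; ring, ← Finset.sum_sub_distrib]
      simp only [← mul_sub]
      refine (hsum (B := 4 * (K * ‖x - y‖) / (c * σ) ^ 3 * (K * ‖w‖)) fun p hp => ?_).trans
        (le_of_eq (by field_simp))
      rw [← real_inner_smul_left, ← real_inner_smul_left, ← inner_sub_left]
      refine (abs_real_inner_le_norm _ _).trans (mul_le_mul ?_ (hDK p hp w) (norm_nonneg _)
        (by positivity))
      refine (norm_kernel_sub_le (by positivity) (hs hx hσ hσx p hp) (hs hy hσ hσy p hp)).trans ?_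
      rw [← map_sub]
      gcongr
      exact hDK p hp _
    refine h1.trans ?_
    gcongr
    linarith
  · intro x hx y hy σ hσ hσx hσy
    have h1 : |u y - u x - inner ℝ (F x) (y - x)| ≤
        4 * (M * K ^ 2) / c ^ 3 * ‖y - x‖ ^ 2 / σ ^ 3 := by
      rw [hu, hu, hF, sub_neg_eq_add, ← Finset.sum_sub_distrib, ← Finset.sum_add_distrib]
      simp only [← mul_sub, ← mul_add]
      refine (hsum (B := 4 * (K * ‖y - x‖) ^ 2 / (c * σ) ^ 3) fun p hp => ?_).trans
        (le_of_eq (by field_simp))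
      rw [map_sub]
      refine (abs_inv_norm_taylor_le (by positivity) (hs hx hσ hσx p hp)
        (hs hy hσ hσy p hp)).trans ?_
      rw [← map_sub]
      gcongr
      · norm_num
      · exact hDK p hp _
    refine h1.trans ?_
    gcongr
    linarith
  · intro x hx hq
    rw [hu, hF, neg_inj]
    refine Finset.sum_congr rfl fun p hp => ?_
    have h3 : 0 < ‖D p x‖ := lt_of_lt_of_le (by positivity) (hD x hx hq p hp)
    rw [real_inner_self_eq_norm_sq]
    field_simp

end Pairs

/-! ### The mass inner product -/

section Mass

variable {N : ℕ} {E : Type*} [NormedAddCommGroup E] [InnerProductSpace ℝ E] {m : Fin N → ℝ}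

/-- The isometry of `E^N` with the mass inner product onto the `ℓ²` sum of `N` copies of `E`: it
multiplies the `i`-th component by `√mᵢ`. -/
noncomputable def massEquiv (m : Fin N → ℝ) (hm : ∀ i, 0 < m i) :
    (Fin N → E) ≃L[ℝ] PiLp 2 (fun _ : Fin N => E) :=
  (ContinuousLinearEquiv.piCongrRight fun i =>
    ContinuousLinearEquiv.smulLeft (Units.mk0 (√(m i)) (Real.sqrt_pos.2 (hm i)).ne')).trans
      (PiLp.continuousLinearEquiv 2 ℝ fun _ : Fin N => E).symm

lemma massEquiv_apply (hm : ∀ i, 0 < m i) (x : Fin N → E) (i : Fin N) :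
    massEquiv m hm x i = √(m i) • x i := rfl

lemma inner_massEquiv (hm : ∀ i, 0 < m i) (x y : Fin N → E) :
    inner ℝ (massEquiv m hm x) (massEquiv m hm y) = massInner m x y := by
  rw [PiLp.inner_apply, massInner]
  refine Finset.sum_congr rfl fun i _ => ?_
  rw [massEquiv_apply, massEquiv_apply, real_inner_smul_left, real_inner_smul_right, ← mul_assoc,
    Real.mul_self_sqrt (hm i).le]

lemma norm_massEquiv (hm : ∀ i, 0 < m i) (x : Fin N → E) :
    ‖massEquiv m hm x‖ = massNorm m x := by
  rw [massNorm, ← inner_massEquiv hm, real_inner_self_eq_norm_sq, Real.sqrt_sq (norm_nonneg _)]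

lemma massEquiv_mem_roundCone (hm : ∀ i, 0 < m i) {a x : Fin N → E} {β : ℝ} :
    massEquiv m hm x ∈ roundCone (massEquiv m hm a) β ↔ x ∈ cone m a β := by
  simp only [roundCone, cone, mem_ofPred_eq, norm_massEquiv, inner_massEquiv]

lemma massEquiv_mem_cutCone (hm : ∀ i, 0 < m i) {a x : Fin N → E} {β r : ℝ} :
    x ∈ cutCone m a β r ↔
      massEquiv m hm x ∈ roundCone (massEquiv m hm a) β ∧ r ≤ ‖massEquiv m hm x‖ := by
  rw [massEquiv_mem_roundCone, norm_massEquiv, cutCone, Set.mem_sdiff, mem_ofPred_eq, not_lt]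

/-- The gradient as a sum over pairs: the terms `(i, j)` and `(j, i)` combine. -/
lemma massInner_gradPotential (x y : Fin N → E) :
    massInner m (gradPotential m x) y = -∑ p ∈ Finset.univ.sigma fun i : Fin N => Finset.Ioi i,
      m p.1 * m p.2 * (1 / ‖x p.1 - x p.2‖ ^ 3 * inner ℝ (x p.1 - x p.2) (y p.1 - y p.2)) := by
  rw [Finset.sum_sigma, massInner]
  set f : Fin N → Fin N → ℝ := fun i j =>
    m i * m j * (1 / ‖x i - x j‖ ^ 3 * inner ℝ (x j - x i) (y i)) with hf
  have h1 : ∀ i, m i * inner ℝ (gradPotential m x i) (y i) = ∑ j ∈ {i}ᶜ, f i j := by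
    intro i
    rw [gradPotential, sum_inner, Finset.mul_sum, Finset.compl_singleton]
    refine Finset.sum_congr rfl fun j _ => ?_
    rw [real_inner_smul_left, norm_sub_rev, hf]
    ring
  simp only [h1]
  rw [Finset.sum_sum_Ioi_add_eq_sum_sum_off_diag (fun j i => f i j) |>.symm, ← Finset.sum_neg_distrib]
  refine Finset.sum_congr rfl fun i _ => ?_
  rw [← Finset.sum_neg_distrib]
  refine Finset.sum_congr rfl fun j _ => ?_
  simp only [hf]
  rw [norm_sub_rev (x j) (x i), ← neg_sub (x i) (x j), inner_neg_left, inner_sub_right]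
  ring

/-- The Newtonian potential with real values. At collisions, the infinite terms are replaced by `0`. -/
noncomputable def realPotential (m : Fin N → ℝ) (x : Fin N → E) : ℝ :=
  ∑ p ∈ Finset.univ.sigma fun i : Fin N => Finset.Ioi i, m p.1 * m p.2 * (1 / ‖x p.1 - x p.2‖)

omit [InnerProductSpace ℝ E] in
lemma potential_eq_ofReal (hm : ∀ i, 0 < m i) {x : Fin N → E} (hx : x ∈ collisionFree N E) :
    potential m x = ENNReal.ofReal (realPotential m x) := by
  have h0 : ∀ i j, 0 ≤ m i * m j := fun i j => mul_nonneg (hm i).le (hm j).le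
  rw [potential, realPotential, ENNReal.ofReal_sum_of_nonneg
    fun p _ => mul_nonneg (h0 _ _) (by positivity), Finset.sum_sigma]
  refine Finset.sum_congr rfl fun i _ => Finset.sum_congr rfl fun j hj => ?_
  have h1 : 0 < ‖x i - x j‖ := norm_pos_iff.2 (sub_ne_zero.2 (hx i j (Finset.mem_Ioi.1 hj).ne))
  rw [mul_one_div, ENNReal.ofReal_div_of_pos h1]

/-! ### Cones without collisions -/

omit [InnerProductSpace ℝ E] in
lemma isOpen_collisionFree : IsOpen (collisionFree N E) := by
  simp only [collisionFree, ofPred_forall]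
  exact isOpen_iInter_of_finite fun i => isOpen_iInter_of_finite fun j =>
    isOpen_iInter_of_finite fun _ => isOpen_ne_fun (continuous_apply i) (continuous_apply j)

lemma smul_mem_collisionSet {x : Fin N → E} (hx : x ∈ collisionSet N E) (s : ℝ) :
    s • x ∈ collisionSet N E := by
  simp only [collisionSet, collisionFree, mem_compl_iff, mem_ofPred_eq, not_forall, not_not] at hx ⊢
  obtain ⟨i, j, hij, h⟩ := hx
  exact ⟨i, j, hij, by rw [Pi.smul_apply, Pi.smul_apply, h]⟩

omit [InnerProductSpace ℝ E] in
lemma zero_mem_collisionSet (hN : 2 ≤ N) : (0 : Fin N → E) ∈ collisionSet N E := by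
  intro h
  have : Fact (2 ≤ N) := ⟨hN⟩
  exact h ⟨0, by lia⟩ ⟨1, by lia⟩ (by simp) rfl

/-- Thin cones around a configuration without collisions contain no collision but the vertex. -/
lemma exists_cone_inter_collisionSet (hN : 2 ≤ N) (hm : ∀ i, 0 < m i) {a : Fin N → E}
    (ha : a ∈ collisionFree N E) :
    ∃ β ∈ Ioo (0 : ℝ) 1, cone m a β ∩ collisionSet N E = {0} := by
  set Φ := massEquiv (E := E) m hm
  have ha0 : Φ a ≠ 0 := fun h => by
    rw [Φ.map_eq_zero_iff] at h
    exact zero_mem_collisionSet hN (h ▸ ha)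
  have hA : 0 < ‖Φ a‖ := norm_pos_iff.2 ha0
  have h1 : IsOpen (Φ.symm ⁻¹' collisionFree N E) := isOpen_collisionFree.preimage Φ.symm.continuous
  obtain ⟨δ, hδ, h2⟩ := Metric.isOpen_iff.1 h1 (Φ a) (by simpa using ha)
  -- points of norm `‖a‖` in the cone of parameter `β` are at distance at most `‖a‖ √(2 (1 - β))` of `a`
  have h3 : 0 < δ ^ 2 / (4 * ‖Φ a‖ ^ 2) := by positivity
  refine ⟨max (1 / 2) (1 - δ ^ 2 / (4 * ‖Φ a‖ ^ 2)), ⟨by positivity, by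
    rw [max_lt_iff]; constructor <;> linarith⟩, ?_⟩
  set β := max (1 / 2) (1 - δ ^ 2 / (4 * ‖Φ a‖ ^ 2)) with hβ
  ext x
  rw [mem_singleton_iff]
  constructor
  · rintro ⟨hx, hxc⟩
    by_contra hx0
    have hX : 0 < ‖Φ x‖ := norm_pos_iff.2 (Φ.map_eq_zero_iff.not.2 hx0)
    have hx' : β * ‖Φ x‖ * ‖Φ a‖ ≤ inner ℝ (Φ x) (Φ a) := (massEquiv_mem_roundCone hm).2 hx
    have hβ1 : 1 - β ≤ δ ^ 2 / (4 * ‖Φ a‖ ^ 2) := by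
      have := le_max_right (1 / 2) (1 - δ ^ 2 / (4 * ‖Φ a‖ ^ 2))
      rw [← hβ] at this
      linarith
    rw [le_div_iff₀ (by positivity)] at hβ1
    -- the multiple of `x` on the sphere through `a` is too close to `a` to be a collision
    set s := ‖Φ a‖ / ‖Φ x‖ with hs
    have h4 : ‖Φ (s • x) - Φ a‖ ^ 2 < δ ^ 2 := by
      have h5 : s * ‖Φ x‖ = ‖Φ a‖ := div_mul_cancel₀ _ hX.ne'
      have h6 : 0 < s := by positivity
      rw [norm_sub_sq_real, map_smul, norm_smul, Real.norm_of_nonneg h6.le, h5,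
        real_inner_smul_left]
      have h7 := mul_le_mul_of_nonneg_left hx' h6.le
      have h8 : s * (β * ‖Φ x‖ * ‖Φ a‖) = β * ‖Φ a‖ ^ 2 := by
        rw [← h5]; ring
      nlinarith [sq_pos_of_pos hδ]
    have h9 : Φ (s • x) ∈ Metric.ball (Φ a) δ := by
      rw [mem_ball_iff_norm]
      exact lt_of_pow_lt_pow_left₀ 2 hδ.le h4
    have h10 := h2 h9
    rw [mem_preimage, Φ.symm_apply_apply] at h10
    exact smul_mem_collisionSet hxc s h10
  · rintro rfl
    exact ⟨by simp [cone, massNorm, massInner], zero_mem_collisionSet hN⟩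

/-- In a cone without collisions, mutual distances dominate the norm. -/
lemma exists_le_norm_sub [FiniteDimensional ℝ E] (hm : ∀ i, 0 < m i) {a : Fin N → E} {β : ℝ}
    (h : cone m a β ∩ collisionSet N E = {0}) :
    ∃ c : ℝ, 0 < c ∧ ∀ x ∈ cone m a β, ∀ i j, i ≠ j → c * massNorm m x ≤ ‖x i - x j‖ := by
  set Φ := massEquiv (E := E) m hm
  have hK : IsCompact (roundCone (Φ a) β ∩ Metric.sphere 0 1) :=
    (isCompact_sphere _ _).inter_left isClosed_roundCone
  have h1 : ∀ p : Fin N × Fin N, ∃ c : ℝ, 0 < c ∧ (p.1 ≠ p.2 →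
      ∀ z ∈ roundCone (Φ a) β ∩ Metric.sphere 0 1, c ≤ ‖Φ.symm z p.1 - Φ.symm z p.2‖) := by
    rintro ⟨i, j⟩
    by_cases hij : i = j
    · exact ⟨1, one_pos, fun h => absurd hij h⟩
    have hf : Continuous fun z => ‖Φ.symm z i - Φ.symm z j‖ :=
      (((continuous_apply i).comp Φ.symm.continuous).sub
        ((continuous_apply j).comp Φ.symm.continuous)).norm
    obtain ⟨c, hc, h2⟩ := hK.exists_forall_le' hf.continuousOn (a := 0) fun z hz => by
      rw [norm_pos_iff, sub_ne_zero]
      intro he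
      have h3 : Φ.symm z ∈ cone m a β ∩ collisionSet N E :=
        ⟨(massEquiv_mem_roundCone hm).1 (by rw [Φ.apply_symm_apply]; exact hz.1),
          fun hz' => hz' i j hij he⟩
      rw [h, mem_singleton_iff, Φ.symm.map_eq_zero_iff] at h3
      simpa [h3] using hz.2
    exact ⟨c, hc, fun _ => h2⟩
  choose c hc h1 using h1
  obtain ⟨c', h2, hc'⟩ := ((eventually_all.2 fun p =>
    (eventually_le_nhds (hc p)).filter_mono nhdsWithin_le_nhds).and
      (self_mem_nhdsWithin (s := Ioi (0 : ℝ)))).exists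
  refine ⟨c', hc', fun x hx i j hij => ?_⟩
  rw [← norm_massEquiv hm]
  rcases (norm_nonneg (Φ x)).eq_or_lt with h0 | h0
  · rw [← h0, mul_zero]; exact norm_nonneg _
  have h3 : ‖Φ x‖⁻¹ • Φ x ∈ roundCone (Φ a) β ∩ Metric.sphere 0 1 := by
    have hx' : β * ‖Φ x‖ * ‖Φ a‖ ≤ inner ℝ (Φ x) (Φ a) := (massEquiv_mem_roundCone hm).2 hx
    have h4 : ‖‖Φ x‖⁻¹ • Φ x‖ = 1 := norm_smul_inv_norm (𝕜 := ℝ) (norm_pos_iff.1 h0)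
    refine ⟨?_, by rw [mem_sphere_zero_iff_norm, h4]⟩
    show β * ‖‖Φ x‖⁻¹ • Φ x‖ * ‖Φ a‖ ≤ inner ℝ (‖Φ x‖⁻¹ • Φ x) (Φ a)
    rw [h4, real_inner_smul_left, le_inv_mul_iff₀ h0]
    linarith
  have h5 := (h2 (i, j)).trans (h1 (i, j) hij _ h3)
  rw [map_smul, Φ.symm_apply_apply, Pi.smul_apply, Pi.smul_apply, ← smul_sub, norm_smul, norm_inv,
    norm_norm, le_inv_mul_iff₀ h0] at h5
  rw [mul_comm]
  exact h5

lemma exists_newtonianOn_roundCone [FiniteDimensional ℝ E] (hm : ∀ i, 0 < m i) {a : Fin N → E}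
    (ha : a ≠ 0) {β : ℝ} (h : cone m a β ∩ collisionSet N E = {0}) :
    ∃ k, NewtonianOn (roundCone (massEquiv m hm a) β) (axial (massEquiv m hm a))
      (fun z => realPotential m ((massEquiv m hm).symm z))
      (fun z => massEquiv m hm (gradPotential m ((massEquiv m hm).symm z))) k := by
  obtain ⟨c, hc, hcone⟩ := exists_le_norm_sub hm h
  set Φ := massEquiv (E := E) m hm
  have hA : 0 < ‖Φ a‖ := norm_pos_iff.2 (Φ.map_eq_zero_iff.not.2 ha)
  refine exists_newtonianOn_of_pairs (P := Finset.univ.sigma fun i : Fin N => Finset.Ioi i)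
    (μ := fun p => m p.1 * m p.2) (c := c * ‖Φ a‖ / 2)
    (D := fun p => (ContinuousLinearMap.proj (R := ℝ) (φ := fun _ : Fin N => E) p.1
      - ContinuousLinearMap.proj (R := ℝ) (φ := fun _ : Fin N => E) p.2).comp
        (Φ.symm : PiLp 2 (fun _ : Fin N => E) →L[ℝ] Fin N → E))
    (fun p _ => mul_nonneg (hm _).le (hm _).le) (by positivity) ?_ (fun z => rfl) ?_
  · intro z hz _ p hp
    have h1 := hcone (Φ.symm z) ((massEquiv_mem_roundCone hm).1 (by
      rw [Φ.apply_symm_apply]; exact hz)) p.1 p.2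
      (Finset.mem_Ioi.1 (Finset.mem_sigma.1 hp).2).ne
    rw [← norm_massEquiv hm, Φ.apply_symm_apply] at h1
    refine le_trans ?_ h1
    rw [axial_apply]
    have h2 := real_inner_le_norm z (Φ a)
    calc c * ‖Φ a‖ / 2 * (2 / ‖Φ a‖ ^ 2 * inner ℝ z (Φ a))
        ≤ c * ‖Φ a‖ / 2 * (2 / ‖Φ a‖ ^ 2 * (‖z‖ * ‖Φ a‖)) := by gcongr
      _ = c * ‖z‖ := by field_simp
  · intro z w
    obtain ⟨y, rfl⟩ := Φ.surjective w
    rw [inner_massEquiv hm, massInner_gradPotential]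
    simp

end Mass

/-! ### Curves in the configuration space -/

section Transport

variable {N : ℕ} {E : Type*} [NormedAddCommGroup E] [InnerProductSpace ℝ E] {m : Fin N → ℝ}

lemma deriv_massEquiv (hm : ∀ i, 0 < m i) (σ : ℝ → Fin N → E) (t : ℝ) :
    deriv (fun r => massEquiv m hm (σ r)) t = massEquiv m hm (deriv σ t) := by
  by_cases h : DifferentiableAt ℝ σ t
  · exact ((massEquiv m hm).hasFDerivAt.comp_hasDerivAt t h.hasDerivAt).deriv
  · rw [deriv_zero_of_not_differentiableAt h, map_zero]
    refine deriv_zero_of_not_differentiableAt fun h' => h ?_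
    simpa using (massEquiv (E := E) m hm).symm.differentiableAt.comp t h'

lemma action_eq_curveAction (hm : ∀ i, 0 < m i) (h : ℝ) (σ : ℝ → Fin N → E) (s t : ℝ) :
    action m h σ s t =
      curveAction (fun z => potential m ((massEquiv m hm).symm z)) h
        (fun r => massEquiv m hm (σ r)) s t := by
  simp only [action, curveAction, lagrangian, deriv_massEquiv, norm_massEquiv,
    ContinuousLinearEquiv.symm_apply_apply]

lemma absolutelyContinuousOnInterval_massEquiv (hm : ∀ i, 0 < m i) {σ : ℝ → Fin N → E} {s t : ℝ} :
    AbsolutelyContinuousOnInterval (fun r => massEquiv m hm (σ r)) s t ↔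
      AbsolutelyContinuousOnInterval σ s t := by
  set Φ := massEquiv (E := E) m hm
  constructor <;> intro h
  · refine absolutelyContinuousOnInterval_of_dist_le h
      (K := ‖(Φ.symm : PiLp 2 (fun _ : Fin N => E) →L[ℝ] Fin N → E)‖) fun x _ y _ => ?_
    have h1 := (Φ.symm : PiLp 2 (fun _ : Fin N => E) →L[ℝ] Fin N → E).le_opNorm (Φ (σ x) - Φ (σ y))
    rw [dist_eq_norm, dist_eq_norm]
    simpa using h1
  · refine absolutelyContinuousOnInterval_of_dist_le h
      (K := ‖(Φ : (Fin N → E) →L[ℝ] PiLp 2 (fun _ : Fin N => E))‖) fun x _ y _ => ?_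
    have h1 := (Φ : (Fin N → E) →L[ℝ] PiLp 2 (fun _ : Fin N => E)).le_opNorm (σ x - σ y)
    rw [dist_eq_norm, dist_eq_norm]
    simpa using h1

lemma hasLimitShape_iff (hm : ∀ i, 0 < m i) {η : ℝ → Fin N → E} {a : Fin N → E} :
    HasLimitShape η a ↔
      (fun t : ℝ => massEquiv m hm (η t) - t • massEquiv m hm a) =o[atTop] fun t : ℝ => t := by
  have e : (fun t : ℝ => massEquiv m hm (η t) - t • massEquiv m hm a)
      = fun t => massEquiv m hm (η t - t • a) := by
    ext1 t
    rw [map_sub, map_smul]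
  rw [e, HasLimitShape]
  exact ⟨fun h => ((massEquiv m hm).isBigO_comp _ _).trans_isLittleO h,
    fun h => ((massEquiv m hm).isBigO_comp_rev _ _).trans_isLittleO h⟩

lemma IsGeodesicRay.isMinimizing (hm : ∀ i, 0 < m i) {h : ℝ} {η : ℝ → Fin N → E}
    (hη : IsGeodesicRay m h η) :
    IsMinimizing (fun z => potential m ((massEquiv m hm).symm z)) h
      (fun t => massEquiv m hm (η t)) := by
  refine fun t ht => ⟨(absolutelyContinuousOnInterval_massEquiv hm).2 (hη t ht).1, ?_⟩
  intro τ σ hτ hσ h0 h1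
  have e : σ = fun r => massEquiv m hm ((massEquiv m hm).symm (σ r)) := by simp
  rw [← action_eq_curveAction, ← (hη t ht).2, e, ← action_eq_curveAction]
  rw [e, absolutelyContinuousOnInterval_massEquiv] at hσ
  exact iInf_le_of_le τ <| iInf_le_of_le _ <| iInf_le_of_le hτ <| iInf_le_of_le hσ <|
    iInf_le_of_le (by rw [h0, ContinuousLinearEquiv.symm_apply_apply]) <|
      iInf_le_of_le (by rw [h1, ContinuousLinearEquiv.symm_apply_apply]) le_rfl

lemma jmDist_le {h τ : ℝ} {σ : ℝ → Fin N → E} (hτ : 0 < τ)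
    (hσ : AbsolutelyContinuousOnInterval σ 0 τ) :
    jmDist m h (σ 0) (σ τ) ≤ action m h σ 0 τ :=
  iInf_le_of_le τ <| iInf_le_of_le σ <| iInf_le_of_le hτ <| iInf_le_of_le hσ <|
    iInf_le_of_le rfl <| iInf_le_of_le rfl le_rfl

/-- Constant curves of short duration show that the distance is zero on the diagonal. -/
lemma jmDist_self (h : ℝ) {x : Fin N → E} (hx : potential m x ≠ ⊤) : jmDist m h x x = 0 := by
  have h1 : ∀ τ : ℝ, 0 < τ →
      jmDist m h x x ≤ (potential m x + ENNReal.ofReal h) * ENNReal.ofReal τ := by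
    intro τ hτ
    refine (jmDist_le (m := m) (h := h) (σ := fun _ => x) hτ
      (LipschitzWith.const x).lipschitzOnWith.absolutelyContinuousOnInterval).trans
      (le_of_eq ?_)
    simp [action, lagrangian, massNorm, massInner]
  have h2 : Tendsto (fun τ : ℝ => (potential m x + ENNReal.ofReal h) * ENNReal.ofReal τ) (𝓝[>] 0)
      (𝓝 ((potential m x + ENNReal.ofReal h) * ENNReal.ofReal 0)) :=
    ENNReal.Tendsto.const_mul ((ENNReal.continuous_ofReal.tendsto 0).mono_left nhdsWithin_le_nhds)
      (Or.inr (ENNReal.add_ne_top.2 ⟨hx, ENNReal.ofReal_ne_top⟩))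
  rw [ENNReal.ofReal_zero, mul_zero] at h2
  exact le_antisymm (ge_of_tendsto h2 (eventually_mem_nhdsWithin.mono h1)) zero_le

lemma isGeodesicRay_of_isMinimizing (hm : ∀ i, 0 < m i) {h : ℝ} {η : ℝ → Fin N → E}
    (h0 : potential m (η 0) ≠ ⊤)
    (hη : IsMinimizing (fun z => potential m ((massEquiv m hm).symm z)) h
      (fun t => massEquiv m hm (η t))) : IsGeodesicRay m h η := by
  intro t ht
  have hac := (absolutelyContinuousOnInterval_massEquiv hm).1 (hη t ht).1
  refine ⟨hac, ?_⟩
  rcases ht.eq_or_lt with rfl | ht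
  · rw [jmDist_self h h0, action]
    simp
  · refine le_antisymm (jmDist_le ht hac) ?_
    refine le_iInf fun τ => le_iInf fun σ => le_iInf fun hτ => le_iInf fun hσ => le_iInf fun e0 =>
      le_iInf fun e1 => ?_
    rw [action_eq_curveAction hm, action_eq_curveAction hm]
    exact (hη t ht.le).2 τ _ hτ ((absolutelyContinuousOnInterval_massEquiv hm).2 hσ)
      (by rw [e0]) (by rw [e1])

end Transport

end NBody

theorem theorem2 {E : Type*} [NormedAddCommGroup E] [InnerProductSpace ℝ E]
    [FiniteDimensional ℝ E] (hE : 2 ≤ Module.finrank ℝ E)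
    {N : ℕ} (hN : 2 ≤ N) (m : Fin N → ℝ) (hm : ∀ i, 0 < m i)
    (a : Fin N → E) (ha : a ∈ NBody.collisionFree N E)
    (α : ℝ) (hα : α ∈ Set.Ioo (0 : ℝ) 1) (hα₀ : NBody.alphaZero m a < α) :
    ∃ r : ℝ, 0 < r ∧ ∀ x ∈ NBody.cutCone m a α r,
      ∃ γ : ℝ → Fin N → E,
        (NBody.IsHyperbolicMotion m a γ ∧ γ 0 = x ∧
          ∀ t, 0 ≤ t → γ t ∈ NBody.cutCone m a α r) ∧
        (∀ η : ℝ → Fin N → E, NBody.IsHyperbolicMotion m a η → η 0 = x →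
          (∀ t, 0 ≤ t → η t ∈ NBody.cutCone m a α r) → Set.EqOn η γ (Set.Ici 0)) ∧
        (NBody.IsGeodesicRay m (NBody.massNorm m a ^ 2 / 2) γ ∧
          NBody.HasLimitShape γ a) ∧
        (∀ η : ℝ → Fin N → E, NBody.IsGeodesicRay m (NBody.massNorm m a ^ 2 / 2) η →
          η 0 = x → NBody.HasLimitShape η a → Set.EqOn η γ (Set.Ici 0)) := by
  have ha0 : a ≠ 0 := fun h => NBody.zero_mem_collisionSet hN (h ▸ ha)
  obtain ⟨β, ⟨⟨hβ0, hβ1⟩, hβ⟩, hβα⟩ := exists_lt_of_csInf_lt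
    (NBody.exists_cone_inter_collisionSet hN hm ha) hα₀
  obtain ⟨k, hk⟩ := NBody.exists_newtonianOn_roundCone hm ha0 hβ
  set Φ := NBody.massEquiv (E := E) m hm with hΦ
  obtain ⟨S, hS, hSa, hSu, hSF⟩ := NBody.FarField.exists_isConical (Φ.map_eq_zero_iff.not.2 ha0)
    hβ0 hβα hα.2 hk
  have hA : 0 < ‖S.a‖ := norm_pos_iff.2 hS.a_ne
  have hg := NBody.FarField.gap_pos hS
  have hε := S.ε_pos
  -- both conditions on the radius of the cut cone hold for all large radii
  obtain ⟨r, hr0, hr, hr1⟩ : ∃ r : ℝ, 0 < r ∧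
      2 * (NBody.FarField.gap S α β * ‖NBody.FarField.basePoint S‖) + S.ρ * ‖S.a‖ ^ 2 / 2
        < 2 * NBody.FarField.gap S α β * r ∧
      4 * Real.pi * (S.k * ‖S.a‖ ^ 2 / (4 * α ^ 2)) * (‖S.a‖ + 1) ≤ ‖S.a‖ ^ 2 * r * S.ε := by
    have h1 := (Filter.tendsto_id (x := (Filter.atTop : Filter ℝ))).const_mul_atTop
      (by positivity : 0 < 2 * NBody.FarField.gap S α β)
    have h2 := (Filter.tendsto_id (x := (Filter.atTop : Filter ℝ))).const_mul_atTop
      (by positivity : 0 < ‖S.a‖ ^ 2 * S.ε)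
    obtain ⟨r, h3, h4, h5⟩ := ((Filter.eventually_gt_atTop 0).and
      ((h1.eventually_gt_atTop _).and (h2.eventually_ge_atTop _))).exists
    exact ⟨r, h3, h4, h5.trans (le_of_eq (by simp only [id]; ring))⟩
  refine ⟨r, hr0, fun x hx => ?_⟩
  have hcut : ∀ {y : Fin N → E}, y ∈ NBody.cutCone m a α r ↔
      Φ y ∈ NBody.roundCone S.a α ∧ r ≤ ‖Φ y‖ := by
    intro y
    rw [hSa]
    exact NBody.massEquiv_mem_cutCone hm
  have hfree : ∀ z ∈ S.region, Φ.symm z ∈ NBody.collisionFree N E := by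
    intro z hz
    by_contra hc
    have h1 : z ∈ NBody.roundCone (Φ a) β := hSa ▸ hS.dom_eq ▸ hz.1
    have h2 : Φ.symm z ∈ NBody.cone m a β ∩ NBody.collisionSet N E :=
      ⟨(NBody.massEquiv_mem_roundCone hm).1 (by rwa [← hΦ, Φ.apply_symm_apply]), hc⟩
    rw [hβ, Set.mem_singleton_iff, Φ.symm.map_eq_zero_iff] at h2
    have h3 := S.ρ_pos.trans_le hz.2
    rw [h2, map_zero] at h3
    exact h3.false
  have hU : ∀ z ∈ S.region, NBody.potential m (Φ.symm z) = ENNReal.ofReal (S.u z) := by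
    intro z hz
    rw [hSu, NBody.potential_eq_ofReal hm (hfree z hz)]
  have hnorm : NBody.massNorm m a = ‖S.a‖ := by rw [hSa, hΦ, NBody.norm_massEquiv hm]
  obtain ⟨hxα, hxr⟩ := hcut.1 hx
  have hxR := NBody.FarField.mem_region_of_mem hS hr hxα hxr
  have hsol := NBody.FarField.sol_ray NBody.FarField.norm_center_sub_le hxR
  have hcone := fun t ht => NBody.FarField.ray_mem_cone hS hxα hxR (t := t) ht
  have hreg : ∀ t, 0 ≤ t → NBody.FarField.ray S S.a (Φ x) t ∈ S.region := fun t ht =>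
    NBody.FarField.mem_region_of_mem hS hr (hcone t ht).1 (hxr.trans (hcone t ht).2)
  have hmin := NBody.FarField.isMinimizing_ray hS hU hr hxα hxr
  have heq : ∀ {η : ℝ → Fin N → E}, η 0 = x →
      (∀ t, 0 ≤ t → Φ (η t) = NBody.FarField.ray S S.a (Φ (η 0)) t) →
      Set.EqOn η (fun t => Φ.symm (NBody.FarField.ray S S.a (Φ x) t)) (Set.Ici 0) := by
    intro η h0 h t ht
    show η t = Φ.symm _
    rw [← h0, ← h t ht, Φ.symm_apply_apply]
  have hlim : NBody.HasLimitShape (fun t => Φ.symm (NBody.FarField.ray S S.a (Φ x) t)) a := by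
    rw [NBody.hasLimitShape_iff hm]
    simp only [← hΦ, Φ.apply_symm_apply, ← hSa]
    exact NBody.FarField.ray_limitShape hxR
  have hγ0 : Φ.symm (NBody.FarField.ray S S.a (Φ x) 0) = x := by
    rw [hsol.init, Φ.symm_apply_apply]
  refine ⟨fun t => Φ.symm (NBody.FarField.ray S S.a (Φ x) t),
    ⟨⟨⟨fun t ht => hfree _ (hreg t ht),
      fun t => Φ.symm (NBody.FarField.rayVel S S.a (Φ x) t), fun t ht => ⟨?_, ?_⟩⟩, hlim⟩, hγ0,
      fun t ht => ?_⟩, ?_, ⟨?_, hlim⟩, ?_⟩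
  · exact Φ.symm.hasFDerivAt.comp_hasDerivWithinAt t (hsol.deriv_pos t ht)
  · have h1 := Φ.symm.hasFDerivAt.comp_hasDerivWithinAt t (hsol.deriv_vel t ht)
    simp only [hSF, Φ.symm_apply_apply, ContinuousLinearEquiv.coe_coe] at h1
    exact h1
  · rw [hcut, Φ.apply_symm_apply]
    exact ⟨(hcone t ht).1, hxr.trans (hcone t ht).2⟩
  · rintro η ⟨⟨-, w, hw⟩, hl⟩ h0 hη
    rw [NBody.hasLimitShape_iff hm, ← hΦ, ← hSa] at hl
    refine heq h0 fun t ht => NBody.FarField.eq_ray_of_motion hS hr hr0 hr1 (η := fun t => Φ (η t))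
      (w := fun t => Φ (w t)) (fun t ht => Φ.hasFDerivAt.comp_hasDerivWithinAt t (hw t ht).1)
      (fun t ht => ?_) (fun t ht => (hcut.1 (hη t ht)).1) (fun t ht => (hcut.1 (hη t ht)).2) hl ht
    have h1 := Φ.hasFDerivAt.comp_hasDerivWithinAt t (hw t ht).2
    simp only [hSF, Φ.symm_apply_apply]
    exact h1
  · refine NBody.isGeodesicRay_of_isMinimizing hm ?_ ?_
    · rw [hU _ (hreg 0 le_rfl)]
      exact ENNReal.ofReal_ne_top
    · simp only [← hΦ, Φ.apply_symm_apply, hnorm]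
      exact hmin
  · intro η hη h0 hl
    rw [NBody.hasLimitShape_iff hm, ← hΦ, ← hSa] at hl
    rw [hnorm] at hη
    have h1 := hη.isMinimizing hm
    exact heq h0 fun t ht => NBody.FarField.eq_ray_of_isMinimizing hS hU hr
      (η := fun t => Φ (η t)) (by rw [h0]; exact hxα) (by rw [h0]; exact hxr) h1 hl ht
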